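/- Let $\Omega\subset\mathbb R^3$ be a bounded domain with boundary of class $C^2$, $T>0$, $k>0$, and write $\mathcal S$ for the symmetric real $3\times3$ matrices, $A:B=\sum_{i,j}A_{ij}B_{ij}$, $|A|=(A:A)^{1/2}$, $PA=A-\frac13\operatorname{tr}(A)I$, $\varepsilon(u)=\frac12(\nabla u+\nabla^Tu)$. Let $\mathbb D:\mathcal S\to\mathcal S$ be linear, symmetric and positive definite. Let $f:\mathbb R\to\mathbb R$ be continuous with $|f(r)|\le a+M|r|^{\alpha}$ for all $r\in\mathbb R$, for some $a,M\ge0$ and $\alpha\in(\frac12,\frac56)$, and $|f(r)|\le C_0(1+|r|)^{1/2}$ for all $r<0$, for some $C_0>0$. Let $F\in L^2(0,T;L^2(\Omega;\mathbb R^3))$, $g_\theta\in H^1(0,T;L^2(\partial\Omega))$, $u_0\in H^1(\Omega;\mathbb R^3)$, $\varepsilon^{p,0}\in L^2(\Omega;\mathcal S)$, $\theta_0\in H^1(\Omega)$. Let $\tilde\theta\in L^\infty(0,T;H^1(\Omega))\cap H^1(0,T;L^2(\Omega))$ be the weak solution of $\tilde\theta_t-\Delta\tilde\theta=0$ in $\Omega\times(0,T)$,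 $\partial\tilde\theta/\partial n=g_\theta$ on $\partial\Omega\times(0,T)$, $\tilde\theta(0)=0$. For $\lambda>0$ let $\mathcal T_{1/\lambda}(r)=\min\{1/\lambda,\max(r,-1/\lambda)\}$ and $Y_\lambda(A)=\frac{(|PA|-k)_+}{2\lambda}\frac{PA}{|PA|}$ (with $Y_\lambda(A)=0$ if $PA=0$), and consider the approximate problem for $(u^\lambda,\tau^\lambda,\varepsilon^{p,\lambda},\theta^\lambda)$ in $\Omega\times(0,T)$: $$\operatorname{div}\big(\tau^\lambda-f(\mathcal T_{1/\lambda}(\theta^\lambda+\tilde\theta))I\big)=-F-\operatorname{div}\mathbb D(\varepsilon(u^\lambda_t)),\qquad \tau^\lambda=\mathbb D(\varepsilon(u^\lambda)-\varepsilon^{p,\lambda}),\qquad \varepsilon^{p,\lambda}_t=Y_\lambda(\tau^\lambda),$$ $$\theta^\lambda_t-\Delta\theta^\lambda=-f(\mathcal T_{1/\lambda}(\theta^\lambda+\tilde\theta))\operatorname{div}u^\lambda_t+\mathcal T_{1/\lambda}(\varepsilon^{p,\lambda}_t:\tau^\lambda),$$ with $u^\lambda=0$ and $\partial\theta^\lambda/\partial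 n=0$ on $\partial\Omega\times(0,T)$, and $u^\lambda(0)=u_0$, $\varepsilon^{p,\lambda}(0)=\varepsilon^{p,0}$, $\theta^\lambda(0)=\theta_0$. A solution is understood in the class $u^\lambda\in H^1(0,T;H^1_0(\Omega;\mathbb R^3))$, $\varepsilon^{p,\lambda}\in H^1(0,T;L^2(\Omega;\mathcal S))$, $\theta^\lambda\in L^2(0,T;H^1(\Omega))\cap H^1(0,T;L^2(\Omega))$, with the first equation in the sense of distributions in $\Omega$ for a.e. $t$, the second and third almost everywhere, and the heat equation with its Neumann condition in the weak form, tested with all functions of $H^1(\Omega)$, for a.e. $t$. Then for every $q$ with $1\le q<\frac54$ there is a constant $C$, which may depend on $q$ and on all the data above but not on $\lambda$, such that for every $\lambda>0$ and every such solution, $\theta^\lambda\in L^q(0,T;W^{1,q}(\Omega))$ and $\|\theta^\lambda\|_{L^q(0,T;W^{1,q}(\Omega))}\le C$. -/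

import Mathlib

open MeasureTheory Set Filter Topology
open scoped ENNReal NNReal ContDiff

namespace ThermoPlasticity

noncomputable section

/-- The physical space `ℝ³` with its Euclidean norm. -/
abbrev E3 : Type := EuclideanSpace ℝ (Fin 3)

/-- Real `3 × 3` matrices. -/
abbrev Mat : Type := Matrix (Fin 3) (Fin 3) ℝ

/-! ### Matrix algebra -/

/-- The Frobenius product `A : B`. -/
def frob (A B : Mat) : ℝ := ∑ i, ∑ j, A i j * B i j

/-- The Frobenius norm `|A|`. -/
def frobNorm (A : Mat) : ℝ := √(frob A A)

/-- The deviatoric part `P A = A - (1/3) tr(A) I`. -/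
def dev (A : Mat) : Mat := A - (A.trace / 3) • (1 : Mat)

/-- The symmetric part of a gradient; `D i` is the gradient of the `i`-th component,
so that `D i j = ∂ⱼ uᵢ`. -/
def symGrad (D : Fin 3 → E3) : Mat := Matrix.of fun i j => (D i j + D j i) / 2

/-- The divergence `∑ᵢ ∂ᵢ uᵢ`, with the same convention for `D`. -/
def divergence (D : Fin 3 → E3) : ℝ := ∑ i, D i i

/-- Truncation at height `K`. -/
def trunc (K r : ℝ) : ℝ := min K (max r (-K))

/-- The Yosida approximation `Y_λ(A) = (|PA| - k)₊ / (2λ) · PA / |PA|`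
(and `0` if `PA = 0`, in agreement with division by zero). -/
def yosida (k lam : ℝ) (A : Mat) : Mat :=
  (max (frobNorm (dev A) - k) 0 / (2 * lam) / frobNorm (dev A)) • dev A

/-! ### Domains and Sobolev spaces on a domain -/

/-- The boundary of `Ω` is of class `C²`: near each boundary point, after an orthogonal change
of coordinates, `Ω` is the set of points above the graph of a `C²` function of two variables. -/
def HasC2Boundary (Ω : Set E3) : Prop :=
  ∀ x₀ ∈ frontier Ω, ∃ r : ℝ, 0 < r ∧ ∃ (e : E3 ≃ₗᵢ[ℝ] E3) (γ : EuclideanSpace ℝ (Fin 2) → ℝ),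
    ContDiff ℝ 2 γ ∧
      Ω ∩ Metric.ball x₀ r = {x ∈ Metric.ball x₀ r | γ !₂[e x 0, e x 1] < e x 2}

/-- `φ ∈ C_c^∞(Ω)`. -/
def IsTest {X : Type*} [NormedAddCommGroup X] [NormedSpace ℝ X] (Ω : Set E3) (φ : E3 → X) :
    Prop :=
  ContDiff ℝ ∞ φ ∧ HasCompactSupport φ ∧ tsupport φ ⊆ Ω

/-- `G` is the weak (distributional) gradient of `v` in `Ω`. -/
def HasWeakGrad (Ω : Set E3) (v : E3 → ℝ) (G : E3 → E3) : Prop :=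
  LocallyIntegrableOn v Ω ∧ LocallyIntegrableOn G Ω ∧
    ∀ φ : E3 → ℝ, IsTest Ω φ → ∫ x in Ω, v x • gradient φ x = -∫ x in Ω, φ x • G x

/-- `v ∈ H¹(Ω)`, with weak gradient `G`. -/
def MemH1 (Ω : Set E3) (v : E3 → ℝ) (G : E3 → E3) : Prop :=
  MemLp v 2 (volume.restrict Ω) ∧ MemLp G 2 (volume.restrict Ω) ∧ HasWeakGrad Ω v G

/-- `v ∈ H¹₀(Ω)`, with weak gradient `G`: the pair is an `L²`-limit of pairs `(φₙ, ∇φₙ)` with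
`φₙ ∈ C_c^∞(Ω)`. -/
def MemH10 (Ω : Set E3) (v : E3 → ℝ) (G : E3 → E3) : Prop :=
  MemLp v 2 (volume.restrict Ω) ∧ MemLp G 2 (volume.restrict Ω) ∧
    ∃ φ : ℕ → E3 → ℝ, (∀ n, IsTest Ω (φ n)) ∧
      Tendsto (fun n => eLpNorm (fun x => φ n x - v x) 2 (volume.restrict Ω)) atTop (𝓝 0) ∧
      Tendsto (fun n => eLpNorm (fun x => gradient (φ n) x - G x) 2 (volume.restrict Ω))
        atTop (𝓝 0)

/-! ### Functions of time and space

A function of time and space is a map `v : ℝ → E3 → X`; only its values for `0 < t < T` and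
for `x` in the domain (up to null sets) matter. -/

/-- The measure `dt ⊗ μ` on `(0, T) × ℝ³`. -/
def cyl (T : ℝ) (μ : Measure E3) : Measure (ℝ × E3) := (volume.restrict (Ioo 0 T)).prod μ

/-- `v ∈ L²(0,T;L²(μ))`. -/
def MemL2L2 {X : Type*} [NormedAddCommGroup X] (T : ℝ) (μ : Measure E3) (v : ℝ → E3 → X) :
    Prop :=
  MemLp (fun p : ℝ × E3 => v p.1 p.2) 2 (cyl T μ)

/-- `v ∈ H¹(0,T;L²(μ))` with initial value `v(0) = v₀` and time derivative `v'`: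
`v₀ ∈ L²(μ)`, `v' ∈ L²(0,T;L²(μ))` and `v(t) = v₀ + ∫₀ᵗ v'(s) ds` almost everywhere. -/
def HasTimeDeriv {X : Type*} [NormedAddCommGroup X] [NormedSpace ℝ X] (T : ℝ) (μ : Measure E3)
    (v₀ : E3 → X) (v v' : ℝ → E3 → X) : Prop :=
  MemLp v₀ 2 μ ∧ MemL2L2 T μ v' ∧
    ∀ᵐ p ∂(cyl T μ), v p.1 p.2 = v₀ p.2 + ∫ s in (0 : ℝ)..p.1, v' s p.2

/-- `v ∈ L²(0,T;H¹(Ω))`, with spatial weak gradient `G`. -/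
def MemL2H1 (T : ℝ) (Ω : Set E3) (v : ℝ → E3 → ℝ) (G : ℝ → E3 → E3) : Prop :=
  MemL2L2 T (volume.restrict Ω) v ∧ MemL2L2 T (volume.restrict Ω) G ∧
    ∀ᵐ t ∂(volume.restrict (Ioo 0 T)), MemH1 Ω (v t) (G t)

/-- `v ∈ H¹(0,T;H¹₀(Ω))` with `v(0) = v₀` and time derivative `v'`; `G` and `G'` are the spatial
gradients of `v` and `v'`. -/
def MemH1H10 (T : ℝ) (Ω : Set E3) (v₀ : E3 → ℝ) (v : ℝ → E3 → ℝ) (G : ℝ → E3 → E3)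
    (v' : ℝ → E3 → ℝ) (G' : ℝ → E3 → E3) : Prop :=
  HasTimeDeriv T (volume.restrict Ω) v₀ v v' ∧
    (∃ G₀ : E3 → E3, MemH1 Ω v₀ G₀ ∧ HasTimeDeriv T (volume.restrict Ω) G₀ G G') ∧
    (∀ᵐ t ∂(volume.restrict (Ioo 0 T)), MemH10 Ω (v t) (G t)) ∧
    ∀ᵐ t ∂(volume.restrict (Ioo 0 T)), MemH10 Ω (v' t) (G' t)

/-- The norm of `L^q(0,T;W^{1,q}(Ω))` of a function `v` with spatial weak gradient `G`:
`(∫₀ᵀ (‖v(t)‖_{L^q(Ω)}^q + ‖G(t)‖_{L^q(Ω)}^q) dt)^{1/q}`. -/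
def normLqW1q (T : ℝ) (Ω : Set E3) (q : ℝ) (v : ℝ → E3 → ℝ) (G : ℝ → E3 → E3) : ℝ≥0∞ :=
  (∫⁻ t in Ioo 0 T, ((∫⁻ x in Ω, ‖v t x‖ₑ ^ q) + ∫⁻ x in Ω, ‖G t x‖ₑ ^ q)) ^ (1 / q)

/-- `v ∈ L^q(0,T;W^{1,q}(Ω))`, with spatial weak gradient `G`. -/
def MemLqW1q (T : ℝ) (Ω : Set E3) (q : ℝ) (v : ℝ → E3 → ℝ) (G : ℝ → E3 → E3) : Prop :=
  AEStronglyMeasurable (fun p : ℝ × E3 => v p.1 p.2) (cyl T (volume.restrict Ω)) ∧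
    AEStronglyMeasurable (fun p : ℝ × E3 => G p.1 p.2) (cyl T (volume.restrict Ω)) ∧
    (∀ᵐ t ∂(volume.restrict (Ioo 0 T)), HasWeakGrad Ω (v t) (G t)) ∧
    normLqW1q T Ω q v G < ⊤

/-! ### The model -/

/-- The data of the problem. -/
structure Model where
  /-- the body -/
  Ω : Set E3
  /-- the length of the time interval -/
  T : ℝ
  /-- the elasticity tensor (only its values on symmetric matrices matter) -/
  D : Mat →ₗ[ℝ] Mat
  /-- the yield limit -/
  k : ℝ
  /-- the thermal part of the stress -/
  f : ℝ → ℝ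
  /-- the external force -/
  F : ℝ → E3 → E3
  /-- the Neumann datum for the temperature -/
  gθ : ℝ → E3 → ℝ
  /-- the initial displacement -/
  u₀ : E3 → E3
  /-- the initial inelastic strain -/
  εp₀ : E3 → Mat
  /-- the initial temperature -/
  θ₀ : E3 → ℝ

namespace Model

/-- Lebesgue measure on `Ω`. -/
def vol (P : Model) : Measure E3 := volume.restrict P.Ω

/-- Surface measure on `∂Ω`. -/
def surf (P : Model) : Measure E3 := (μHE[2]).restrict (frontier P.Ω)

/-- The standing assumptions on the data. -/
structure Admissible (P : Model) : Prop where
  isOpen : IsOpen P.Ω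
  isConnected : IsConnected P.Ω
  isBounded : Bornology.IsBounded P.Ω
  c2Boundary : HasC2Boundary P.Ω
  T_pos : 0 < P.T
  D_symm_mem : ∀ A : Mat, A.IsSymm → (P.D A).IsSymm
  D_symmetric : ∀ A B : Mat, A.IsSymm → B.IsSymm → frob (P.D A) B = frob A (P.D B)
  D_posDef : ∀ A : Mat, A.IsSymm → A ≠ 0 → 0 < frob (P.D A) A
  k_pos : 0 < P.k
  f_continuous : Continuous P.f
  f_growth : ∃ a M α : ℝ, 0 ≤ a ∧ 0 ≤ M ∧ 1 / 2 < α ∧ α < 5 / 6 ∧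
    ∀ r : ℝ, |P.f r| ≤ a + M * |r| ^ α
  f_growth_neg : ∃ C : ℝ, 0 < C ∧ ∀ r : ℝ, r < 0 → |P.f r| ≤ C * (1 + |r|) ^ (1 / 2 : ℝ)
  F_mem : MemL2L2 P.T P.vol P.F
  gθ_mem : ∃ (g₀ : E3 → ℝ) (g' : ℝ → E3 → ℝ), HasTimeDeriv P.T P.surf g₀ P.gθ g'
  u₀_mem : ∀ i, ∃ G : E3 → E3, MemH1 P.Ω (fun x => P.u₀ x i) G
  εp₀_mem : ∀ i j, MemLp (fun x => P.εp₀ x i j) 2 P.vol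
  εp₀_symm : ∀ᵐ x ∂P.vol, (P.εp₀ x).IsSymm
  θ₀_mem : ∃ G : E3 → E3, MemH1 P.Ω P.θ₀ G

/-- `θb ∈ L^∞(0,T;H¹(Ω)) ∩ H¹(0,T;L²(Ω))` is the (weak) solution of the heat equation
`∂ₜθb - Δθb = 0` in `Ω × (0,T)` with `∂θb/∂n = gθ` on `∂Ω × (0,T)` and `θb(0) = 0`.
The test functions are the restrictions to `Ω` of smooth functions on `ℝ³`, which are dense in
`H¹(Ω)`. -/
def IsBoundaryLift (P : Model) (θb : ℝ → E3 → ℝ) : Prop :=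
  ∃ (θb' : ℝ → E3 → ℝ) (G : ℝ → E3 → E3),
    HasTimeDeriv P.T P.vol 0 θb θb' ∧
    MemL2H1 P.T P.Ω θb G ∧
    (∃ B : ℝ≥0, ∀ᵐ t ∂(volume.restrict (Ioo 0 P.T)),
      eLpNorm (θb t) 2 P.vol + eLpNorm (G t) 2 P.vol ≤ B) ∧
    ∀ᵐ t ∂(volume.restrict (Ioo 0 P.T)), ∀ φ : E3 → ℝ, ContDiff ℝ ∞ φ →
      (∫ x, θb' t x * φ x ∂P.vol) + ∫ x, inner ℝ (G t x) (gradient φ x) ∂P.vol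
        = ∫ x, P.gθ t x * φ x ∂P.surf

/-- The equations of the approximate problem with parameter `lam` for the displacement `u`, the
stress `τ`, the inelastic strain `εp` and the temperature `θ` (after subtraction of `θb`). Here
`u'`, `εp'`, `θ'` are the time derivatives and `Du`, `Du'`, `Gθ` the spatial gradients. -/
structure SolvesApprox (P : Model) (θb : ℝ → E3 → ℝ) (lam : ℝ)
    (u : ℝ → E3 → E3) (τ εp : ℝ → E3 → Mat) (θ : ℝ → E3 → ℝ)
    (u' : ℝ → E3 → E3) (Du Du' : ℝ → E3 → Fin 3 → E3) (εp' : ℝ → E3 → Mat)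
    (θ' : ℝ → E3 → ℝ) (Gθ : ℝ → E3 → E3) : Prop where
  /-- `u ∈ H¹(0,T;H¹₀(Ω;ℝ³))` and `u(0) = u₀` -/
  u_mem : ∀ i, MemH1H10 P.T P.Ω (fun x => P.u₀ x i) (fun t x => u t x i) (fun t x => Du t x i)
    (fun t x => u' t x i) (fun t x => Du' t x i)
  /-- `εp ∈ H¹(0,T;L²(Ω))` and `εp(0) = εp₀` -/
  εp_mem : ∀ i j, HasTimeDeriv P.T P.vol (fun x => P.εp₀ x i j) (fun t x => εp t x i j)
    (fun t x => εp' t x i j)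
  εp_symm : ∀ᵐ p ∂(cyl P.T P.vol), (εp p.1 p.2).IsSymm
  /-- `θ ∈ H¹(0,T;L²(Ω))` and `θ(0) = θ₀` -/
  θ_time : HasTimeDeriv P.T P.vol P.θ₀ θ θ'
  /-- `θ ∈ L²(0,T;H¹(Ω))` -/
  θ_space : MemL2H1 P.T P.Ω θ Gθ
  /-- `τ = D(ε(u) - εp)` -/
  stress : ∀ᵐ p ∂(cyl P.T P.vol), τ p.1 p.2 = P.D (symGrad (Du p.1 p.2) - εp p.1 p.2)
  /-- `∂ₜεp = Y_λ(τ)` -/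
  flow : ∀ᵐ p ∂(cyl P.T P.vol), εp' p.1 p.2 = yosida P.k lam (τ p.1 p.2)
  /-- `div σ = -F - div D(ε(u'))` in the sense of distributions in `Ω`, where
  `σ = τ - f(TC_{1/λ}(θ + θb)) I` -/
  momentum : ∀ᵐ t ∂(volume.restrict (Ioo 0 P.T)), ∀ w : E3 → E3, IsTest P.Ω w →
    ∫ x, frob ((τ t x - P.f (trunc (1 / lam) (θ t x + θb t x)) • (1 : Mat))
        + P.D (symGrad (Du' t x)))
      (symGrad fun i => gradient (fun y => w y i) x) ∂P.vol
      = ∫ x, inner ℝ (P.F t x) (w x) ∂P.vol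
  /-- `∂ₜθ - Δθ = -f(TC_{1/λ}(θ + θb)) div u' + TC_{1/λ}(∂ₜεp : τ)` with `∂θ/∂n = 0` on `∂Ω`,
  in the weak form -/
  heat : ∀ᵐ t ∂(volume.restrict (Ioo 0 P.T)), ∀ (φ : E3 → ℝ) (Gφ : E3 → E3), MemH1 P.Ω φ Gφ →
    (∫ x, θ' t x * φ x ∂P.vol) + ∫ x, inner ℝ (Gθ t x) (Gφ x) ∂P.vol
      = ∫ x, (-P.f (trunc (1 / lam) (θ t x + θb t x)) * divergence (Du' t x)
          + trunc (1 / lam) (frob (εp' t x) (τ t x))) * φ x ∂P.vol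

/-- `(u, τ, εp, θ)` is a solution of the approximate problem with parameter `lam`. -/
def IsApproxSolution (P : Model) (θb : ℝ → E3 → ℝ) (lam : ℝ)
    (u : ℝ → E3 → E3) (τ εp : ℝ → E3 → Mat) (θ : ℝ → E3 → ℝ) : Prop :=
  ∃ (u' : ℝ → E3 → E3) (Du Du' : ℝ → E3 → Fin 3 → E3) (εp' : ℝ → E3 → Mat)
    (θ' : ℝ → E3 → ℝ) (Gθ : ℝ → E3 → E3),
    P.SolvesApprox θb lam u τ εp θ u' Du Du' εp' θ' Gθ

end Model

end

end ThermoPlasticity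

/-! The bound combines two tests of the system. The parameter `lam` enters only through `trunc`,
which keeps the sign and does not increase the modulus, and through the Yosida flow rule, of which
only the symmetry and the sign of `εp' : τ` are used in the estimates. All constants are therefore
independent of `lam`.

Write J(s) = √(1 + s²) (`bracket`) and χ = J′, so χ(s) = s / J(s). The momentum balance tested with
the velocity makes the elastic energy telescope. After Poincaré absorbs the force, the viscous term
and the dissipation are bounded by a constant plus ∫∫ f div u′ (`exists_mechanical_estimate`). The
heat equation tested with χ(θ) is added to this. The truncated dissipation is nonnegative and at
most the mechanical one, and χ ≤ 1, so the dissipation terms drop out and what remains is ∫∫ f (1 -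
χ(θ)) div u′. For large positive θ the factor 1 - χ ≤ 1/(1 + θ²) defeats the growth of f. For
negative θ the factor is only bounded, and this is where growth of order 1/2 is needed. In all cases
f² (1 - χ)² ≤ K (J(θ) + θb²), with θb the boundary lift. Young and Grönwall then give bounds for
J(θ) in L^∞(0,T;L¹) and for ε(u′) in L² (`exists_energy_estimate`).

The second step is of Boccardo-Gallouët type. Testing with a bounded ψ(θ), where ψ′ = J^{-(1+ν)},
bounds I = ∫∫ J(θ)^{-(1+ν)} |∇θ|² by C (1 + ∫∫ |f div u′|) (`exists_gradient_estimate`). In space,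
the embedding of W^{1,1} into L^{3/2}, applied to J(θ)^{4/3-ν} and interpolated with the L¹ bound,
controls ∫ J(θ)^{5/3-ν} linearly by the same weighted gradient integral
(`lintegral_bracket_rpow_le`). Since 2α < 5/3, for small ν the integral of f² is controlled by X =
∫∫ J(θ)^{5/3-ν}. Young with a small weight lets X absorb itself and closes the loop
(`exists_temperature_estimate`). A pointwise Young inequality turns X and I into a bound for |∇θ|^q
exactly when ν ≤ 5/3 - 4q/3, and such ν > 0 exist because q < 5/4.

The Sobolev tools are proved along lines. A function with an integrable weak derivative in a
direction is, after a cutoff, absolutely continuous on almost every line in that direction. This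
yields the chain rule for weak gradients. It also yields the Sobolev inequality up to the boundary
without an extension operator: near a boundary point there are three independent directions along
which Ω can be left only by leaving a ball, so the cut-off function is bounded by integrals over
half-lines, and the grid-lines inequality applies. -/

namespace ThermoPlasticity

/-! ### Calculus on the line for absolutely continuous functions -/

/-- Composition of an absolutely continuous function with a `C¹` function. -/
theorem absolutelyContinuousOnInterval_comp {ψ g : ℝ → ℝ} {a b : ℝ} (hψ : ContDiff ℝ 1 ψ)
    (hg : AbsolutelyContinuousOnInterval g a b) :
    AbsolutelyContinuousOnInterval (fun t => ψ (g t)) a b := by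
  obtain ⟨M, hM⟩ := hg.exists_bound
  obtain ⟨K, hK⟩ := (hψ.contDiffOn (s := Icc (-M) M)).exists_lipschitzOnWith
    (by decide) (convex_Icc _ _) isCompact_Icc
  rw [absolutelyContinuousOnInterval_iff] at hg ⊢
  intro ε hε
  obtain ⟨δ, hδ, h⟩ := hg (ε / (K + 1)) (by positivity)
  refine ⟨δ, hδ, fun E hE hE' => ?_⟩
  have hmem : ∀ t ∈ uIcc a b, g t ∈ Icc (-M) M := fun t ht => abs_le.1 (hM t ht)
  calc ∑ i ∈ Finset.range E.1, dist (ψ (g (E.2 i).1)) (ψ (g (E.2 i).2))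
      ≤ ∑ i ∈ Finset.range E.1, K * dist (g (E.2 i).1) (g (E.2 i).2) := by
        refine Finset.sum_le_sum fun i hi => ?_
        exact hK.dist_le_mul _ (hmem _ (hE.1 i hi).1) _ (hmem _ (hE.1 i hi).2)
    _ = K * ∑ i ∈ Finset.range E.1, dist (g (E.2 i).1) (g (E.2 i).2) := by
        rw [Finset.mul_sum]
    _ ≤ K * (ε / (K + 1)) := by
        gcongr
        exact (h E hE hE').le
    _ < (K + 1) * (ε / (K + 1)) := by gcongr; linarith
    _ = ε := by field

theorem absolutelyContinuousOnInterval_primitive {g' : ℝ → ℝ} {a b : ℝ} (c : ℝ)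
    (hg : IntervalIntegrable g' volume a b) :
    AbsolutelyContinuousOnInterval (fun t => c + ∫ s in a..t, g' s) a b := by
  have h1 : AbsolutelyContinuousOnInterval (fun _ : ℝ => c) a b :=
    (contDiff_const (n := 1)).contDiffOn.absolutelyContinuousOnInterval
  exact h1.add (hg.absolutelyContinuousOnInterval_intervalIntegral (c := a) (by simp))

/-- Chain and product rule for the primitive of an integrable function. -/
theorem integral_deriv_comp_primitive_mul {ψ φ g' : ℝ → ℝ} {a b : ℝ} (c : ℝ)
    (hψ : ContDiff ℝ 1 ψ) (hφ : ContDiff ℝ 1 φ) (hg : IntervalIntegrable g' volume a b) :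
    ∫ t in a..b, (deriv ψ (c + ∫ s in a..t, g' s) * g' t * φ t
        + ψ (c + ∫ s in a..t, g' s) * deriv φ t)
      = ψ (c + ∫ s in a..b, g' s) * φ b - ψ c * φ a := by
  have hAC := absolutelyContinuousOnInterval_primitive c hg
  have h1 := absolutelyContinuousOnInterval_comp hψ hAC
  have h2 : AbsolutelyContinuousOnInterval φ a b :=
    hφ.contDiffOn.absolutelyContinuousOnInterval
  have h := h1.integral_deriv_mul_eq_sub h2
  simp only [intervalIntegral.integral_same, add_zero] at h
  rw [← h]
  refine intervalIntegral.integral_congr_ae ?_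
  filter_upwards [hg.ae_hasDerivAt_integral] with t ht ht'
  have h3 := (ht (uIoc_subset_uIcc ht') a (by simp)).const_add c
  have h4 := ((hψ.differentiable (by simp)) (c + ∫ s in a..t, g' s)).hasDerivAt.comp t h3
  have h5 : deriv (fun t => ψ (c + ∫ s in a..t, g' s)) t
      = deriv ψ (c + ∫ s in a..t, g' s) * g' t := h4.deriv
  rw [h5]

/-- Chain rule for the primitive of an integrable function. -/
theorem integral_deriv_comp_primitive {ψ g' : ℝ → ℝ} {a b : ℝ} (c : ℝ)
    (hψ : ContDiff ℝ 1 ψ) (hg : IntervalIntegrable g' volume a b) :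
    ∫ t in a..b, deriv ψ (c + ∫ s in a..t, g' s) * g' t
      = ψ (c + ∫ s in a..b, g' s) - ψ c := by
  have := integral_deriv_comp_primitive_mul (φ := fun _ => 1) c hψ contDiff_const hg
  simpa using this

/-- Product rule for the primitives of two integrable functions. -/
theorem integral_primitive_mul_primitive {g' h' : ℝ → ℝ} {a b : ℝ} (c d : ℝ)
    (hg : IntervalIntegrable g' volume a b) (hh : IntervalIntegrable h' volume a b) :
    ∫ t in a..b, (g' t * (d + ∫ s in a..t, h' s) + (c + ∫ s in a..t, g' s) * h' t)
      = (c + ∫ s in a..b, g' s) * (d + ∫ s in a..b, h' s) - c * d := by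
  have h := (absolutelyContinuousOnInterval_primitive c hg).integral_deriv_mul_eq_sub
    (absolutelyContinuousOnInterval_primitive d hh)
  simp only [intervalIntegral.integral_same, add_zero] at h
  rw [← h]
  refine intervalIntegral.integral_congr_ae ?_
  filter_upwards [hg.ae_hasDerivAt_integral, hh.ae_hasDerivAt_integral] with t h1 h2 ht'
  rw [((h1 (uIoc_subset_uIcc ht') a (by simp)).const_add c).deriv,
    ((h2 (uIoc_subset_uIcc ht') a (by simp)).const_add d).deriv]

/-- Grönwall's inequality for integrable functions satisfying the integral inequality almost
everywhere. -/
theorem ae_le_of_le_integral {T C₁ C₂ : ℝ} {Y : ℝ → ℝ} (hC₁ : 0 ≤ C₁) (hC₂ : 0 ≤ C₂)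
    (hY : IntegrableOn Y (Ioo 0 T))
    (h : ∀ᵐ t ∂(volume.restrict (Ioo 0 T)), Y t ≤ C₁ + C₂ * ∫ s in (0 : ℝ)..t, Y s) :
    ∀ᵐ t ∂(volume.restrict (Ioo 0 T)), Y t ≤ C₁ * Real.exp (C₂ * T) := by
  rcases le_or_gt T 0 with hT | hT
  · simp [Ioo_eq_empty (not_lt.2 hT)]
  have hYi : IntervalIntegrable Y volume 0 T := by
    rw [intervalIntegrable_iff_integrableOn_Ioo_of_le hT.le]; exact hY
  -- `Y` is only integrable. Its majorant `R` is continuous and satisfies the same inequality for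
  -- every `t`; the next iterate `S` is then differentiable inside the interval, and the classical
  -- argument applies to it.
  set R : ℝ → ℝ := fun t => C₁ + C₂ * ∫ s in (0 : ℝ)..t, Y s with hR
  have hsub : ∀ t ∈ Icc (0 : ℝ) T, uIcc 0 t ⊆ uIcc 0 T := fun t ht => by
    rw [uIcc_of_le ht.1, uIcc_of_le hT.le]; exact Icc_subset_Icc_right ht.2
  have hprimc : ContinuousOn (fun t => ∫ s in (0 : ℝ)..t, Y s) (Icc 0 T) := by
    have := (hYi.absolutelyContinuousOnInterval_intervalIntegral (c := 0) (by simp)).continuousOn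
    rwa [uIcc_of_le hT.le] at this
  have hRc : ContinuousOn R (Icc 0 T) := continuousOn_const.add (continuousOn_const.mul hprimc)
  have hYR : ∀ᵐ t ∂(volume.restrict (Ioo 0 T)), Y t ≤ R t := h
  have hRi : IntervalIntegrable R volume 0 T := by
    apply ContinuousOn.intervalIntegrable; rwa [uIcc_of_le hT.le]
  have hRR : ∀ t ∈ Icc (0 : ℝ) T, R t ≤ C₁ + C₂ * ∫ s in (0 : ℝ)..t, R s := by
    intro t ht
    have : ∫ s in (0 : ℝ)..t, Y s ≤ ∫ s in (0 : ℝ)..t, R s := by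
      refine intervalIntegral.integral_mono_ae_restrict ht.1 (hYi.mono_set (hsub t ht))
        (hRi.mono_set (hsub t ht)) ?_
      rw [← restrict_Ioo_eq_restrict_Icc]
      exact ae_restrict_of_ae_restrict_of_subset (Ioo_subset_Ioo_right ht.2) hYR
    simp only [hR] at this ⊢
    gcongr
  set S : ℝ → ℝ := fun t => C₁ + C₂ * ∫ s in (0 : ℝ)..t, R s with hS
  have hSc : ContinuousOn S (Icc 0 T) := by
    have := (hRi.absolutelyContinuousOnInterval_intervalIntegral (c := 0) (by simp)).continuousOn
    rw [uIcc_of_le hT.le] at this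
    exact continuousOn_const.add (continuousOn_const.mul this)
  have hanti : AntitoneOn (fun t => Real.exp (-C₂ * t) * S t) (Icc 0 T) := by
    have hder : ∀ t ∈ interior (Icc (0 : ℝ) T), HasDerivAt (fun t => Real.exp (-C₂ * t) * S t)
        (Real.exp (-C₂ * t) * (-C₂) * S t + Real.exp (-C₂ * t) * (C₂ * R t)) t := by
      intro t ht
      rw [interior_Icc] at ht
      have h1 : HasDerivAt (fun t => Real.exp (-C₂ * t)) (Real.exp (-C₂ * t) * (-C₂)) t := by
        simpa using ((hasDerivAt_id t).const_mul (-C₂)).exp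
      have h2 : HasDerivAt (fun t => ∫ s in (0 : ℝ)..t, R s) (R t) t := by
        refine intervalIntegral.integral_hasDerivAt_right
          (hRi.mono_set (hsub t (Ioo_subset_Icc_self ht))) ?_
          (hRc.continuousAt (Icc_mem_nhds ht.1 ht.2))
        exact hRc.stronglyMeasurableAtFilter_nhdsWithin measurableSet_Icc t |>.filter_mono
          (by rw [nhdsWithin_eq_nhds.2 (Icc_mem_nhds ht.1 ht.2)])
      exact h1.mul ((h2.const_mul C₂).const_add C₁)
    refine antitoneOn_of_deriv_nonpos (convex_Icc _ _) ?_ ?_ ?_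
    · exact ContinuousOn.mul (by fun_prop) hSc
    · intro t ht; exact (hder t ht).differentiableAt.differentiableWithinAt
    · intro t ht
      rw [(hder t ht).deriv]
      have h3 := hRR t (interior_subset ht)
      have h4 : 0 ≤ Real.exp (-C₂ * t) * C₂ := by positivity
      nlinarith
  filter_upwards [hYR, ae_restrict_mem measurableSet_Ioo] with t ht htm
  have htI := Ioo_subset_Icc_self htm
  have h5 := hanti (left_mem_Icc.2 hT.le) htI htm.1.le
  simp only [mul_zero, Real.exp_zero, one_mul] at h5
  have h6 : S 0 = C₁ := by simp [hS]
  rw [h6] at h5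
  calc Y t ≤ R t := ht
    _ ≤ S t := hRR t htI
    _ = Real.exp (C₂ * t) * (Real.exp (-C₂ * t) * S t) := by
        rw [← mul_assoc, ← Real.exp_add]; simp
    _ ≤ Real.exp (C₂ * t) * C₁ := by gcongr
    _ ≤ Real.exp (C₂ * T) * C₁ := by
        gcongr
        exact htm.2.le
    _ = _ := mul_comm _ _

/-! ### Functions with a time derivative -/

section TimeDeriv

set_option linter.unusedSectionVars false

variable {X Y : Type*} [NormedAddCommGroup X] [NormedSpace ℝ X]
  [NormedAddCommGroup Y] [NormedSpace ℝ Y] {T : ℝ} {μ : Measure E3} [IsFiniteMeasure μ]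

instance isFiniteMeasure_cyl : IsFiniteMeasure (cyl T μ) := by
  unfold cyl
  infer_instance

theorem ae_ae_of_ae_cyl {p : ℝ × E3 → Prop} (h : ∀ᵐ z ∂(cyl T μ), p z) :
    ∀ᵐ x ∂μ, ∀ᵐ t ∂(volume.restrict (Ioo 0 T)), p (t, x) := by
  have h' : ∀ᵐ z ∂(μ.prod (volume.restrict (Ioo 0 T))), p z.swap := by
    have := (Measure.measurePreserving_swap (μ := μ)
      (ν := volume.restrict (Ioo 0 T))).quasiMeasurePreserving.ae h
    exact this
  exact Measure.ae_ae_of_ae_prod h'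

theorem MemL2L2.integrable {v : ℝ → E3 → X} (hv : MemL2L2 T μ v) :
    Integrable (fun p : ℝ × E3 => v p.1 p.2) (cyl T μ) :=
  MemLp.integrable (by norm_num) hv

theorem ae_integrableOn_of_integrable_cyl {F : ℝ → E3 → X}
    (hF : Integrable (fun p : ℝ × E3 => F p.1 p.2) (cyl T μ)) :
    ∀ᵐ x ∂μ, IntegrableOn (fun t => F t x) (Ioo 0 T) :=
  hF.prod_left_ae

theorem intervalIntegrable_of_integrableOn_Ioo {g : ℝ → X} {s : ℝ}
    (hg : IntegrableOn g (Ioo 0 T)) (h0 : 0 ≤ s) (hs : s ≤ T) :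
    IntervalIntegrable g volume 0 s := by
  rw [intervalIntegrable_iff_integrableOn_Ioo_of_le h0]
  exact hg.mono_set (Ioo_subset_Ioo_right hs)

/-- The primitive in time of an integrable function is measurable in time and space. -/
theorem aestronglyMeasurable_primitive {F : ℝ → E3 → X}
    (hF : AEStronglyMeasurable (fun p : ℝ × E3 => F p.1 p.2) (cyl T μ)) :
    AEStronglyMeasurable (fun p : ℝ × E3 => ∫ s in (0 : ℝ)..p.1, F s p.2) (cyl T μ) := by
  set W := hF.mk with hW
  have hWm : StronglyMeasurable W := hF.stronglyMeasurable_mk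
  have hm : StronglyMeasurable fun p : ℝ × E3 =>
      ∫ s, (Ioc 0 p.1).indicator (fun s => W (s, p.2)) s := by
    have : StronglyMeasurable fun z : (ℝ × E3) × ℝ =>
        {z : (ℝ × E3) × ℝ | 0 < z.2 ∧ z.2 ≤ z.1.1}.indicator (fun z => W (z.2, z.1.2)) z := by
      refine StronglyMeasurable.indicator (hWm.comp_measurable (by fun_prop)) ?_
      exact (measurableSet_lt measurable_const measurable_snd).inter
        (measurableSet_le measurable_snd (by fun_prop))
    exact this.integral_prod_right (ν := volume)
  refine ⟨_, hm, ?_⟩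
  have h1 := ae_ae_of_ae_cyl hF.ae_eq_mk
  have h2 : ∀ᵐ z ∂(cyl T μ), ∀ᵐ t ∂(volume.restrict (Ioo 0 T)), F t z.2 = W (t, z.2) :=
    Measure.quasiMeasurePreserving_snd.ae h1
  have h3 : ∀ᵐ z ∂(cyl T μ), z.1 ∈ Ioo 0 T :=
    Measure.quasiMeasurePreserving_fst.ae (ae_restrict_mem measurableSet_Ioo)
  filter_upwards [h2, h3] with z hz hz1
  rw [integral_indicator measurableSet_Ioc, intervalIntegral.integral_of_le hz1.1.le]
  refine integral_congr_ae ?_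
  rw [← restrict_Ioo_eq_restrict_Ioc]
  exact ae_restrict_of_ae_restrict_of_subset (Ioo_subset_Ioo_right hz1.2.le) hz

theorem ae_ae_of_ae_cyl' {p : ℝ × E3 → Prop} (h : ∀ᵐ z ∂(cyl T μ), p z) :
    ∀ᵐ t ∂(volume.restrict (Ioo 0 T)), ∀ᵐ x ∂μ, p (t, x) :=
  Measure.ae_ae_of_ae_prod h

theorem ae_cyl_mem_Ioo : ∀ᵐ z ∂(cyl T μ), z.1 ∈ Ioo 0 T :=
  Measure.quasiMeasurePreserving_fst.ae (ae_restrict_mem measurableSet_Ioo)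

theorem ae_cyl_of_ae_snd {p : E3 → Prop} (h : ∀ᵐ x ∂μ, p x) : ∀ᵐ z ∂(cyl T μ), p z.2 :=
  Measure.quasiMeasurePreserving_snd.ae h

theorem HasTimeDeriv.aestronglyMeasurable {v₀ : E3 → X} {v v' : ℝ → E3 → X}
    (h : HasTimeDeriv T μ v₀ v v') :
    AEStronglyMeasurable (fun p : ℝ × E3 => v p.1 p.2) (cyl T μ) := by
  refine AEStronglyMeasurable.congr (f := fun p : ℝ × E3 =>
    v₀ p.2 + ∫ s in (0 : ℝ)..p.1, v' s p.2) ?_ ?_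
  · refine AEStronglyMeasurable.add ?_ (aestronglyMeasurable_primitive h.2.1.1)
    exact h.1.1.comp_quasiMeasurePreserving Measure.quasiMeasurePreserving_snd
  · filter_upwards [h.2.2] with p hp using hp.symm

theorem HasTimeDeriv.clm_comp {v₀ : E3 → X} {v v' : ℝ → E3 → X} [CompleteSpace X] [CompleteSpace Y]
    (h : HasTimeDeriv T μ v₀ v v') (L : X →L[ℝ] Y) :
    HasTimeDeriv T μ (fun x => L (v₀ x)) (fun t x => L (v t x)) (fun t x => L (v' t x)) := by
  refine ⟨L.comp_memLp' h.1, L.comp_memLp' h.2.1, ?_⟩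
  filter_upwards [h.2.2, ae_cyl_mem_Ioo,
    ae_cyl_of_ae_snd (ae_integrableOn_of_integrable_cyl h.2.1.integrable)] with p hp hpT hpi
  rw [hp, map_add, L.intervalIntegral_comp_comm
    (intervalIntegrable_of_integrableOn_Ioo hpi hpT.1.le hpT.2.le)]

theorem HasTimeDeriv.add {v₀ w₀ : E3 → X} {v v' w w' : ℝ → E3 → X}
    (h : HasTimeDeriv T μ v₀ v v') (h' : HasTimeDeriv T μ w₀ w w') :
    HasTimeDeriv T μ (fun x => v₀ x + w₀ x) (fun t x => v t x + w t x)
      (fun t x => v' t x + w' t x) := by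
  refine ⟨h.1.add h'.1, MemLp.add h.2.1 h'.2.1, ?_⟩
  filter_upwards [h.2.2, h'.2.2, ae_cyl_mem_Ioo,
    ae_cyl_of_ae_snd (ae_integrableOn_of_integrable_cyl h.2.1.integrable),
    ae_cyl_of_ae_snd (ae_integrableOn_of_integrable_cyl h'.2.1.integrable)]
    with p hp hp' hpT hpi hpi'
  rw [hp, hp', intervalIntegral.integral_add
    (intervalIntegrable_of_integrableOn_Ioo hpi hpT.1.le hpT.2.le)
    (intervalIntegrable_of_integrableOn_Ioo hpi' hpT.1.le hpT.2.le)]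
  abel

theorem HasTimeDeriv.const_mul {v₀ : E3 → ℝ} {v v' : ℝ → E3 → ℝ}
    (h : HasTimeDeriv T μ v₀ v v') (c : ℝ) :
    HasTimeDeriv T μ (fun x => c * v₀ x) (fun t x => c * v t x) (fun t x => c * v' t x) :=
  h.clm_comp (c • ContinuousLinearMap.id ℝ ℝ)

/-- Cauchy-Schwarz, obtained from the nonnegativity of the quadratic polynomial c ↦ ∫ (c - |g|)². -/
theorem intervalIntegral_sq_le {g : ℝ → ℝ} {s : ℝ} (h0 : 0 ≤ s) (hs : s ≤ T)
    (hg : MemLp g 2 (volume.restrict (Ioo 0 T))) :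
    (∫ t in (0 : ℝ)..s, g t) ^ 2 ≤ T * ∫ t in Ioo 0 T, g t ^ 2 := by
  have hgi : IntegrableOn g (Ioo 0 T) := hg.integrable (by norm_num)
  have hg2 : IntegrableOn (fun t => g t ^ 2) (Ioo 0 T) := hg.integrable_sq
  have h1 : |∫ t in (0 : ℝ)..s, g t| ≤ ∫ t in Ioo 0 T, |g t| := by
    rw [intervalIntegral.integral_of_le h0, ← restrict_Ioo_eq_restrict_Ioc]
    refine (abs_integral_le_integral_abs).trans ?_
    exact setIntegral_mono_set hgi.abs (Eventually.of_forall fun _ => abs_nonneg _)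
      (Ioo_subset_Ioo_right hs).eventuallyLE
  have hT : 0 ≤ T := h0.trans hs
  have h2 : (∫ t in Ioo 0 T, |g t|) ^ 2 ≤ T * ∫ t in Ioo 0 T, g t ^ 2 := by
    set A := ∫ t in Ioo 0 T, |g t| with hA
    set B := ∫ t in Ioo 0 T, g t ^ 2 with hB
    have key : ∀ c : ℝ, 0 ≤ c ^ 2 * T - 2 * c * A + B := by
      intro c
      have : 0 ≤ ∫ t in Ioo 0 T, (c - |g t|) ^ 2 := integral_nonneg fun _ => sq_nonneg _
      have e : ∫ t in Ioo 0 T, (c - |g t|) ^ 2 = c ^ 2 * T - 2 * c * A + B := by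
        have : ∀ t, (c - |g t|) ^ 2 = c ^ 2 - 2 * c * |g t| + g t ^ 2 := fun t => by
          rw [sub_sq, sq_abs]
        simp_rw [this]
        have hi : Integrable (fun t => c ^ 2 - 2 * c * |g t|) (volume.restrict (Ioo 0 T)) :=
          (integrable_const _).sub (hgi.abs.const_mul _)
        rw [integral_add hi hg2,
          integral_sub (integrable_const _) (hgi.abs.const_mul _), integral_const_mul]
        simp [measureReal_restrict_apply, hT, hA, hB, mul_comm]
      linarith
    rcases hT.eq_or_lt with h | h
    · rw [hA, ← h]; simp
    -- The minimizer of the quadratic polynomial.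
    · have := key (A / T)
      have e : (A / T) ^ 2 * T - 2 * (A / T) * A + B = (T * B - A ^ 2) / T := by
        field_simp; ring
      rw [e] at this
      have := (div_nonneg_iff.1 this).resolve_right (fun h' => absurd h'.2 (not_le.2 h))
      linarith
  calc (∫ t in (0 : ℝ)..s, g t) ^ 2 = |∫ t in (0 : ℝ)..s, g t| ^ 2 := (sq_abs _).symm
    _ ≤ (∫ t in Ioo 0 T, |g t|) ^ 2 := by gcongr
    _ ≤ _ := h2

/-- Square integrability of `v` need not be assumed: pointwise v² ≤ 2 v₀² + 2T ∫ v'², and the right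
side does not depend on time. -/
theorem HasTimeDeriv.memL2L2 {v₀ : E3 → ℝ} {v v' : ℝ → E3 → ℝ}
    (h : HasTimeDeriv T μ v₀ v v') : MemL2L2 T μ v := by
  have hsq : Integrable (fun p : ℝ × E3 => v' p.1 p.2 ^ 2) (cyl T μ) :=
    MemLp.integrable_sq h.2.1
  have hm := h.aestronglyMeasurable
  rw [MemL2L2, memLp_two_iff_integrable_sq hm]
  have hdom : Integrable (fun p : ℝ × E3 =>
      2 * v₀ p.2 ^ 2 + 2 * (T * ∫ t in Ioo 0 T, v' t p.2 ^ 2)) (cyl T μ) := by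
    have h1 : Integrable (fun x => 2 * v₀ x ^ 2 + 2 * (T * ∫ t in Ioo 0 T, v' t x ^ 2)) μ :=
      (h.1.integrable_sq.const_mul 2).add ((hsq.integral_prod_right.const_mul T).const_mul 2)
    exact h1.comp_snd (volume.restrict (Ioo 0 T))
  refine hdom.mono' (hm.pow 2) ?_
  have hmem : ∀ᵐ x ∂μ, AEStronglyMeasurable (fun t => v' t x) (volume.restrict (Ioo 0 T)) :=
    (ae_integrableOn_of_integrable_cyl h.2.1.integrable).mono fun x hx => hx.1
  filter_upwards [h.2.2, ae_cyl_mem_Ioo, ae_cyl_of_ae_snd hmem,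
    ae_cyl_of_ae_snd (ae_integrableOn_of_integrable_cyl (F := fun t x => v' t x ^ 2) hsq)]
    with p hp hpT hpm hpi
  have := intervalIntegral_sq_le hpT.1.le hpT.2.le ((memLp_two_iff_integrable_sq hpm).2 hpi)
  rw [Real.norm_of_nonneg (sq_nonneg _), hp]
  nlinarith [sq_nonneg (v₀ p.2 - ∫ s in (0 : ℝ)..p.1, v' s p.2)]

/-- Integration over space of a function that is the primitive in time of an integrable
function. -/
theorem integral_of_ae_eq_primitive {w₀ : E3 → ℝ} {w F : ℝ → E3 → ℝ} (hw₀ : Integrable w₀ μ)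
    (hF : Integrable (fun p : ℝ × E3 => F p.1 p.2) (cyl T μ))
    (h : ∀ᵐ p ∂(cyl T μ), w p.1 p.2 = w₀ p.2 + ∫ s in (0 : ℝ)..p.1, F s p.2) :
    ∀ᵐ t ∂(volume.restrict (Ioo 0 T)), Integrable (w t) μ ∧
      ∫ x, w t x ∂μ = ∫ x, w₀ x ∂μ + ∫ s in (0 : ℝ)..t, ∫ x, F s x ∂μ := by
  filter_upwards [ae_ae_of_ae_cyl' h, ae_restrict_mem measurableSet_Ioo] with t ht htm
  have hFt : Integrable (fun p : ℝ × E3 => F p.1 p.2) ((volume.restrict (Ioc 0 t)).prod μ) := by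
    refine hF.mono_measure ?_
    refine Measure.prod_mono ?_ le_rfl
    rw [← restrict_Ioo_eq_restrict_Ioc]
    exact Measure.restrict_mono (Ioo_subset_Ioo_right htm.2.le) le_rfl
  have h1 : Integrable (fun x => ∫ s in (0 : ℝ)..t, F s x) μ := by
    simp_rw [intervalIntegral.integral_of_le htm.1.le]
    exact hFt.integral_prod_right
  refine ⟨(hw₀.add h1).congr ?_, ?_⟩
  · filter_upwards [ht] with x hx using hx.symm
  · rw [integral_congr_ae ht, integral_add hw₀ h1]
    congr 1
    simp_rw [intervalIntegral.integral_of_le htm.1.le]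
    exact (integral_integral_swap (f := F) hFt).symm

/-- The chain rule in time, integrated over space. -/
theorem HasTimeDeriv.integral_comp {v₀ : E3 → ℝ} {v v' : ℝ → E3 → ℝ} {ψ : ℝ → ℝ}
    (h : HasTimeDeriv T μ v₀ v v') (hψ : ContDiff ℝ 1 ψ)
    (h₀ : Integrable (fun x => ψ (v₀ x)) μ)
    (hi : Integrable (fun p : ℝ × E3 => deriv ψ (v p.1 p.2) * v' p.1 p.2) (cyl T μ)) :
    ∀ᵐ t ∂(volume.restrict (Ioo 0 T)), Integrable (fun x => ψ (v t x)) μ ∧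
      ∫ x, ψ (v t x) ∂μ = ∫ x, ψ (v₀ x) ∂μ
        + ∫ s in (0 : ℝ)..t, ∫ x, deriv ψ (v s x) * v' s x ∂μ := by
  refine integral_of_ae_eq_primitive h₀ hi ?_
  filter_upwards [h.2.2, ae_cyl_mem_Ioo, ae_cyl_of_ae_snd (ae_ae_of_ae_cyl h.2.2),
    ae_cyl_of_ae_snd (ae_integrableOn_of_integrable_cyl h.2.1.integrable)] with p hp hpT hpe hpi
  have := integral_deriv_comp_primitive (v₀ p.2) hψ
    (intervalIntegrable_of_integrableOn_Ioo hpi hpT.1.le hpT.2.le)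
  rw [← hp] at this
  rw [← sub_eq_iff_eq_add', ← this, intervalIntegral.integral_of_le hpT.1.le,
    intervalIntegral.integral_of_le hpT.1.le, ← restrict_Ioo_eq_restrict_Ioc]
  refine integral_congr_ae ?_
  filter_upwards [ae_restrict_of_ae_restrict_of_subset (Ioo_subset_Ioo_right hpT.2.le) hpe]
    with t ht
  rw [ht]

end TimeDeriv

/-! ### Test functions, cutoffs and weak directional derivatives -/

open scoped Manifold in
/-- Smooth cutoff functions. -/
theorem exists_cutoff {K U : Set E3} (hK : IsCompact K) (hU : IsOpen U) (hKU : K ⊆ U) :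
    ∃ ζ : E3 → ℝ, IsTest U ζ ∧ (∀ᶠ x in 𝓝ˢ K, ζ x = 1) ∧ ∀ x, ζ x ∈ Icc (0 : ℝ) 1 := by
  obtain ⟨L, hL, hKL, hLU⟩ := exists_compact_between hK hU hKU
  obtain ⟨f, h1, h0, h01⟩ := exists_contMDiffMap_one_nhds_of_subset_interior
    𝓘(ℝ, E3) (n := (⊤ : ℕ∞)) hK.isClosed hKL
  have hsupp : tsupport (f : E3 → ℝ) ⊆ L :=
    closure_minimal (fun x hx => by_contra fun hxL => hx (h0 x hxL)) hL.isClosed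
  exact ⟨f, ⟨f.contMDiff.contDiff, hL.of_isClosed_subset (isClosed_tsupport _) hsupp,
    hsupp.trans hLU⟩, h1, h01⟩

namespace IsTest

variable {Ω : Set E3} {φ ζ : E3 → ℝ}

theorem continuous_fderiv (hφ : IsTest Ω φ) (e : E3) : Continuous fun x => fderiv ℝ φ x e :=
  (hφ.1.continuous_fderiv (by simp)).clm_apply continuous_const

theorem hasCompactSupport_fderiv (hφ : IsTest Ω φ) (e : E3) :
    HasCompactSupport fun x => fderiv ℝ φ x e :=
  hφ.2.1.fderiv_apply ℝ e

theorem exists_bound (hφ : IsTest Ω φ) : ∃ C, ∀ x, ‖φ x‖ ≤ C :=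
  hφ.2.1.exists_bound_of_continuous hφ.1.continuous

theorem exists_bound_fderiv (hφ : IsTest Ω φ) (e : E3) : ∃ C, ∀ x, ‖fderiv ℝ φ x e‖ ≤ C :=
  (hφ.hasCompactSupport_fderiv e).exists_bound_of_continuous (hφ.continuous_fderiv e)

theorem integrable_mul {μ : Measure E3} {v : E3 → ℝ} (hφ : IsTest Ω φ) (hv : Integrable v μ) :
    Integrable (fun x => v x * φ x) μ := by
  obtain ⟨C, hC⟩ := hφ.exists_bound
  exact hv.mul_bdd hφ.1.continuous.aestronglyMeasurable (Eventually.of_forall hC)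

theorem integrable_mul_fderiv {μ : Measure E3} {v : E3 → ℝ} (hφ : IsTest Ω φ)
    (hv : Integrable v μ) (e : E3) : Integrable (fun x => v x * fderiv ℝ φ x e) μ := by
  obtain ⟨C, hC⟩ := hφ.exists_bound_fderiv e
  exact hv.mul_bdd (hφ.continuous_fderiv e).aestronglyMeasurable (Eventually.of_forall hC)

theorem translate (hφ : IsTest univ φ) (a : E3) : IsTest univ (fun x => φ (x - a)) :=
  ⟨hφ.1.comp (contDiff_id.sub contDiff_const),
    hφ.2.1.comp_homeomorph (Homeomorph.subRight a), subset_univ _⟩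

theorem univ_of (hφ : IsTest Ω φ) : IsTest univ φ := ⟨hφ.1, hφ.2.1, subset_univ _⟩

end IsTest

theorem fderiv_translate (φ : E3 → ℝ) (a x : E3) :
    fderiv ℝ (fun y => φ (y - a)) x = fderiv ℝ φ (x - a) := by
  simpa [sub_eq_add_neg] using fderiv_comp_add_right (𝕜 := ℝ) (f := φ) (x := x) (-a)

/-- `g` is the weak derivative of `v` in `Ω` in the direction `e`. -/
def HasWeakDeriv (Ω : Set E3) (e : E3) (v g : E3 → ℝ) : Prop :=
  IntegrableOn v Ω ∧ IntegrableOn g Ω ∧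
    ∀ φ : E3 → ℝ, IsTest Ω φ → ∫ x in Ω, v x * fderiv ℝ φ x e = -∫ x in Ω, g x * φ x

/-- Product of a weakly differentiable function with a cutoff function, extended by zero. -/
theorem HasWeakDeriv.integral_cutoff {Ω : Set E3} {e : E3} {v g φ ζ : E3 → ℝ} (hΩ : IsOpen Ω)
    (h : HasWeakDeriv Ω e v g) (hφ : IsTest univ φ) (hζ : IsTest univ ζ)
    (hs : tsupport ζ ∩ tsupport φ ⊆ Ω) :
    ∫ x, Ω.indicator (fun x => ζ x * v x) x * fderiv ℝ φ x e
      = -∫ x, Ω.indicator (fun x => ζ x * g x + fderiv ℝ ζ x e * v x) x * φ x := by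
  have ht : IsTest Ω (fun x => ζ x * φ x) :=
    ⟨hζ.1.mul hφ.1, hφ.2.1.mul_left,
      (subset_inter tsupport_mul_subset_left tsupport_mul_subset_right).trans hs⟩
  have hd : ∀ x, fderiv ℝ (fun x => ζ x * φ x) x e
      = ζ x * fderiv ℝ φ x e + φ x * fderiv ℝ ζ x e := fun x => by
    have := fderiv_fun_mul (hζ.1.differentiable (by simp) x) (hφ.1.differentiable (by simp) x)
    rw [this]; simp
  have hw := h.2.2 _ ht
  have e1 : ∀ x, v x * fderiv ℝ (fun x => ζ x * φ x) x e
      = ζ x * v x * fderiv ℝ φ x e + fderiv ℝ ζ x e * v x * φ x := fun x => by rw [hd]; ring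
  have hi1 : IntegrableOn (fun x => ζ x * v x) Ω := by
    refine (hζ.integrable_mul h.1).congr (Eventually.of_forall fun x => ?_)
    simp only [mul_comm]
  have hi2 : IntegrableOn (fun x => fderiv ℝ ζ x e * v x) Ω := by
    refine (hζ.integrable_mul_fderiv h.1 e).congr (Eventually.of_forall fun x => ?_)
    simp only [mul_comm]
  have hi3 : IntegrableOn (fun x => ζ x * g x) Ω := by
    refine (hζ.integrable_mul h.2.1).congr (Eventually.of_forall fun x => ?_)
    simp only [mul_comm]
  simp_rw [e1] at hw
  rw [integral_add (hφ.integrable_mul_fderiv hi1 e) (hφ.integrable_mul hi2)] at hw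
  have hind : ∀ w ψ : E3 → ℝ, ∫ x, Ω.indicator w x * ψ x = ∫ x in Ω, w x * ψ x := fun w ψ => by
    rw [← integral_indicator hΩ.measurableSet]
    simp_rw [indicator_mul_left]
  rw [hind, hind]
  simp_rw [add_mul]
  rw [integral_add (hφ.integrable_mul hi3) (hφ.integrable_mul hi2)]
  have e2 : ∫ x in Ω, g x * (ζ x * φ x) = ∫ x in Ω, ζ x * g x * φ x :=
    integral_congr_ae (Eventually.of_forall fun x => by ring)
  linarith

/-! ### Lines in a fixed direction -/

/-- For each fixed time the map is a translation of space, which preserves Lebesgue measure. -/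
theorem measurePreserving_shear (ν : Measure ℝ) [SFinite ν] (e : E3) :
    MeasurePreserving (fun p : ℝ × E3 => (p.1, p.2 + p.1 • e)) (ν.prod volume)
      (ν.prod volume) :=
  (MeasurePreserving.id ν).skew_product (by fun_prop)
    (Eventually.of_forall fun t => (measurePreserving_add_right volume (t • e)).map_eq)

/-- The difference of the values of a function at two points of a line is the integral of its
weak derivative. -/
theorem ae_sub_eq_integral {V h : E3 → ℝ} {e : E3} {U : Set E3} (hU : IsOpen U)
    (hV : Integrable V) (hh : Integrable h) {L : ℝ} (hL : 0 ≤ L)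
    (H : ∀ φ : E3 → ℝ, IsTest U φ → ∀ s ∈ Icc 0 L,
      ∫ x, V x * fderiv ℝ φ (x - s • e) e = -∫ x, h x * φ (x - s • e)) :
    ∀ᵐ x, x ∈ U → V (x + L • e) - V x = ∫ t in (0 : ℝ)..L, h (x + t • e) := by
  set ν : Measure ℝ := volume.restrict (Ioc 0 L) with hν
  have hsh : Integrable (fun p : ℝ × E3 => h (p.2 + p.1 • e)) (ν.prod volume) :=
    (measurePreserving_shear ν e).integrable_comp_of_integrable
      (g := fun p : ℝ × E3 => h p.2) (hh.comp_snd ν)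
  have hI : Integrable (fun x => ∫ t in (0 : ℝ)..L, h (x + t • e)) := by
    simp_rw [intervalIntegral.integral_of_le hL]
    exact hsh.integral_prod_right
  have hVL : Integrable (fun x => V (x + L • e)) := hV.comp_add_right _
  -- Tested with φ, the translations pass to φ. The difference φ(x) - φ(x - L e) is the integral
  -- over t of the directional derivatives of the translates of φ, and `H` applies to each of them.
  have key := hU.ae_eq_zero_of_integral_contDiff_smul_eq_zero
    (f := fun x => V (x + L • e) - V x - ∫ t in (0 : ℝ)..L, h (x + t • e))
    (((hVL.sub hV).sub hI).locallyIntegrable.locallyIntegrableOn U) ?_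
  · filter_upwards [key] with x hx hxU
    linarith [hx hxU]
  intro φ h1 h2 h3
  have hφ : IsTest U φ := ⟨h1, h2, h3⟩
  simp_rw [smul_eq_mul, mul_comm (φ _)]
  simp_rw [sub_mul]
  have hd : Integrable (fun x => V (x + L • e) * φ x - V x * φ x) :=
    (hφ.integrable_mul hVL).sub (hφ.integrable_mul hV)
  rw [integral_sub hd (hφ.integrable_mul hI), integral_sub (hφ.integrable_mul hVL) (hφ.integrable_mul hV)]
  have a1 : ∫ x, V (x + L • e) * φ x = ∫ x, V x * φ (x - L • e) := by
    rw [← integral_add_right_eq_self (fun x => V x * φ (x - L • e)) (L • e)]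
    simp
  have hb : Integrable (fun p : ℝ × E3 => h (p.2 + p.1 • e) * φ p.2) (ν.prod volume) := by
    obtain ⟨C, hC⟩ := hφ.exists_bound
    exact hsh.mul_bdd (hφ.1.continuous.comp continuous_snd).aestronglyMeasurable
      (Eventually.of_forall fun p => hC p.2)
  have a2 : ∫ x, (∫ t in (0 : ℝ)..L, h (x + t • e)) * φ x
      = ∫ t in (0 : ℝ)..L, ∫ x, h x * φ (x - t • e) := by
    simp_rw [← intervalIntegral.integral_mul_const, intervalIntegral.integral_of_le hL]
    rw [← integral_integral_swap (f := fun t x => h (x + t • e) * φ x) hb]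
    refine integral_congr_ae (Eventually.of_forall fun t => ?_)
    simp only
    rw [← integral_add_right_eq_self (fun x => h x * φ (x - t • e)) (t • e)]
    simp
  have hc : Integrable (fun p : ℝ × E3 => V p.2 * fderiv ℝ φ (p.2 - p.1 • e) e)
      (ν.prod volume) := by
    obtain ⟨C, hC⟩ := hφ.exists_bound_fderiv e
    exact (hV.comp_snd ν).mul_bdd ((hφ.continuous_fderiv e).comp
      (by fun_prop : Continuous fun p : ℝ × E3 => p.2 - p.1 • e)).aestronglyMeasurable
      (Eventually.of_forall fun p => hC _)
  have a3 : ∫ t in (0 : ℝ)..L, ∫ x, h x * φ (x - t • e)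
      = -∫ x, V x * (φ x - φ (x - L • e)) := by
    have : ∫ t in (0 : ℝ)..L, ∫ x, h x * φ (x - t • e)
        = -∫ t in (0 : ℝ)..L, ∫ x, V x * fderiv ℝ φ (x - t • e) e := by
      rw [← intervalIntegral.integral_neg]
      refine intervalIntegral.integral_congr fun t ht => ?_
      rw [uIcc_of_le hL] at ht
      rw [H φ hφ t ht, neg_neg]
    rw [this]
    congr 1
    rw [intervalIntegral.integral_of_le hL,
      integral_integral_swap (f := fun t x => V x * fderiv ℝ φ (x - t • e) e) hc]
    refine integral_congr_ae (Eventually.of_forall fun x => ?_)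
    beta_reduce
    rw [← intervalIntegral.integral_of_le hL, intervalIntegral.integral_const_mul]
    congr 1
    have hder : ∀ t : ℝ, HasDerivAt (fun t : ℝ => φ (x - t • e))
        (-fderiv ℝ φ (x - t • e) e) t := by
      intro t
      have h5 : HasDerivAt (fun t : ℝ => x - t • e) (-e) t := by
        simpa using ((hasDerivAt_id t).smul_const e).const_sub x
      have := (hφ.1.differentiable (by simp) (x - t • e)).hasFDerivAt.comp_hasDerivAt t h5
      rw [map_neg] at this
      exact this
    have := intervalIntegral.integral_eq_sub_of_hasDerivAt (a := 0) (b := L)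
      (fun t _ => hder t) (Continuous.intervalIntegrable (((hφ.continuous_fderiv e).comp
        (by fun_prop : Continuous fun t : ℝ => x - t • e)).neg) _ _)
    rw [intervalIntegral.integral_neg] at this
    simp only [zero_smul, sub_zero] at this
    linarith
  rw [a1, a2, a3]
  simp_rw [mul_sub]
  rw [integral_sub (hφ.integrable_mul hV) ((hφ.univ_of.translate _).integrable_mul hV)]
  ring

/-- The slab `0 ≤ ⟪x, e⟫ < 1`. -/
def slab (e : E3) : Set E3 := {x | inner ℝ x e ∈ Ico (0 : ℝ) 1}

theorem measurableSet_slab (e : E3) : MeasurableSet (slab e) :=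
  (by fun_prop : Measurable fun x : E3 => inner ℝ x e) measurableSet_Ico

/-- The lines in the direction `e` through the slab orthogonal to `e` sweep out the space. -/
theorem measurePreserving_slab {e : E3} (he : ‖e‖ = 1) :
    MeasurePreserving (fun p : ℝ × E3 => p.2 + p.1 • e)
      ((volume : Measure ℝ).prod (volume.restrict (slab e))) volume := by
  refine ⟨by fun_prop, ?_⟩
  ext A hA
  rw [Measure.map_apply (by fun_prop) hA]
  have h1 : (volume : Measure ℝ).prod ((volume : Measure E3).restrict (slab e))
      = (volume.prod volume).restrict (univ ×ˢ slab e) := by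
    rw [← Measure.prod_restrict, Measure.restrict_univ]
  set B : Set (ℝ × E3) := {q | q.2 - q.1 • e ∈ slab e ∧ q.2 ∈ A} with hB
  have hBm : MeasurableSet B :=
    ((by fun_prop : Measurable fun q : ℝ × E3 => q.2 - q.1 • e) (measurableSet_slab e)).inter
      (measurable_snd hA)
  have h2 : (fun p : ℝ × E3 => p.2 + p.1 • e) ⁻¹' A ∩ univ ×ˢ slab e
      = (fun p : ℝ × E3 => (p.1, p.2 + p.1 • e)) ⁻¹' B := by
    ext p; simp [hB, and_comm]
  rw [h1, Measure.restrict_apply ((by fun_prop : Measurable fun p : ℝ × E3 => p.2 + p.1 • e) hA),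
    h2, (measurePreserving_shear volume e).measure_preimage hBm.nullMeasurableSet,
    Measure.prod_apply_symm hBm]
  -- A point y lies on x + t • e with x in the slab exactly for t in a half-open interval of length
  -- 1. The thickness of the slab thus compensates for integrating over a slab instead of a
  -- hyperplane.
  have h3 : ∀ y, volume ((fun t : ℝ => (t, y)) ⁻¹' B) = A.indicator 1 y := by
    intro y
    by_cases hy : y ∈ A
    · have : (fun t : ℝ => (t, y)) ⁻¹' B = Ioc (inner ℝ y e - 1) (inner ℝ y e) := by
        ext t
        simp only [hB, slab, mem_preimage, mem_ofPred_eq, hy, and_true, inner_sub_left,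
          inner_smul_left, real_inner_self_eq_norm_sq, he, mem_Ico, mem_Ioc]
        simp
        constructor <;> rintro ⟨h1, h2⟩ <;> constructor <;> linarith
      rw [this, Real.volume_Ioc]
      simp [hy]
    · have : (fun t : ℝ => (t, y)) ⁻¹' B = ∅ := by
        ext t; simp [hB, hy]
      simp [this, hy]
  simp_rw [h3]
  rw [lintegral_indicator_one hA]

theorem eq_zero_of_inner_lt {R : ℝ} {φ : E3 → ℝ} (hφ : tsupport φ ⊆ Metric.closedBall 0 R)
    {e y : E3} (he : ‖e‖ = 1) (hy : R < |inner ℝ y e|) : y ∉ tsupport φ := by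
  intro h
  have h1 := hφ h
  rw [mem_closedBall_zero_iff] at h1
  have h2 := abs_real_inner_le_norm y e
  rw [he, mul_one] at h2
  linarith

theorem fderiv_apply_eq_zero_of_notMem_tsupport {φ : E3 → ℝ} {y : E3} (e : E3)
    (hy : y ∉ tsupport φ) : fderiv ℝ φ y e = 0 := by
  have := image_eq_zero_of_notMem_tsupport (f := fun x => fderiv ℝ φ x e) (x := y)
    (fun h' => hy (tsupport_fderiv_apply_subset ℝ e h'))
  exact this

/-- On almost every line, a compactly supported function with a weak derivative is the primitive
of this derivative. -/
theorem ae_line_eq_primitive {V h : E3 → ℝ} {e : E3} (he : ‖e‖ = 1) {R : ℝ} (hR : 0 ≤ R)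
    (hV : Integrable V) (hh : Integrable h)
    (hVs : ∀ y, R < |inner ℝ y e| → V y = 0) (hhs : ∀ y, R < |inner ℝ y e| → h y = 0)
    (H : ∀ φ : E3 → ℝ, IsTest univ φ → ∫ x, V x * fderiv ℝ φ x e = -∫ x, h x * φ x) :
    ∀ᵐ x ∂(volume.restrict (slab e)), Integrable (fun t : ℝ => h (x + t • e)) ∧
      ∃ c : ℝ, ∀ᵐ t : ℝ, t ∈ Ioc (-R - 1) (R + 1) →
        V (x + t • e) = c + ∫ s in (-R - 1)..t, h (x + s • e) := by
  -- From a parameter t > -R - 1, a shift by `L` goes beyond the support of `V`. The margin 1 at the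
  -- left end accounts for the width of the slab.
  set L := 2 * R + 2 with hL
  have hrep := ae_sub_eq_integral (V := V) (h := h) (e := e) (U := univ) (L := L) isOpen_univ hV hh
    (by positivity) (fun φ hφ s _ => by
      have := H _ (hφ.translate (s • e))
      simpa only [fderiv_translate] using this)
  have hmp := measurePreserving_slab he
  have h1 : ∀ᵐ x ∂(volume.restrict (slab e)), ∀ᵐ t : ℝ,
      V (x + t • e + L • e) - V (x + t • e) = ∫ τ in (0 : ℝ)..L, h (x + t • e + τ • e) := by
    have := hmp.quasiMeasurePreserving.ae hrep
    have h' := (Measure.measurePreserving_swap (μ := volume.restrict (slab e))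
      (ν := (volume : Measure ℝ))).quasiMeasurePreserving.ae this
    filter_upwards [Measure.ae_ae_of_ae_prod h'] with x hx
    filter_upwards [hx] with t ht using ht (mem_univ _)
  have h2 : ∀ᵐ x ∂(volume.restrict (slab e)), Integrable (fun t : ℝ => h (x + t • e)) :=
    (hmp.integrable_comp_of_integrable hh).prod_left_ae
  filter_upwards [h1, h2, ae_restrict_mem (measurableSet_slab e)] with x hx hxi hxs
  refine ⟨hxi, -∫ s in (-R - 1)..(R + 1), h (x + s • e), ?_⟩
  have hin : ∀ t : ℝ, inner ℝ (x + t • e) e = inner ℝ x e + t := fun t => by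
    rw [inner_add_left, inner_smul_left, real_inner_self_eq_norm_sq, he]; simp
  filter_upwards [hx] with t ht htm
  have hz : V (x + t • e + L • e) = 0 := by
    rw [add_assoc, ← add_smul]
    refine hVs _ ?_
    rw [hin]
    exact lt_of_lt_of_le (by linarith [htm.1, hxs.1]) (le_abs_self _)
  have hsh : ∫ τ in (0 : ℝ)..L, h (x + t • e + τ • e) = ∫ s in t..(t + L), h (x + s • e) := by
    have : ∀ τ : ℝ, x + t • e + τ • e = x + (τ + t) • e := fun τ => by
      rw [add_assoc, ← add_smul, add_comm t]
    simp_rw [this]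
    rw [intervalIntegral.integral_comp_add_right (fun s => h (x + s • e))]
    simp [add_comm]
  have hzero : ∫ s in (R + 1)..(t + L), h (x + s • e) = 0 := by
    refine intervalIntegral.integral_zero_ae (Eventually.of_forall fun s hs => ?_)
    rw [uIoc_of_le (by linarith [htm.1])] at hs
    refine hhs _ ?_
    rw [hin]
    exact lt_of_lt_of_le (by linarith [hs.1, hxs.1]) (le_abs_self _)
  have hii : ∀ a b, IntervalIntegrable (fun s => h (x + s • e)) volume a b := fun a b =>
    hxi.intervalIntegrable
  have e1 := intervalIntegral.integral_add_adjacent_intervals (hii t (R + 1)) (hii (R + 1) (t + L))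
  have e2 := intervalIntegral.integral_add_adjacent_intervals (hii (-R - 1) t) (hii t (R + 1))
  rw [hz, hsh] at ht
  linarith

/-- The chain rule for weak derivatives. -/
theorem HasWeakDeriv.comp {Ω : Set E3} {e : E3} {v g : E3 → ℝ} {ψ : ℝ → ℝ}
    (hΩ : IsOpen Ω) (he : ‖e‖ = 1) (h : HasWeakDeriv Ω e v g) (hψ : ContDiff ℝ 1 ψ)
    (h1 : IntegrableOn (fun x => ψ (v x)) Ω)
    (h2 : IntegrableOn (fun x => deriv ψ (v x) * g x) Ω) :
    HasWeakDeriv Ω e (fun x => ψ (v x)) (fun x => deriv ψ (v x) * g x) := by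
  refine ⟨h1, h2, fun φ hφ => ?_⟩
  -- Since `ζ = 1` near the support of `φ`, replacing `v` by `ζ v` extended by zero does not affect
  -- the identity tested with `φ`, and makes the function globally defined with compact support.
  obtain ⟨ζ, hζ, hζ1, -⟩ := exists_cutoff hφ.2.1 hΩ hφ.2.2
  obtain ⟨R, hR0, hR⟩ : ∃ R : ℝ, 0 ≤ R ∧ tsupport ζ ∪ tsupport φ ⊆ Metric.closedBall 0 R := by
    obtain ⟨R, hR⟩ := (hζ.2.1.union hφ.2.1).isBounded.subset_closedBall 0
    exact ⟨max R 0, le_max_right _ _,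
      hR.trans (Metric.closedBall_subset_closedBall (le_max_left _ _))⟩
  set V : E3 → ℝ := Ω.indicator (fun x => ζ x * v x) with hV
  set k : E3 → ℝ := Ω.indicator (fun x => ζ x * g x + fderiv ℝ ζ x e * v x) with hk
  have hVi : Integrable V := by
    rw [hV, integrable_indicator_iff hΩ.measurableSet]
    refine (hζ.integrable_mul h.1).congr (Eventually.of_forall fun x => ?_)
    simp only [mul_comm]
  have hki : Integrable k := by
    rw [hk, integrable_indicator_iff hΩ.measurableSet]
    refine ((hζ.integrable_mul h.2.1).add (hζ.integrable_mul_fderiv h.1 e)).congr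
      (Eventually.of_forall fun x => ?_)
    simp only [mul_comm, Pi.add_apply]
  have hζz : ∀ y, R < |inner ℝ y e| → ζ y = 0 ∧ fderiv ℝ ζ y e = 0 := fun y hy => by
    have hy' := eq_zero_of_inner_lt (subset_union_left.trans hR) he hy
    exact ⟨image_eq_zero_of_notMem_tsupport hy', fderiv_apply_eq_zero_of_notMem_tsupport e hy'⟩
  have hline := ae_line_eq_primitive he hR0 hVi hki
    (fun y hy => by simp [hV, (hζz y hy).1])
    (fun y hy => by simp [hk, (hζz y hy).1, (hζz y hy).2])
    (fun φ' hφ' => h.integral_cutoff hΩ hφ' hζ.univ_of (inter_subset_left.trans hζ.2.2))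
  -- On almost every line `F` is the derivative of the product of ψ(V) and φ. That product vanishes
  -- at both ends, so `F` has integral zero over the line and hence over the space.
  set F : E3 → ℝ := fun y => deriv ψ (V y) * k y * φ y + ψ (V y) * fderiv ℝ φ y e with hF
  have hFeq : ∀ y, F y = Ω.indicator
      (fun y => deriv ψ (v y) * g y * φ y + ψ (v y) * fderiv ℝ φ y e) y := by
    intro y
    by_cases hy : y ∈ tsupport φ
    · have hyΩ := hφ.2.2 hy
      have h3 : ζ =ᶠ[𝓝 y] fun _ => 1 := hζ1.filter_mono (nhds_le_nhdsSet hy)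
      have h4 : fderiv ℝ ζ y = 0 := by rw [h3.fderiv_eq]; simp
      simp [hF, hV, hk, hyΩ, h3.eq_of_nhds, h4]
    · have h3 : φ y = 0 := image_eq_zero_of_notMem_tsupport hy
      have h4 : fderiv ℝ φ y e = 0 := fderiv_apply_eq_zero_of_notMem_tsupport e hy
      by_cases hyΩ : y ∈ Ω <;> simp [hF, hyΩ, h3, h4]
  have hi1 := hφ.integrable_mul h2
  have hi2 := hφ.integrable_mul_fderiv h1 e
  have hFi : Integrable F := by
    rw [funext hFeq, integrable_indicator_iff hΩ.measurableSet]
    exact hi1.add hi2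
  have hint : ∫ y, F y = 0 := by
    have hmp := measurePreserving_slab he
    have hFc : Integrable (fun p : ℝ × E3 => F (p.2 + p.1 • e))
        (volume.prod (volume.restrict (slab e))) := hmp.integrable_comp_of_integrable hFi
    rw [← hmp.map_eq, integral_map hmp.aemeasurable (by rw [hmp.map_eq]; exact hFi.1),
      integral_prod_symm _ hFc]
    refine integral_eq_zero_of_ae ?_
    filter_upwards [hline, ae_restrict_mem (measurableSet_slab e)] with x ⟨hxi, c, hc⟩ hxs
    simp only [Pi.zero_apply]
    have hin : ∀ t : ℝ, inner ℝ (x + t • e) e = inner ℝ x e + t := fun t => by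
      rw [inner_add_left, inner_smul_left, real_inner_self_eq_norm_sq, he]; simp
    have hout : ∀ t : ℝ, t ∉ Ioo (-R - 1) (R + 1) → x + t • e ∉ tsupport φ := by
      intro t ht
      refine eq_zero_of_inner_lt (subset_union_right.trans hR) he ?_
      rw [hin]
      rcases lt_or_ge (-R - 1) t with h5 | h5
      · have : R + 1 ≤ t := by
          by_contra h6; exact ht ⟨h5, not_le.1 h6⟩
        exact lt_of_lt_of_le (by linarith [hxs.1]) (le_abs_self _)
      · rw [lt_abs]; right; linarith [hxs.2]
    have hder : ∀ t : ℝ, HasDerivAt (fun t : ℝ => φ (x + t • e))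
        (fderiv ℝ φ (x + t • e) e) t := by
      intro t
      have h5 : HasDerivAt (fun t : ℝ => x + t • e) e t := by
        simpa using ((hasDerivAt_id t).smul_const e).const_add x
      exact (hφ.1.differentiable (by simp) (x + t • e)).hasFDerivAt.comp_hasDerivAt t h5
    have hφl : ContDiff ℝ 1 (fun t : ℝ => φ (x + t • e)) :=
      (hφ.1.of_le (by exact_mod_cast le_top)).comp (by fun_prop)
    have hch := integral_deriv_comp_primitive_mul (a := -R - 1) (b := R + 1) c hψ hφl
      (hxi.intervalIntegrable)
    rw [image_eq_zero_of_notMem_tsupport (hout (-R - 1) (by simp)),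
      image_eq_zero_of_notMem_tsupport (hout (R + 1) (by simp)), mul_zero, mul_zero, sub_zero] at hch
    have hF0 : ∀ t, t ∉ Ioc (-R - 1) (R + 1) → F (x + t • e) = 0 := by
      intro t ht
      have hy := hout t (fun h' => ht (Ioo_subset_Ioc_self h'))
      have h3 : φ (x + t • e) = 0 := image_eq_zero_of_notMem_tsupport hy
      have h4 : fderiv ℝ φ (x + t • e) e = 0 := fderiv_apply_eq_zero_of_notMem_tsupport e hy
      simp [hF, h3, h4]
    rw [← setIntegral_eq_integral_of_forall_compl_eq_zero hF0,
      ← intervalIntegral.integral_of_le (by linarith), ← hch]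
    refine intervalIntegral.integral_congr_ae ?_
    filter_upwards [hc] with t ht htm
    rw [uIoc_of_le (by linarith)] at htm
    simp only [hF]
    rw [ht htm, (hder t).deriv]
  rw [funext hFeq, integral_indicator hΩ.measurableSet, integral_add hi1 hi2] at hint
  linarith

/-! ### The chain rule for weak gradients -/

/-- `G` is the weak gradient of `v` in `Ω`, and both are integrable in `Ω`. -/
def HasL1Grad (Ω : Set E3) (v : E3 → ℝ) (G : E3 → E3) : Prop :=
  IntegrableOn G Ω ∧ ∀ e : E3, HasWeakDeriv Ω e v (fun x => inner ℝ (G x) e)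

theorem HasWeakDeriv.smul_direction {Ω : Set E3} {e : E3} {v g : E3 → ℝ}
    (h : HasWeakDeriv Ω e v g) (c : ℝ) : HasWeakDeriv Ω (c • e) v (fun x => c * g x) := by
  refine ⟨h.1, h.2.1.const_mul c, fun φ hφ => ?_⟩
  have e1 : ∀ x, v x * fderiv ℝ φ x (c • e) = c * (v x * fderiv ℝ φ x e) := fun x => by
    rw [map_smul, smul_eq_mul]; ring
  have e2 : ∀ x, c * g x * φ x = c * (g x * φ x) := fun x => by ring
  simp_rw [e1, e2]
  rw [integral_const_mul, integral_const_mul, h.2.2 φ hφ]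
  ring

/-- The chain rule for weak gradients. -/
theorem HasL1Grad.comp {Ω : Set E3} {v : E3 → ℝ} {G : E3 → E3} {ψ : ℝ → ℝ} (hΩ : IsOpen Ω)
    (h : HasL1Grad Ω v G) (hψ : ContDiff ℝ 1 ψ) (h1 : IntegrableOn (fun x => ψ (v x)) Ω)
    (h2 : IntegrableOn (fun x => deriv ψ (v x) • G x) Ω) :
    HasL1Grad Ω (fun x => ψ (v x)) (fun x => deriv ψ (v x) • G x) := by
  refine ⟨h2, fun e => ?_⟩
  have h3 : ∀ e : E3, IntegrableOn (fun x => deriv ψ (v x) * inner ℝ (G x) e) Ω := fun e => by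
    refine (h2.inner_const e).congr (Eventually.of_forall fun x => ?_)
    simp [inner_smul_left]
  rcases eq_or_ne e 0 with rfl | he
  · exact ⟨h1, by simp, fun φ _ => by simp⟩
  · have hu : ‖(‖e‖⁻¹ • e)‖ = 1 := by
      rw [norm_smul, norm_inv, norm_norm, inv_mul_cancel₀ (norm_ne_zero_iff.2 he)]
    have := ((h.2 (‖e‖⁻¹ • e)).comp hΩ hu hψ h1 (h3 _)).smul_direction ‖e‖
    have e1 : ‖e‖ • (‖e‖⁻¹ • e) = e := by
      rw [smul_smul, mul_inv_cancel₀ (norm_ne_zero_iff.2 he), one_smul]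
    rw [e1] at this
    convert this using 2 with x
    have he' := norm_ne_zero_iff.2 he
    rw [inner_smul_left, inner_smul_right]
    simp only [conj_trivial]
    field_simp

/-! ### The Sobolev inequality up to the boundary -/

/-- A measurable representative, raised to infinity on a measurable null set. The inequality is
wanted everywhere because individual lines are null sets, on which an almost everywhere inequality
says nothing. -/
theorem exists_measurable_ge {α : Type*} [MeasurableSpace α] {μ : Measure α} {f : α → ℝ≥0∞}
    (hf : AEMeasurable f μ) :
    ∃ F : α → ℝ≥0∞, Measurable F ∧ (∀ x, f x ≤ F x) ∧ ∫⁻ x, F x ∂μ = ∫⁻ x, f x ∂μ := by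
  set N := toMeasurable μ {x | ¬ f x = hf.mk f x} with hN
  have hN0 : μ N = 0 := by rw [hN, measure_toMeasurable]; exact hf.ae_eq_mk
  refine ⟨fun x => hf.mk f x + N.indicator (fun _ => ⊤) x,
    hf.measurable_mk.add (measurable_const.indicator (measurableSet_toMeasurable _ _)),
    fun x => ?_, ?_⟩
  · by_cases hx : x ∈ N
    · simp [hx]
    · have : f x = hf.mk f x := by
        by_contra h; exact hx (subset_toMeasurable μ _ h)
      exact this.le.trans le_self_add
  · refine lintegral_congr_ae ?_
    filter_upwards [hf.ae_eq_mk, measure_eq_zero_iff_ae_notMem.1 hN0] with x h1 h2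
    simp [h2, h1]

/-- A function dominated by the integrals of `f` over lines in three independent directions
belongs to `L^{3/2}`. -/
theorem lintegral_rpow_le_of_lines {d : Fin 3 → E3} (hd : LinearIndependent ℝ d) :
    ∃ C : ℝ≥0, ∀ W f : E3 → ℝ≥0∞, AEMeasurable f volume →
      (∀ i, ∀ᵐ x, W x ≤ ∫⁻ t : ℝ, f (x + t • d i)) →
      ∫⁻ x, W x ^ (3 / 2 : ℝ) ≤ C * (∫⁻ x, f x) ^ (3 / 2 : ℝ) := by
  set b : Module.Basis (Fin 3) ℝ E3 :=
    basisOfLinearIndependentOfCardEqFinrank hd (by simp) with hb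
  set A : (Fin 3 → ℝ) ≃L[ℝ] E3 := b.equivFun.symm.toContinuousLinearEquiv with hA
  have hAy : ∀ y, A y = ∑ i, y i • d i := fun y => by
    simp [hA, hb, Module.Basis.equivFun_symm_apply]
  have : (Measure.map A (volume : Measure (Fin 3 → ℝ))).IsAddHaarMeasure :=
    A.isAddHaarMeasure_map volume
  obtain ⟨c, hc0, hc⟩ : ∃ c : ℝ≥0, c ≠ 0 ∧ Measure.map A (volume : Measure (Fin 3 → ℝ))
      = c • (volume : Measure E3) := by
    refine ⟨Measure.addHaarScalarFactor (Measure.map A volume) volume,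
      (Measure.addHaarScalarFactor_pos_of_isAddHaarMeasure _ _).ne', ?_⟩
    exact Measure.isAddLeftInvariant_eq_smul _ _
  have hint : ∀ g : E3 → ℝ≥0∞, ∫⁻ y, g (A y) = c * ∫⁻ x, g x := fun g => by
    have h1 : ∫⁻ x, g x ∂(Measure.map A volume) = ∫⁻ y, g (A y) :=
      lintegral_map_equiv g A.toHomeomorph.toMeasurableEquiv
    rw [← h1, hc, lintegral_smul_measure]
    rfl
  -- `c` is the Jacobian factor of the linear map `A` that sends coordinate lines to lines in the
  -- directions `d i`. It appears with power 1 on the left of the coordinate inequality and with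
  -- power 3/2 on the right.
  refine ⟨c⁻¹ * c ^ (3 / 2 : ℝ), fun W f hf hW => ?_⟩
  obtain ⟨F, hFm, hfF, hFi⟩ := exists_measurable_ge hf
  have hW' : ∀ᵐ y : Fin 3 → ℝ, ∀ i, W (A y) ≤ ∫⁻ t : ℝ, F (A y + t • d i) := by
    rw [ae_all_iff]
    intro i
    have h1 : ∀ᵐ x ∂(Measure.map A (volume : Measure (Fin 3 → ℝ))),
        W x ≤ ∫⁻ t : ℝ, F (x + t • d i) := by
      rw [hc]
      refine Measure.ae_smul_measure ?_ c
      filter_upwards [hW i] with x hx using hx.trans (lintegral_mono fun t => hfF _)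
    exact ae_of_ae_map A.continuous.aemeasurable h1
  have hline : ∀ (y : Fin 3 → ℝ) (i : Fin 3),
      ∫⁻ t : ℝ, F (A y + t • d i) = ∫⁻ s : ℝ, F (A (Function.update y i s)) := by
    intro y i
    have h1 : ∀ s, A (Function.update y i s) = A y + (s - y i) • d i := by
      intro s
      rw [hAy, hAy, ← Finset.add_sum_erase _ _ (Finset.mem_univ i),
        ← Finset.add_sum_erase (a := i) _ (fun j => y j • d j) (Finset.mem_univ i)]
      have h2 : ∑ j ∈ Finset.univ.erase i, Function.update y i s j • d j
          = ∑ j ∈ Finset.univ.erase i, y j • d j :=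
        Finset.sum_congr rfl fun j hj => by
          rw [Function.update_of_ne (Finset.ne_of_mem_erase hj)]
      rw [h2, Function.update_self, sub_smul]
      abel
    simp_rw [h1]
    exact (lintegral_sub_right_eq_self (fun t => F (A y + t • d i)) (y i)).symm
  -- The grid-lines inequality of Gagliardo and Nirenberg in dimension three: W^{3/2} is a product
  -- of three factors W^{1/2}, one for each family of coordinate lines.
  have hgrid := lintegral_prod_lintegral_pow_le (fun _ : Fin 3 => (volume : Measure ℝ))
    (p := 3 / 2) (by constructor <;> norm_num) (f := fun y => F (A y))
    (hFm.comp A.continuous.measurable)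
  have h3 : ∫⁻ y, W (A y) ^ (3 / 2 : ℝ) ≤ (∫⁻ y, F (A y)) ^ (3 / 2 : ℝ) := by
    refine le_trans (lintegral_mono_ae ?_) hgrid
    filter_upwards [hW'] with y hy
    have e1 : W (A y) ^ (3 / 2 : ℝ) = ∏ _i : Fin 3, W (A y) ^ (1 / 2 : ℝ) := by
      rw [Finset.prod_const, Finset.card_univ, Fintype.card_fin, ← ENNReal.rpow_natCast,
        ← ENNReal.rpow_mul]
      norm_num
    rw [e1]
    refine Finset.prod_le_prod' fun i _ => ?_
    have e2 : (1 : ℝ) / ((Fintype.card (Fin 3) : ℝ) - 1) = 1 / 2 := by norm_num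
    rw [e2, ← hline y i]
    exact ENNReal.rpow_le_rpow (hy i) (by norm_num)
  rw [hint F, hint (fun x => W x ^ (3 / 2 : ℝ)), hFi, ENNReal.mul_rpow_of_nonneg _ _ (by norm_num),
    mul_comm] at h3
  have hc0' : (c : ℝ≥0∞) ≠ 0 := by exact_mod_cast hc0
  rw [← ENNReal.le_div_iff_mul_le (Or.inl hc0') (Or.inl ENNReal.coe_ne_top)] at h3
  refine h3.trans (le_of_eq ?_)
  rw [ENNReal.coe_mul, ENNReal.coe_inv hc0, ENNReal.coe_rpow_of_nonneg _ (by norm_num), div_eq_mul_inv]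
  ring

/-- A local Sobolev inequality, where `Ω` is invariant under translations in three independent
directions. -/
theorem sobolev_local {Ω : Set E3} (hΩ : IsOpen Ω) {x₀ : E3} {r : ℝ} (hr : 0 < r)
    {d : Fin 3 → E3} (hd : LinearIndependent ℝ d)
    (hf : ∀ i, ∀ x ∈ Ω ∩ Metric.ball x₀ r, ∀ t : ℝ, 0 ≤ t → x + t • d i ∈ Metric.ball x₀ r →
      x + t • d i ∈ Ω) :
    ∃ C : ℝ≥0, ∀ z Z, HasL1Grad Ω z Z →
      ∫⁻ x in Ω ∩ Metric.ball x₀ (r / 2), ‖z x‖ₑ ^ (3 / 2 : ℝ)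
        ≤ C * (∫⁻ x in Ω, (‖z x‖ₑ + ‖Z x‖ₑ)) ^ (3 / 2 : ℝ) := by
  obtain ⟨C, hC⟩ := lintegral_rpow_le_of_lines hd
  obtain ⟨ζ, hζ, hζ1, hζ01⟩ := exists_cutoff (isCompact_closedBall x₀ (r / 2))
    (Metric.isOpen_ball (x := x₀) (ε := r)) (Metric.closedBall_subset_ball (by linarith))
  choose M hM using fun i => hζ.exists_bound_fderiv (d i)
  set A : ℝ≥0 := ∑ i, (‖d i‖₊ + ‖M i‖₊) with hA
  refine ⟨C * A ^ (3 / 2 : ℝ), fun z Z hz => ?_⟩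
  have hzi : IntegrableOn z Ω := (hz.2 0).1
  set V : E3 → ℝ := Ω.indicator (fun x => ζ x * z x) with hV
  set h : Fin 3 → E3 → ℝ := fun i =>
    Ω.indicator (fun x => ζ x * inner ℝ (Z x) (d i) + fderiv ℝ ζ x (d i) * z x) with hh
  set f : E3 → ℝ≥0∞ := Ω.indicator (fun x => A * (‖z x‖ₑ + ‖Z x‖ₑ)) with hf'
  have hfm : AEMeasurable f volume := by
    rw [hf', aemeasurable_indicator_iff hΩ.measurableSet]
    exact (hzi.1.enorm.add hz.1.1.enorm).const_mul _
  have hhf : ∀ i x, ‖h i x‖ₑ ≤ f x := by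
    intro i x
    by_cases hx : x ∈ Ω
    · simp only [hh, hf', indicator_of_mem hx]
      have h1 : ‖ζ x * inner ℝ (Z x) (d i)‖₊ ≤ ‖d i‖₊ * ‖Z x‖₊ := by
        rw [← NNReal.coe_le_coe]
        push_cast
        rw [norm_mul, Real.norm_of_nonneg (hζ01 x).1, mul_comm ‖d i‖]
        calc ζ x * ‖inner ℝ (Z x) (d i)‖ ≤ 1 * (‖Z x‖ * ‖d i‖) := by
              gcongr
              · exact (hζ01 x).2
              · exact norm_inner_le_norm _ _
          _ = _ := one_mul _
      have h2 : ‖fderiv ℝ ζ x (d i) * z x‖₊ ≤ ‖M i‖₊ * ‖z x‖₊ := by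
        rw [← NNReal.coe_le_coe]
        push_cast
        rw [norm_mul]
        gcongr
        exact (hM i x).trans (le_abs_self _)
      have h3 : ‖d i‖₊ + ‖M i‖₊ ≤ A :=
        Finset.single_le_sum (f := fun i => ‖d i‖₊ + ‖M i‖₊) (fun _ _ => zero_le)
          (Finset.mem_univ i)
      have h4 : ‖ζ x * inner ℝ (Z x) (d i) + fderiv ℝ ζ x (d i) * z x‖₊
          ≤ A * (‖z x‖₊ + ‖Z x‖₊) := by
        calc _ ≤ ‖ζ x * inner ℝ (Z x) (d i)‖₊ + ‖fderiv ℝ ζ x (d i) * z x‖₊ := nnnorm_add_le _ _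
          _ ≤ ‖d i‖₊ * ‖Z x‖₊ + ‖M i‖₊ * ‖z x‖₊ := add_le_add h1 h2
          _ ≤ (‖d i‖₊ + ‖M i‖₊) * (‖z x‖₊ + ‖Z x‖₊) := by
            rw [← NNReal.coe_le_coe]; push_cast
            nlinarith [norm_nonneg (d i), norm_nonneg (Z x), norm_nonneg (M i), norm_nonneg (z x),
              mul_nonneg (norm_nonneg (d i)) (norm_nonneg (z x)),
              mul_nonneg (norm_nonneg (M i)) (norm_nonneg (Z x))]
          _ ≤ _ := by gcongr
      simp only [enorm]
      exact_mod_cast h4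
    · simp [hh, hx]
  have hVi : Integrable V := by
    rw [hV, integrable_indicator_iff hΩ.measurableSet]
    refine (hζ.integrable_mul hzi).congr (Eventually.of_forall fun x => ?_)
    simp only [mul_comm]
  have hhi : ∀ i, Integrable (h i) := fun i => by
    simp only [hh]
    rw [integrable_indicator_iff hΩ.measurableSet]
    refine ((hζ.integrable_mul (hz.2 (d i)).2.1).add
      (hζ.integrable_mul_fderiv hzi (d i))).congr (Eventually.of_forall fun x => ?_)
    simp only [mul_comm, Pi.add_apply]
  have hVs : ∀ x, x ∉ Metric.ball x₀ r → V x = 0 := fun x hx => by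
    have : ζ x = 0 := image_eq_zero_of_notMem_tsupport fun h' => hx (hζ.2.2 h')
    simp [hV, this]
  have hlines : ∀ i, ∀ᵐ x, ‖V x‖ₑ ≤ ∫⁻ t : ℝ, f (x + t • d i) := by
    intro i
    have hdi : 0 < ‖d i‖ := norm_pos_iff.2 (hd.ne_zero i)
    -- A displacement of length 2r leaves the ball of radius r, so `V` vanishes at the far end.
    set L := 2 * r / ‖d i‖ with hL
    have hL0 : 0 ≤ L := by positivity
    have := ae_sub_eq_integral (V := V) (h := h i) (e := d i) (L := L)
      (hΩ.inter Metric.isOpen_ball) hVi (hhi i) hL0 (fun φ hφ s hs => by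
        have := (hz.2 (d i)).integral_cutoff (φ := fun x => φ (x - s • d i)) hΩ
          (hφ.univ_of.translate _) hζ.univ_of ?_
        · simpa only [fderiv_translate] using this
        -- A translated test function may leave `Ω`. By the forward invariance of `Ω` inside the
        -- ball, it does not do so where the cutoff `ζ` lives.
        · rintro y ⟨hy1, hy2⟩
          have h5 : y - s • d i ∈ tsupport φ :=
            tsupport_comp_subset_preimage φ (f := fun x => x - s • d i) (by fun_prop) hy2
          have := hf i _ (hφ.2.2 h5) s hs.1
          rw [sub_add_cancel] at this
          exact this (hζ.2.2 hy1))
    filter_upwards [this] with x hx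
    by_cases hxU : x ∈ Ω ∩ Metric.ball x₀ r
    · have h6 := hx hxU
      rw [hVs (x + L • d i), zero_sub] at h6
      · rw [← enorm_neg, h6, intervalIntegral.integral_of_le hL0]
        refine (enorm_integral_le_lintegral_enorm _).trans ?_
        exact (setLIntegral_le_lintegral _ _).trans (lintegral_mono fun t => hhf i _)
      · intro h7
        have h8 := dist_triangle_right (x + L • d i) x x₀
        rw [dist_self_add_left, norm_smul, Real.norm_of_nonneg hL0, hL,
          div_mul_cancel₀ _ hdi.ne'] at h8
        have h9 := Metric.mem_ball.1 h7
        have h10 := Metric.mem_ball.1 hxU.2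
        linarith
    · have : V x = 0 := by
        by_cases hxΩ : x ∈ Ω
        · exact hVs x fun h' => hxU ⟨hxΩ, h'⟩
        · simp [hV, hxΩ]
      simp [this]
  have hmain := hC (fun x => ‖V x‖ₑ) f hfm hlines
  have hfi : ∫⁻ x, f x = A * ∫⁻ x in Ω, (‖z x‖ₑ + ‖Z x‖ₑ) := by
    rw [hf', lintegral_indicator hΩ.measurableSet, lintegral_const_mul' _ _ ENNReal.coe_ne_top]
  calc ∫⁻ x in Ω ∩ Metric.ball x₀ (r / 2), ‖z x‖ₑ ^ (3 / 2 : ℝ)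
      = ∫⁻ x in Ω ∩ Metric.ball x₀ (r / 2), ‖V x‖ₑ ^ (3 / 2 : ℝ) := by
        refine setLIntegral_congr_fun (hΩ.inter Metric.isOpen_ball).measurableSet fun x hx => ?_
        have : ζ x = 1 := hζ1.self_of_nhdsSet x (Metric.ball_subset_closedBall hx.2)
        simp [hV, hx.1, this]
    _ ≤ ∫⁻ x, ‖V x‖ₑ ^ (3 / 2 : ℝ) := setLIntegral_le_lintegral _ _
    _ ≤ C * (A * ∫⁻ x in Ω, (‖z x‖ₑ + ‖Z x‖ₑ)) ^ (3 / 2 : ℝ) := by rw [← hfi]; exact hmain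
    _ = _ := by
        rw [ENNReal.mul_rpow_of_nonneg _ _ (by norm_num), ENNReal.coe_mul,
          ENNReal.coe_rpow_of_nonneg _ (by norm_num), mul_assoc]

/-- A linearly independent family of directions pointing into the set above the graph of a
`K`-Lipschitz function. -/
def coneDirection (K : ℝ) : Fin 3 → E3 := ![!₂[1, 0, K], !₂[0, 1, K], !₂[0, 0, 1]]

theorem linearIndependent_coneDirection (K : ℝ) : LinearIndependent ℝ (coneDirection K) := by
  rw [Fintype.linearIndependent_iff]
  intro g hg
  have h := fun i => congrArg (fun x : E3 => x i) hg
  have h0 := h 0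
  have h1 := h 1
  have h2 := h 2
  simp [coneDirection, Fin.sum_univ_three] at h0 h1 h2
  intro i
  fin_cases i
  · exact h0
  · exact h1
  · simpa [h0, h1] using h2

/-- In graph coordinates, a step whose vertical part is at least `K` times its horizontal length,
with `K` a local Lipschitz constant of the graph function, cannot pass below the graph. Only this
cone property of the boundary serves the Sobolev inequality. -/
theorem exists_directions_of_mem_frontier {Ω : Set E3} (hb : HasC2Boundary Ω) {x₀ : E3}
    (hx₀ : x₀ ∈ frontier Ω) :
    ∃ r : ℝ, 0 < r ∧ ∃ d : Fin 3 → E3, LinearIndependent ℝ d ∧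
      ∀ i, ∀ x ∈ Ω ∩ Metric.ball x₀ r, ∀ t : ℝ, 0 ≤ t → x + t • d i ∈ Metric.ball x₀ r →
        x + t • d i ∈ Ω := by
  obtain ⟨r, hr, e, γ, hγ, hΩ⟩ := hb x₀ hx₀
  set p : E3 → EuclideanSpace ℝ (Fin 2) := fun y => !₂[y 0, y 1] with hp
  have hpd : ∀ y y', dist (p y) (p y') ≤ dist y y' := by
    intro y y'
    rw [EuclideanSpace.dist_eq, EuclideanSpace.dist_eq]
    refine Real.sqrt_le_sqrt ?_
    rw [Fin.sum_univ_three, Fin.sum_univ_two]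
    simp only [hp]
    simp
  obtain ⟨K, hK⟩ := ((hγ.of_le (by norm_num : (1 : ℕ∞ω) ≤ 2)).contDiffOn
    (s := Metric.closedBall (p (e x₀)) r)).exists_lipschitzOnWith (by decide)
    (convex_closedBall _ _) (isCompact_closedBall _ _)
  have hmem : ∀ x ∈ Metric.ball x₀ r, p (e x) ∈ Metric.closedBall (p (e x₀)) r := by
    intro x hx
    have h1 := hpd (e x) (e x₀)
    rw [e.dist_map] at h1
    exact h1.trans (Metric.mem_ball.1 hx).le
  refine ⟨r, hr, fun i => e.symm (coneDirection K i), ?_, ?_⟩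
  · exact (linearIndependent_coneDirection K).map' e.symm.toLinearEquiv.toLinearMap
      e.symm.toLinearEquiv.ker
  intro i x hx t ht hxt
  have hx' := hx
  rw [hΩ] at hx'
  have key : x + t • e.symm (coneDirection K i) ∈ {x ∈ Metric.ball x₀ r |
      γ !₂[e x 0, e x 1] < e x 2} := by
    refine ⟨hxt, ?_⟩
    have hL := hK.dist_le_mul _ (hmem _ hxt) _ (hmem _ hx.2)
    rw [Real.dist_eq, EuclideanSpace.dist_eq, Fin.sum_univ_two] at hL
    have h1 := (abs_le.1 hL).2
    have h2 : γ (p (e x)) < e x 2 := hx'.2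
    change γ (p (e (x + t • e.symm (coneDirection K i)))) < e (x + t • e.symm (coneDirection K i)) 2
    have h3 : e (x + t • e.symm (coneDirection K i)) = e x + t • coneDirection K i := by
      simp
    rw [h3] at h1 ⊢
    simp only [hp, Real.dist_eq] at h1 h2 ⊢
    fin_cases i
    · simp [coneDirection, Real.sqrt_sq ht] at h1 ⊢
      linarith
    · simp [coneDirection, Real.sqrt_sq ht] at h1 ⊢
      linarith
    · simp [coneDirection] at h1 ⊢
      linarith
  rw [← hΩ] at key
  exact key.1

/-- The Sobolev inequality `W^{1,1}(Ω) ⊆ L^{3/2}(Ω)`. -/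
theorem sobolev {Ω : Set E3} (hΩ : IsOpen Ω) (hbd : Bornology.IsBounded Ω)
    (hb : HasC2Boundary Ω) :
    ∃ C : ℝ≥0, ∀ z Z, HasL1Grad Ω z Z →
      ∫⁻ x in Ω, ‖z x‖ₑ ^ (3 / 2 : ℝ)
        ≤ C * (∫⁻ x in Ω, (‖z x‖ₑ + ‖Z x‖ₑ)) ^ (3 / 2 : ℝ) := by
  have hloc : ∀ x₀ ∈ closure Ω, ∃ r : ℝ, 0 < r ∧ ∃ C : ℝ≥0, ∀ z Z, HasL1Grad Ω z Z →
      ∫⁻ x in Ω ∩ Metric.ball x₀ (r / 2), ‖z x‖ₑ ^ (3 / 2 : ℝ)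
        ≤ C * (∫⁻ x in Ω, (‖z x‖ₑ + ‖Z x‖ₑ)) ^ (3 / 2 : ℝ) := by
    intro x₀ hx₀
    by_cases hx : x₀ ∈ Ω
    · obtain ⟨r, hr, hrΩ⟩ := Metric.isOpen_iff.1 hΩ x₀ hx
      exact ⟨r, hr, sobolev_local hΩ hr (linearIndependent_coneDirection 0)
        fun i x _ t _ ht => hrΩ ht⟩
    · have hfr : x₀ ∈ frontier Ω := by
        rw [frontier, hΩ.interior_eq]; exact ⟨hx₀, hx⟩
      obtain ⟨r, hr, d, hd, hf⟩ := exists_directions_of_mem_frontier hb hfr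
      exact ⟨r, hr, sobolev_local hΩ hr hd hf⟩
  choose! r hr C hC using hloc
  obtain ⟨s, hs, hcov⟩ := hbd.isCompact_closure.elim_nhds_subcover
    (fun x => Metric.ball x (r x / 2)) (fun x hx => Metric.ball_mem_nhds x (half_pos (hr x hx)))
  refine ⟨∑ x ∈ s, C x, fun z Z hz => ?_⟩
  have hsub : Ω ⊆ ⋃ x ∈ s, Ω ∩ Metric.ball x (r x / 2) := by
    intro y hy
    obtain ⟨x, hx, hyx⟩ := mem_iUnion₂.1 (hcov (subset_closure hy))
    exact mem_iUnion₂.2 ⟨x, hx, hy, hyx⟩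
  calc ∫⁻ x in Ω, ‖z x‖ₑ ^ (3 / 2 : ℝ)
      ≤ ∫⁻ x in ⋃ x ∈ s, Ω ∩ Metric.ball x (r x / 2), ‖z x‖ₑ ^ (3 / 2 : ℝ) :=
        lintegral_mono_set hsub
    _ ≤ ∑ x₀ ∈ s, ∫⁻ x in Ω ∩ Metric.ball x₀ (r x₀ / 2), ‖z x‖ₑ ^ (3 / 2 : ℝ) := by
        have hu : ⋃ x ∈ s, Ω ∩ Metric.ball x (r x / 2)
            = ⋃ x : s, Ω ∩ Metric.ball (x : E3) (r x / 2) := by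
          ext y; simp
        rw [hu]
        refine (lintegral_iUnion_le _ _).trans (le_of_eq ?_)
        rw [tsum_fintype]
        exact Finset.sum_coe_sort s
          (fun x₀ => ∫⁻ x in Ω ∩ Metric.ball x₀ (r x₀ / 2), ‖z x‖ₑ ^ (3 / 2 : ℝ))
    _ ≤ ∑ x₀ ∈ s, C x₀ * (∫⁻ x in Ω, (‖z x‖ₑ + ‖Z x‖ₑ)) ^ (3 / 2 : ℝ) :=
        Finset.sum_le_sum fun x₀ hx₀ => hC x₀ (hs x₀ hx₀) z Z hz
    _ = _ := by rw [← Finset.sum_mul]; push_cast; rfl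

/-! ### Sobolev functions -/

theorem inner_gradient (φ : E3 → ℝ) (x e : E3) : inner ℝ (gradient φ x) e = fderiv ℝ φ x e :=
  inner_gradient_left

theorem integrable_smul_gradient {Ω : Set E3} {φ v : E3 → ℝ} {μ : Measure E3} (hφ : IsTest Ω φ)
    (hv : Integrable v μ) : Integrable (fun x => v x • gradient φ x) μ := by
  have hc : Continuous fun x => gradient φ x :=
    (InnerProductSpace.toDual ℝ E3).symm.continuous.comp (hφ.1.continuous_fderiv (by simp))
  obtain ⟨C, hC⟩ := (hφ.2.1.fderiv (𝕜 := ℝ)).exists_bound_of_continuous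
    (hφ.1.continuous_fderiv (by simp))
  refine Integrable.smul_bdd hv C hc.aestronglyMeasurable (Eventually.of_forall fun x => ?_)
  have : ‖gradient φ x‖ = ‖fderiv ℝ φ x‖ := by simp [gradient]
  rw [this]
  exact hC x

theorem HasWeakGrad.hasL1Grad {Ω : Set E3} {v : E3 → ℝ} {G : E3 → E3} (h : HasWeakGrad Ω v G)
    (hv : IntegrableOn v Ω) (hG : IntegrableOn G Ω) : HasL1Grad Ω v G := by
  refine ⟨hG, fun e => ⟨hv, hG.inner_const e, fun φ hφ => ?_⟩⟩
  have h1 := congrArg (fun y : E3 => inner ℝ e y) (h.2.2 φ hφ)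
  have hi : IntegrableOn (fun x => φ x • G x) Ω := by
    obtain ⟨C, hC⟩ := hφ.exists_bound
    exact hG.bdd_smul C hφ.1.continuous.aestronglyMeasurable (Eventually.of_forall hC)
  simp only [inner_neg_right] at h1
  rw [← integral_inner (integrable_smul_gradient hφ hv), ← integral_inner hi] at h1
  simp only [inner_smul_right] at h1
  have e1 : ∀ x, v x * fderiv ℝ φ x e = v x * inner ℝ e (gradient φ x) := fun x => by
    rw [real_inner_comm, inner_gradient]
  have e2 : ∀ x, inner ℝ (G x) e * φ x = φ x * inner ℝ e (G x) := fun x => by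
    rw [real_inner_comm, mul_comm]
  simp_rw [e1, e2]
  exact h1

theorem HasL1Grad.hasWeakGrad {Ω : Set E3} {v : E3 → ℝ} {G : E3 → E3} (h : HasL1Grad Ω v G) :
    HasWeakGrad Ω v G := by
  refine ⟨(h.2 0).1.locallyIntegrableOn, h.1.locallyIntegrableOn, fun φ hφ => ?_⟩
  have hi : IntegrableOn (fun x => φ x • G x) Ω := by
    obtain ⟨C, hC⟩ := hφ.exists_bound
    exact h.1.bdd_smul C hφ.1.continuous.aestronglyMeasurable (Eventually.of_forall hC)
  refine ext_inner_left ℝ fun e => ?_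
  rw [inner_neg_right, ← integral_inner (integrable_smul_gradient hφ (h.2 0).1),
    ← integral_inner hi]
  have h1 := (h.2 e).2.2 φ hφ
  have e1 : ∀ x, v x * fderiv ℝ φ x e = v x * inner ℝ e (gradient φ x) := fun x => by
    rw [real_inner_comm, inner_gradient]
  have e2 : ∀ x, inner ℝ (G x) e * φ x = φ x * inner ℝ e (G x) := fun x => by
    rw [real_inner_comm, mul_comm]
  simp_rw [e1, e2] at h1
  simp only [inner_smul_right]
  exact h1

/-- Uniqueness of weak gradients. -/
theorem HasWeakGrad.ae_eq {Ω : Set E3} {v : E3 → ℝ} {G G' : E3 → E3} (hΩ : IsOpen Ω)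
    (h : HasWeakGrad Ω v G) (h' : HasWeakGrad Ω v G') : G =ᵐ[volume.restrict Ω] G' := by
  have := hΩ.ae_eq_zero_of_integral_contDiff_smul_eq_zero (μ := volume) (h.2.1.sub h'.2.1) ?_
  · rw [Filter.EventuallyEq, ae_restrict_iff' hΩ.measurableSet]
    filter_upwards [this] with x hx hxΩ using sub_eq_zero.1 (hx hxΩ)
  · intro φ h1 h2 h3
    have hint : ∀ {H : E3 → E3}, LocallyIntegrableOn H Ω → IntegrableOn (fun x => φ x • H x) Ω := by
      intro H hH
      have hK : IntegrableOn H (tsupport φ) := hH.integrableOn_compact_subset h3 h2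
      have h4 : IntegrableOn (fun x => φ x • H x) (tsupport φ) :=
        hK.continuousOn_smul h1.continuous.continuousOn h2
      have h5 : Integrable (fun x => φ x • H x) := by
        rwa [integrableOn_iff_integrable_of_support_subset] at h4
        exact (Function.support_smul_subset_left _ _).trans (subset_tsupport φ)
      exact h5.integrableOn
    have h6 : ∫ x, φ x • (G - G') x = ∫ x in Ω, φ x • (G - G') x := by
      symm
      refine setIntegral_eq_integral_of_forall_compl_eq_zero fun x hx => ?_
      rw [image_eq_zero_of_notMem_tsupport fun h' => hx (h3 h'), zero_smul]
    rw [h6]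
    simp only [Pi.sub_apply, smul_sub]
    rw [integral_sub (hint h.2.1) (hint h'.2.1)]
    have e1 := h.2.2 φ ⟨h1, h2, h3⟩
    have e2 := h'.2.2 φ ⟨h1, h2, h3⟩
    rw [e1, neg_inj] at e2
    rw [e2, sub_self]

theorem MemH1.hasL1Grad {Ω : Set E3} [IsFiniteMeasure (volume.restrict Ω)] {v : E3 → ℝ}
    {G : E3 → E3} (h : MemH1 Ω v G) : HasL1Grad Ω v G :=
  h.2.2.hasL1Grad (h.1.integrable (by norm_num)) (h.2.1.integrable (by norm_num))

/-- Composition of a function in `H¹(Ω)` with a bounded `C¹` function with bounded derivative. -/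
theorem MemH1.comp {Ω : Set E3} [IsFiniteMeasure (volume.restrict Ω)] (hΩ : IsOpen Ω) {v : E3 → ℝ}
    {G : E3 → E3} {ψ : ℝ → ℝ} (h : MemH1 Ω v G) (hψ : ContDiff ℝ 1 ψ) {B : ℝ}
    (hB : ∀ s, |ψ s| ≤ B) (hB' : ∀ s, |deriv ψ s| ≤ B) :
    MemH1 Ω (fun x => ψ (v x)) (fun x => deriv ψ (v x) • G x) := by
  have h1 : MemLp (fun x => ψ (v x)) 2 (volume.restrict Ω) :=
    MemLp.of_bound (hψ.continuous.comp_aestronglyMeasurable h.1.1) B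
      (Eventually.of_forall fun x => hB _)
  have h2 : MemLp (fun x => deriv ψ (v x) • G x) 2 (volume.restrict Ω) := by
    refine h.2.1.of_le_mul (c := B) (((hψ.continuous_deriv le_rfl).comp_aestronglyMeasurable
      h.1.1).smul h.2.1.1) (Eventually.of_forall fun x => ?_)
    rw [norm_smul]
    gcongr
    exact hB' _
  exact ⟨h1, h2, (h.hasL1Grad.comp hΩ hψ (h1.integrable (by norm_num))
    (h2.integrable (by norm_num))).hasWeakGrad⟩

/-! ### Integrals of squares -/

theorem eLpNorm_two_sq {α X : Type*} [MeasurableSpace α] {μ : Measure α} [NormedAddCommGroup X]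
    {f : α → X} (hf : MemLp f 2 μ) : (eLpNorm f 2 μ).toReal ^ 2 = ∫ x, ‖f x‖ ^ 2 ∂μ := by
  have h := hf.eLpNorm_eq_integral_rpow_norm (by norm_num) (by norm_num)
  have h0 : 0 ≤ ∫ x, ‖f x‖ ^ 2 ∂μ := integral_nonneg fun _ => sq_nonneg _
  simp only [ENNReal.toReal_ofNat, Real.rpow_ofNat] at h
  rw [h, ENNReal.toReal_ofReal (by positivity), ← Real.rpow_natCast, ← Real.rpow_mul h0]
  norm_num

theorem MemLp.integrable_real_inner {α X : Type*} [MeasurableSpace α] {μ : Measure α}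
    [NormedAddCommGroup X] [InnerProductSpace ℝ X] {r v : α → X} (hr : MemLp r 2 μ)
    (hv : MemLp v 2 μ) : Integrable (fun x => inner ℝ (r x) (v x)) μ :=
  (hr.norm.integrable_mul hv.norm).mono' (hr.1.inner hv.1)
    (Eventually.of_forall fun _ => norm_inner_le_norm _ _)

/-- By Cauchy-Schwarz the integrands converge in L¹. This carries identities for smooth test
functions over to H¹₀. -/
theorem tendsto_integral_inner {α X : Type*} [MeasurableSpace α] {μ : Measure α}
    [NormedAddCommGroup X] [InnerProductSpace ℝ X] {r v : α → X} {φ : ℕ → α → X}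
    (hr : MemLp r 2 μ) (hv : MemLp v 2 μ) (hφ : ∀ n, MemLp (φ n) 2 μ)
    (h : Tendsto (fun n => eLpNorm (fun x => φ n x - v x) 2 μ) atTop (𝓝 0)) :
    Tendsto (fun n => ∫ x, inner ℝ (r x) (φ n x) ∂μ) atTop (𝓝 (∫ x, inner ℝ (r x) (v x) ∂μ)) := by
  refine tendsto_integral_of_L1' _ (MemLp.integrable_real_inner hr hv).1
    (Eventually.of_forall fun n => MemLp.integrable_real_inner hr (hφ n)) ?_
  have h1 : Tendsto (fun n => eLpNorm r 2 μ * eLpNorm (fun x => φ n x - v x) 2 μ) atTop (𝓝 0) := by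
    have := ENNReal.Tendsto.const_mul (a := eLpNorm r 2 μ) h (Or.inr hr.2.ne)
    simpa using this
  refine tendsto_of_tendsto_of_tendsto_of_le_of_le tendsto_const_nhds h1 (fun _ => zero_le)
    fun n => ?_
  have h2 := eLpNorm_le_eLpNorm_mul_eLpNorm_of_nnnorm (p := 2) (q := 2) (r := 1) (μ := μ) hr.1
    ((hφ n).sub hv).1 (fun a b => inner ℝ a b) 1 (Eventually.of_forall fun x => by
      rw [one_mul]; exact nnnorm_inner_le_nnnorm _ _)
  simp only [ENNReal.coe_one, one_mul] at h2
  refine le_trans (le_of_eq ?_) h2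
  congr 1
  ext x
  simp [inner_sub_right]

/-! ### The Poincaré inequality in `H¹₀` -/

/-- Since `l` has derivative 1 along `e`, integration by parts gives ∫ φ² = -∫ 2 l φ ∂ₑφ. On the
support |l| ≤ R, so the integrand is at most φ²/2 + 2R² (∂ₑφ)², and half of the left side is
absorbed. -/
theorem IsTest.integral_sq_le_fderiv {Ω : Set E3} {φ : E3 → ℝ} (hφ : IsTest Ω φ) {R : ℝ}
    (hR : Ω ⊆ Metric.closedBall 0 R) (l : E3 →L[ℝ] ℝ) (hl : ∀ x, |l x| ≤ ‖x‖) (e : E3)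
    (hle : l e = 1) :
    ∫ x, φ x ^ 2 ≤ 4 * R ^ 2 * ∫ x, fderiv ℝ φ x e ^ 2 := by
  have hd := hφ.1.differentiable (by simp)
  have hc := hφ.1.continuous
  have hdc := hφ.continuous_fderiv e
  have hcs : ∀ g : E3 → ℝ, Continuous g → (∀ x, x ∉ tsupport φ → g x = 0) → Integrable g :=
    fun g hg h0 => hg.integrable_of_hasCompactSupport (HasCompactSupport.intro hφ.2.1 fun x => h0 x)
  have hφ0 : ∀ x, x ∉ tsupport φ → φ x = 0 := fun x hx => image_eq_zero_of_notMem_tsupport hx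
  have hi0 : Integrable (fun x => φ x ^ 2) := hcs _ (hc.pow 2) fun x hx => by
    rw [hφ0 x hx]; simp
  have hi1 : Integrable (fun x => fderiv ℝ φ x e ^ 2) := hcs _ (hdc.pow 2) fun x hx => by
    rw [fderiv_apply_eq_zero_of_notMem_tsupport e hx]; simp
  have hi2 : Integrable (fun x => l x * (2 * φ x * fderiv ℝ φ x e)) :=
    hcs _ (l.continuous.mul ((continuous_const.mul hc).mul hdc)) fun x hx => by
      rw [hφ0 x hx]; simp
  have hi3 : Integrable (fun x => l x * φ x ^ 2) :=
    hcs _ (l.continuous.mul (hc.pow 2)) fun x hx => by rw [hφ0 x hx]; simp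
  have hfd : ∀ x, fderiv ℝ (fun x => φ x ^ 2) x e = 2 * φ x * fderiv ℝ φ x e := fun x => by
    rw [((hd x).hasFDerivAt.pow 2).fderiv]; simp
  have hfl : ∀ x, fderiv ℝ (fun x => l x) x e = 1 := fun x => by
    rw [l.hasFDerivAt.fderiv, hle]
  have hibp := integral_mul_fderiv_eq_neg_fderiv_mul_of_integrable (μ := (volume : Measure E3))
    (f := fun x => l x) (g := fun x => φ x ^ 2) (v := e)
    (by simp_rw [hfl, one_mul]; exact hi0) (by simp_rw [hfd]; exact hi2) hi3
    (fun x _ => l.differentiableAt) (fun x _ => (hd x).pow 2)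
  simp_rw [hfd, hfl, one_mul] at hibp
  have hpt : ∀ x, -(l x * (2 * φ x * fderiv ℝ φ x e))
      ≤ 1 / 2 * φ x ^ 2 + 2 * R ^ 2 * fderiv ℝ φ x e ^ 2 := by
    intro x
    by_cases hx : x ∈ tsupport φ
    · have h1 := hR (hφ.2.2 hx)
      rw [mem_closedBall_zero_iff] at h1
      have h2 : l x ^ 2 ≤ R ^ 2 := by
        have h4 : |l x| ≤ R := (hl x).trans h1
        exact sq_le_sq' (by linarith [(abs_le.1 h4).1]) (abs_le.1 h4).2
      nlinarith [sq_nonneg (φ x + 2 * l x * fderiv ℝ φ x e), sq_nonneg (fderiv ℝ φ x e),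
        mul_le_mul_of_nonneg_right h2 (sq_nonneg (fderiv ℝ φ x e))]
    · have h1 : φ x = 0 := image_eq_zero_of_notMem_tsupport hx
      rw [h1]
      simp
      positivity
  have h5 : ∫ x, -(l x * (2 * φ x * fderiv ℝ φ x e))
      ≤ ∫ x, (1 / 2 * φ x ^ 2 + 2 * R ^ 2 * fderiv ℝ φ x e ^ 2) :=
    integral_mono hi2.neg ((hi0.const_mul (1 / 2)).add (hi1.const_mul (2 * R ^ 2))) hpt
  rw [integral_neg, hibp, neg_neg, integral_add (hi0.const_mul _) (hi1.const_mul _),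
    integral_const_mul, integral_const_mul] at h5
  linarith

theorem gradient_apply (φ : E3 → ℝ) (x : E3) (i : Fin 3) :
    gradient φ x i = fderiv ℝ φ x (EuclideanSpace.single i 1) := by
  rw [← inner_gradient, EuclideanSpace.inner_single_right]; simp

theorem IsTest.integral_sq_le {Ω : Set E3} {φ : E3 → ℝ} (hφ : IsTest Ω φ) {R : ℝ}
    (hR : Ω ⊆ Metric.closedBall 0 R) (i : Fin 3) :
    ∫ x, φ x ^ 2 ≤ 4 * R ^ 2 * ∫ x, (gradient φ x i) ^ 2 := by
  simp_rw [gradient_apply]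
  exact hφ.integral_sq_le_fderiv hR (EuclideanSpace.proj i) (fun x => PiLp.norm_apply_le x i) _
    (by simp)

theorem IsTest.memLp {Ω : Set E3} {φ : E3 → ℝ} (hφ : IsTest Ω φ) (μ : Measure E3)
    [IsFiniteMeasureOnCompacts μ] : MemLp φ 2 μ :=
  hφ.1.continuous.memLp_of_hasCompactSupport hφ.2.1

theorem IsTest.memLp_gradient {Ω : Set E3} {φ : E3 → ℝ} (hφ : IsTest Ω φ) (μ : Measure E3)
    [IsFiniteMeasureOnCompacts μ] : MemLp (gradient φ) 2 μ := by
  have hc : Continuous (gradient φ) :=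
    (InnerProductSpace.toDual ℝ E3).symm.continuous.comp (hφ.1.continuous_fderiv (by simp))
  refine hc.memLp_of_hasCompactSupport ?_
  exact (hφ.2.1.fderiv (𝕜 := ℝ)).comp_left (g := (InnerProductSpace.toDual ℝ E3).symm) (by simp)

theorem eLpNorm_apply_le {α : Type*} [MeasurableSpace α] {μ : Measure α} (f : α → E3) (i : Fin 3) :
    eLpNorm (fun x => f x i) 2 μ ≤ eLpNorm f 2 μ :=
  eLpNorm_mono fun x => PiLp.norm_apply_le (f x) i

theorem memLp_apply {α : Type*} [MeasurableSpace α] {μ : Measure α} {f : α → E3}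
    (hf : MemLp f 2 μ) (i : Fin 3) : MemLp (fun x => f x i) 2 μ :=
  (EuclideanSpace.proj (𝕜 := ℝ) i : E3 →L[ℝ] ℝ).comp_memLp' hf

/-- A single partial derivative suffices on the right. For a vector field this permits pairing
component i with direction i, so that only diagonal entries of the strain appear. -/
theorem MemH10.integral_sq_le {Ω : Set E3} {v : E3 → ℝ} {G : E3 → E3} (h : MemH10 Ω v G)
    {R : ℝ} (hR0 : 0 ≤ R) (hR : Ω ⊆ Metric.closedBall 0 R) (i : Fin 3) :
    ∫ x in Ω, v x ^ 2 ≤ 4 * R ^ 2 * ∫ x in Ω, G x i ^ 2 := by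
  obtain ⟨hv, hG, φ, hφ, h1, h2⟩ := h
  set μ := (volume : Measure E3).restrict Ω with hμ
  have hGi := memLp_apply hG i
  have hgr : ∀ n, MemLp (fun x => gradient (φ n) x i) 2 μ := fun n =>
    memLp_apply ((hφ n).memLp_gradient μ) i
  have key : ∀ n, eLpNorm (φ n) 2 μ
      ≤ ENNReal.ofReal (2 * R) * eLpNorm (fun x => gradient (φ n) x i) 2 μ := by
    intro n
    have e1 := (hφ n).integral_sq_le hR i
    have e2 : ∫ x, φ n x ^ 2 = ∫ x, ‖φ n x‖ ^ 2 ∂μ := by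
      rw [hμ]
      simp_rw [Real.norm_eq_abs, sq_abs]
      refine (setIntegral_eq_integral_of_forall_compl_eq_zero fun x hx => ?_).symm
      rw [image_eq_zero_of_notMem_tsupport fun h' => hx ((hφ n).2.2 h')]; simp
    have e3 : ∫ x, gradient (φ n) x i ^ 2 = ∫ x, ‖gradient (φ n) x i‖ ^ 2 ∂μ := by
      rw [hμ]
      simp_rw [Real.norm_eq_abs, sq_abs]
      refine (setIntegral_eq_integral_of_forall_compl_eq_zero fun x hx => ?_).symm
      rw [gradient_apply, fderiv_apply_eq_zero_of_notMem_tsupport _ fun h' => hx ((hφ n).2.2 h')]; simp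
    rw [e2, e3, ← eLpNorm_two_sq ((hφ n).memLp μ), ← eLpNorm_two_sq (hgr n)] at e1
    have e4 : (eLpNorm (φ n) 2 μ).toReal
        ≤ 2 * R * (eLpNorm (fun x => gradient (φ n) x i) 2 μ).toReal := by
      refine le_of_sq_le_sq ?_ (by positivity)
      nlinarith
    rw [← ENNReal.ofReal_toReal ((hφ n).memLp μ).2.ne,
      ← ENNReal.ofReal_toReal (hgr n).2.ne, ← ENNReal.ofReal_mul (by positivity)]
    exact ENNReal.ofReal_le_ofReal e4
  have hmain : eLpNorm v 2 μ ≤ ENNReal.ofReal (2 * R) * eLpNorm (fun x => G x i) 2 μ := by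
    have hlim : Tendsto (fun n => eLpNorm (fun x => φ n x - v x) 2 μ
        + ENNReal.ofReal (2 * R) * (eLpNorm (fun x => gradient (φ n) x - G x) 2 μ
          + eLpNorm (fun x => G x i) 2 μ)) atTop
        (𝓝 (0 + ENNReal.ofReal (2 * R) * (0 + eLpNorm (fun x => G x i) 2 μ))) :=
      h1.add (ENNReal.Tendsto.const_mul (h2.add_const _) (Or.inr ENNReal.ofReal_ne_top))
    rw [zero_add, zero_add] at hlim
    refine ge_of_tendsto' hlim fun n => ?_
    have t1 : eLpNorm v 2 μ ≤ eLpNorm (fun x => φ n x - v x) 2 μ + eLpNorm (φ n) 2 μ := by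
      have := eLpNorm_sub_le (p := 2) (μ := μ) ((hφ n).memLp μ).1
        (((hφ n).memLp μ).1.sub hv.1) (by norm_num)
      rw [sub_sub_cancel, add_comm] at this
      exact this
    have t2 : eLpNorm (fun x => gradient (φ n) x i) 2 μ
        ≤ eLpNorm (fun x => gradient (φ n) x - G x) 2 μ + eLpNorm (fun x => G x i) 2 μ := by
      have := eLpNorm_add_le (p := 2) (μ := μ) ((hgr n).sub hGi).1 hGi.1 (by norm_num)
      rw [sub_add_cancel] at this
      refine this.trans (add_le_add_left ?_ _)
      exact eLpNorm_apply_le (fun x => gradient (φ n) x - G x) i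
    refine t1.trans (add_le_add_right ((key n).trans ?_) _)
    gcongr
  have e5 : ∫ x in Ω, v x ^ 2 = (eLpNorm v 2 μ).toReal ^ 2 := by
    rw [eLpNorm_two_sq hv]; simp_rw [Real.norm_eq_abs, sq_abs]; rfl
  have e6 : ∫ x in Ω, G x i ^ 2 = (eLpNorm (fun x => G x i) 2 μ).toReal ^ 2 := by
    rw [eLpNorm_two_sq hGi]; simp_rw [Real.norm_eq_abs, sq_abs]; rfl
  rw [e5, e6]
  have e7 : (eLpNorm v 2 μ).toReal ≤ 2 * R * (eLpNorm (fun x => G x i) 2 μ).toReal := by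
    have := ENNReal.toReal_mono (ENNReal.mul_ne_top ENNReal.ofReal_ne_top hGi.2.ne) hmain
    rwa [ENNReal.toReal_mul, ENNReal.toReal_ofReal (by positivity)] at this
  calc (eLpNorm v 2 μ).toReal ^ 2 ≤ (2 * R * (eLpNorm (fun x => G x i) 2 μ).toReal) ^ 2 := by
        gcongr
    _ = _ := by ring

/-! ### Matrix algebra -/

theorem frob_add_left (A B C : Mat) : frob (A + B) C = frob A C + frob B C := by
  simp [frob, add_mul, Finset.sum_add_distrib]

theorem frob_sub_left (A B C : Mat) : frob (A - B) C = frob A C - frob B C := by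
  simp [frob, sub_mul, Finset.sum_sub_distrib]

theorem frob_smul_left (c : ℝ) (A B : Mat) : frob (c • A) B = c * frob A B := by
  simp [frob, Finset.mul_sum, mul_assoc]

theorem frob_comm (A B : Mat) : frob A B = frob B A := by
  simp [frob, mul_comm]

theorem frob_add_right (A B C : Mat) : frob A (B + C) = frob A B + frob A C := by
  rw [frob_comm, frob_add_left, frob_comm B, frob_comm C]

theorem frob_self_nonneg (A : Mat) : 0 ≤ frob A A :=
  Finset.sum_nonneg fun _ _ => Finset.sum_nonneg fun _ _ => mul_self_nonneg _

theorem frob_one_symGrad (D : Fin 3 → E3) : frob 1 (symGrad D) = divergence D := by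
  simp [frob, symGrad, divergence, Fin.sum_univ_three, Matrix.one_apply]

theorem symGrad_isSymm (D : Fin 3 → E3) : (symGrad D).IsSymm := by
  ext i j
  simp [symGrad, add_comm]

theorem diag_sq_le_frob (A : Mat) : ∑ i, A i i ^ 2 ≤ frob A A := by
  refine Finset.sum_le_sum fun i _ => ?_
  rw [pow_two]
  exact Finset.single_le_sum (f := fun j => A i j * A i j) (fun j _ => mul_self_nonneg _)
    (Finset.mem_univ i)

theorem symGrad_diag (D : Fin 3 → E3) (i : Fin 3) : symGrad D i i = D i i := by
  simp [symGrad]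

/-- Cauchy-Schwarz on the three diagonal entries, which are shared by the gradient and its symmetric
part. -/
theorem divergence_sq_le (D : Fin 3 → E3) :
    divergence D ^ 2 ≤ 3 * frob (symGrad D) (symGrad D) := by
  have h := diag_sq_le_frob (symGrad D)
  simp only [symGrad_diag] at h
  rw [Fin.sum_univ_three] at h
  rw [divergence, Fin.sum_univ_three]
  nlinarith [sq_nonneg (D 0 0 - D 1 1), sq_nonneg (D 1 1 - D 2 2), sq_nonneg (D 0 0 - D 2 2)]

/-- The deviatoric part is trace free, hence orthogonal to the multiples of the identity. -/
theorem frob_dev_self (A : Mat) : frob (dev A) A = frob (dev A) (dev A) := by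
  simp [frob, dev, Fin.sum_univ_three, Matrix.one_apply, Matrix.trace]
  ring

theorem dev_isSymm {A : Mat} (h : A.IsSymm) : (dev A).IsSymm :=
  h.sub (Matrix.isSymm_one.smul _)

theorem yosida_isSymm {A : Mat} (k lam : ℝ) (h : A.IsSymm) : (yosida k lam A).IsSymm :=
  (dev_isSymm h).smul _

/-- The flow is a nonnegative multiple of the deviator, so the plastic dissipation has a sign
whatever the value of `lam`. -/
theorem frob_yosida_nonneg {k lam : ℝ} (hlam : 0 < lam) (A : Mat) :
    0 ≤ frob (yosida k lam A) A := by
  rw [yosida, frob_smul_left, frob_dev_self]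
  refine mul_nonneg (div_nonneg (div_nonneg (le_max_right _ _) (by positivity)) ?_)
    (frob_self_nonneg _)
  exact Real.sqrt_nonneg _

theorem linearMap_apply_eq_sum (D : Mat →ₗ[ℝ] Mat) (A : Mat) (i j : Fin 3) :
    D A i j = ∑ k, ∑ l, D (Matrix.single k l 1) i j * A k l := by
  conv_lhs => rw [Matrix.matrix_eq_sum_single A]
  have h : ∀ k l, Matrix.single k l (A k l) = A k l • Matrix.single k l (1 : ℝ) := fun k l => by
    rw [Matrix.smul_single, smul_eq_mul, mul_one]
  simp_rw [h, map_sum, map_smul, Matrix.sum_apply, Matrix.smul_apply, smul_eq_mul, mul_comm]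

/-- Coercivity of a positive definite elasticity tensor. -/
theorem exists_coercive (D : Mat →ₗ[ℝ] Mat)
    (hD : ∀ A : Mat, A.IsSymm → A ≠ 0 → 0 < frob (D A) A) :
    ∃ c : ℝ, 0 < c ∧ ∀ A : Mat, A.IsSymm → c * frob A A ≤ frob (D A) A := by
  set q : (Fin 3 → Fin 3 → ℝ) → ℝ := fun a => frob (D (Matrix.of a)) (Matrix.of a) with hq
  set n : (Fin 3 → Fin 3 → ℝ) → ℝ := fun a => frob (Matrix.of a) (Matrix.of a) with hn
  have hqc : Continuous q := by
    simp only [hq, frob, fun a : Fin 3 → Fin 3 → ℝ => linearMap_apply_eq_sum D (Matrix.of a),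
      Matrix.of_apply]
    fun_prop
  have hnc : Continuous n := by
    simp only [hn, frob, Matrix.of_apply]
    fun_prop
  -- The unit sphere of the symmetric matrices, as a compact set of coordinates. The constant is the
  -- minimum of the quadratic form on it, and homogeneity extends the bound.
  set K : Set (Fin 3 → Fin 3 → ℝ) := {a | (∀ i j, a i j = a j i) ∧ n a = 1} with hK
  have hKc : IsCompact K := by
    refine Metric.isCompact_of_isClosed_isBounded ?_ ?_
    · have : K = (⋂ i, ⋂ j, {a | a i j = a j i}) ∩ {a | n a = 1} := by
        ext a; simp [hK]
      rw [this]
      exact IsClosed.inter (isClosed_iInter fun i => isClosed_iInter fun j =>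
        isClosed_eq (by fun_prop) (by fun_prop)) (isClosed_eq hnc continuous_const)
    · refine (Metric.isBounded_closedBall (x := 0) (r := 1)).subset fun a ha => ?_
      rw [mem_closedBall_zero_iff, pi_norm_le_iff_of_nonneg zero_le_one]
      intro i
      rw [pi_norm_le_iff_of_nonneg zero_le_one]
      intro j
      have h1 : a i j * a i j ≤ n a := by
        refine le_trans ?_ (Finset.single_le_sum (f := fun i => ∑ j, a i j * a i j)
          (fun i _ => Finset.sum_nonneg fun j _ => mul_self_nonneg _) (Finset.mem_univ i))
        exact Finset.single_le_sum (f := fun j => a i j * a i j) (fun j _ => mul_self_nonneg _)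
          (Finset.mem_univ j)
      rw [ha.2] at h1
      rw [Real.norm_eq_abs, abs_le]
      constructor <;> nlinarith
  have hscale : ∀ A : Mat, frob (D A) A = q A := fun A => rfl
  have key : ∃ c : ℝ, 0 < c ∧ ∀ a ∈ K, c ≤ q a := by
    rcases K.eq_empty_or_nonempty with h | h
    · exact ⟨1, one_pos, by simp [h]⟩
    · obtain ⟨a, ha, hmin⟩ := hKc.exists_isMinOn h hqc.continuousOn
      refine ⟨q a, hD _ (Matrix.IsSymm.ext fun i j => ?_) ?_, fun b hb => hmin hb⟩
      · exact (ha.1 i j).symm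
      · intro h0
        have h1 : n a = 1 := ha.2
        simp only [hn] at h1
        rw [h0] at h1
        simp [frob] at h1
  obtain ⟨c, hc, hcK⟩ := key
  refine ⟨c, hc, fun A hA => ?_⟩
  rcases (frob_self_nonneg A).eq_or_lt with h0 | hpos
  · rw [← h0, mul_zero]
    have : A = 0 := by
      ext i j
      have h1 := Finset.sum_eq_zero_iff_of_nonneg
        (fun i _ => Finset.sum_nonneg fun j _ => mul_self_nonneg (A i j)) |>.1 h0.symm i
        (Finset.mem_univ i)
      have h2 := Finset.sum_eq_zero_iff_of_nonneg
        (fun j _ => mul_self_nonneg (A i j)) |>.1 h1 j (Finset.mem_univ j)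
      simpa using h2
    rw [this]
    simp [frob]
  · set s := √(frob A A) with hs
    have hs0 : 0 < s := Real.sqrt_pos.2 hpos
    have hs2 : s ^ 2 = frob A A := Real.sq_sqrt hpos.le
    have hm : (fun i j => (s⁻¹ • A) i j) ∈ K := by
      refine ⟨fun i j => ?_, ?_⟩
      · simp [hA.apply i j]
      · change frob (s⁻¹ • A) (s⁻¹ • A) = 1
        rw [frob_smul_left, frob_comm, frob_smul_left, ← hs2]
        field_simp
    have h1 := hcK _ hm
    change c ≤ frob (D (s⁻¹ • A)) (s⁻¹ • A) at h1
    rw [map_smul, frob_smul_left, frob_comm, frob_smul_left, frob_comm] at h1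
    have h2 : s⁻¹ * (s⁻¹ * frob (D A) A) = frob (D A) A / frob A A := by
      rw [← hs2]; field_simp
    rw [h2, le_div_iff₀ hpos] at h1
    exact h1

/-! ### Truncation -/

theorem abs_trunc_le {K : ℝ} (hK : 0 < K) (r : ℝ) : |trunc K r| ≤ K := by
  rw [trunc, abs_le]
  exact ⟨le_min (by linarith) (le_max_right _ _), min_le_left _ _⟩

theorem trunc_of_nonneg {K r : ℝ} (hK : 0 < K) (hr : 0 ≤ r) : 0 ≤ trunc K r ∧ trunc K r ≤ r := by
  rw [trunc, max_eq_left (by linarith)]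
  exact ⟨le_min hK.le hr, min_le_right _ _⟩

theorem trunc_of_neg {K r : ℝ} (hK : 0 < K) (hr : r < 0) : trunc K r < 0 ∧ r ≤ trunc K r := by
  have h : max r (-K) < 0 := max_lt hr (by linarith)
  rw [trunc, min_eq_right (by linarith)]
  exact ⟨h, le_max_left _ _⟩

theorem continuous_trunc (K : ℝ) : Continuous (trunc K) := by
  unfold trunc
  fun_prop

theorem abs_trunc_le_abs {K : ℝ} (hK : 0 < K) (r : ℝ) : |trunc K r| ≤ |r| := by
  rcases le_or_gt 0 r with h | h
  · have := trunc_of_nonneg hK h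
    rw [abs_of_nonneg this.1, abs_of_nonneg h]; exact this.2
  · have := trunc_of_neg hK h
    rw [abs_of_neg this.1, abs_of_neg h]; linarith [this.2]

/-! ### Functions with an integrable time derivative -/

section TimeDeriv

variable {T : ℝ} {μ : Measure E3} [IsFiniteMeasure μ]

/-- `w(t) = w₀ + ∫₀ᵗ F(s) ds` almost everywhere, with integrable `w₀` and `F`. -/
def HasL1TimeDeriv (T : ℝ) (μ : Measure E3) (w₀ : E3 → ℝ) (w F : ℝ → E3 → ℝ) : Prop :=
  Integrable w₀ μ ∧ Integrable (fun p : ℝ × E3 => F p.1 p.2) (cyl T μ) ∧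
    ∀ᵐ p ∂(cyl T μ), w p.1 p.2 = w₀ p.2 + ∫ s in (0 : ℝ)..p.1, F s p.2

theorem HasL1TimeDeriv.integral_eq {w₀ : E3 → ℝ} {w F : ℝ → E3 → ℝ}
    (h : HasL1TimeDeriv T μ w₀ w F) :
    ∀ᵐ t ∂(volume.restrict (Ioo 0 T)), Integrable (w t) μ ∧
      ∫ x, w t x ∂μ = ∫ x, w₀ x ∂μ + ∫ s in (0 : ℝ)..t, ∫ x, F s x ∂μ :=
  integral_of_ae_eq_primitive h.1 h.2.1 h.2.2

theorem HasL1TimeDeriv.add {w₀ v₀ : E3 → ℝ} {w F v H : ℝ → E3 → ℝ}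
    (h : HasL1TimeDeriv T μ w₀ w F) (h' : HasL1TimeDeriv T μ v₀ v H) :
    HasL1TimeDeriv T μ (fun x => w₀ x + v₀ x) (fun t x => w t x + v t x)
      (fun t x => F t x + H t x) := by
  refine ⟨h.1.add h'.1, h.2.1.add h'.2.1, ?_⟩
  filter_upwards [h.2.2, h'.2.2, ae_cyl_mem_Ioo,
    ae_cyl_of_ae_snd (ae_integrableOn_of_integrable_cyl h.2.1),
    ae_cyl_of_ae_snd (ae_integrableOn_of_integrable_cyl h'.2.1)] with p hp hp' hpT hpi hpi'
  rw [hp, hp', intervalIntegral.integral_add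
    (intervalIntegrable_of_integrableOn_Ioo hpi hpT.1.le hpT.2.le)
    (intervalIntegrable_of_integrableOn_Ioo hpi' hpT.1.le hpT.2.le)]
  ring

theorem HasL1TimeDeriv.sum {ι : Type*} (s : Finset ι) {w₀ : ι → E3 → ℝ} {w F : ι → ℝ → E3 → ℝ}
    (h : ∀ i, HasL1TimeDeriv T μ (w₀ i) (w i) (F i)) :
    HasL1TimeDeriv T μ (fun x => ∑ i ∈ s, w₀ i x) (fun t x => ∑ i ∈ s, w i t x)
      (fun t x => ∑ i ∈ s, F i t x) := by
  classical
  induction s using Finset.induction_on with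
  | empty =>
    simp only [Finset.sum_empty]
    exact ⟨integrable_zero _ _ _, integrable_zero _ _ _, by simp⟩
  | insert a s ha ih =>
    simp only [Finset.sum_insert ha]
    exact (h a).add ih

theorem HasTimeDeriv.sum {ι : Type*} (s : Finset ι) {w₀ : ι → E3 → ℝ} {w F : ι → ℝ → E3 → ℝ}
    (h : ∀ i, HasTimeDeriv T μ (w₀ i) (w i) (F i)) :
    HasTimeDeriv T μ (fun x => ∑ i ∈ s, w₀ i x) (fun t x => ∑ i ∈ s, w i t x)
      (fun t x => ∑ i ∈ s, F i t x) := by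
  classical
  induction s using Finset.induction_on with
  | empty =>
    simp only [Finset.sum_empty]
    exact ⟨MemLp.zero', MemLp.zero', by simp⟩
  | insert a s ha ih =>
    simp only [Finset.sum_insert ha]
    exact (h a).add ih

theorem HasTimeDeriv.mul {v₀ w₀ : E3 → ℝ} {v v' w w' : ℝ → E3 → ℝ}
    (hv : HasTimeDeriv T μ v₀ v v') (hw : HasTimeDeriv T μ w₀ w w') :
    HasL1TimeDeriv T μ (fun x => v₀ x * w₀ x) (fun t x => v t x * w t x)
      (fun t x => v' t x * w t x + v t x * w' t x) := by
  refine ⟨hv.1.integrable_mul hw.1,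
    (MemLp.integrable_mul hv.2.1 hw.memL2L2).add (MemLp.integrable_mul hv.memL2L2 hw.2.1), ?_⟩
  filter_upwards [hv.2.2, hw.2.2, ae_cyl_mem_Ioo,
    ae_cyl_of_ae_snd (ae_ae_of_ae_cyl hv.2.2), ae_cyl_of_ae_snd (ae_ae_of_ae_cyl hw.2.2),
    ae_cyl_of_ae_snd (ae_integrableOn_of_integrable_cyl hv.2.1.integrable),
    ae_cyl_of_ae_snd (ae_integrableOn_of_integrable_cyl hw.2.1.integrable)]
    with p hp hp' hpT hpe hpe' hpi hpi'
  have := integral_primitive_mul_primitive (v₀ p.2) (w₀ p.2)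
    (intervalIntegrable_of_integrableOn_Ioo hpi hpT.1.le hpT.2.le)
    (intervalIntegrable_of_integrableOn_Ioo hpi' hpT.1.le hpT.2.le)
  rw [← hp, ← hp'] at this
  rw [← sub_eq_iff_eq_add', ← this, intervalIntegral.integral_of_le hpT.1.le,
    intervalIntegral.integral_of_le hpT.1.le, ← restrict_Ioo_eq_restrict_Ioc]
  refine integral_congr_ae ?_
  filter_upwards [ae_restrict_of_ae_restrict_of_subset (Ioo_subset_Ioo_right hpT.2.le) hpe,
    ae_restrict_of_ae_restrict_of_subset (Ioo_subset_Ioo_right hpT.2.le) hpe'] with t ht ht'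
  rw [ht, ht']

/-- Serves to replace the initial gradient supplied with a solution by one chosen beforehand from
the data. -/
theorem HasTimeDeriv.congr_init {X : Type*} [NormedAddCommGroup X] [NormedSpace ℝ X]
    {v₀ w₀ : E3 → X} {v v' : ℝ → E3 → X} (h : HasTimeDeriv T μ v₀ v v') (hw : v₀ =ᵐ[μ] w₀) :
    HasTimeDeriv T μ w₀ v v' := by
  refine ⟨(memLp_congr_ae hw).1 h.1, h.2.1, ?_⟩
  filter_upwards [h.2.2, ae_cyl_of_ae_snd hw] with p hp hp'
  rw [hp, hp']

theorem HasTimeDeriv.linearMap_apply (D : Mat →ₗ[ℝ] Mat) {e₀ : E3 → Mat} {e e' : ℝ → E3 → Mat}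
    (h : ∀ i j, HasTimeDeriv T μ (fun x => e₀ x i j) (fun t x => e t x i j)
      (fun t x => e' t x i j)) (i j : Fin 3) :
    HasTimeDeriv T μ (fun x => D (e₀ x) i j) (fun t x => D (e t x) i j)
      (fun t x => D (e' t x) i j) := by
  simp only [fun x => linearMap_apply_eq_sum D (e₀ x) i j,
    fun t x => linearMap_apply_eq_sum D (e t x) i j, fun t x => linearMap_apply_eq_sum D (e' t x) i j]
  exact HasTimeDeriv.sum _ fun k => HasTimeDeriv.sum _ fun l => (h k l).const_mul _

/-- The time derivative of the elastic energy. -/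
theorem hasL1TimeDeriv_frob (D : Mat →ₗ[ℝ] Mat) {e₀ : E3 → Mat} {e e' : ℝ → E3 → Mat}
    (h : ∀ i j, HasTimeDeriv T μ (fun x => e₀ x i j) (fun t x => e t x i j)
      (fun t x => e' t x i j)) :
    HasL1TimeDeriv T μ (fun x => frob (D (e₀ x)) (e₀ x)) (fun t x => frob (D (e t x)) (e t x))
      (fun t x => frob (D (e' t x)) (e t x) + frob (D (e t x)) (e' t x)) := by
  have := HasL1TimeDeriv.sum Finset.univ fun i => HasL1TimeDeriv.sum Finset.univ fun j =>
    (HasTimeDeriv.linearMap_apply D h i j).mul (h i j)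
  simp_rw [Finset.sum_add_distrib] at this
  exact this

end TimeDeriv

/-! ### Testing the momentum balance with fields in `H¹₀` -/

theorem isTest_smul_single {Ω : Set E3} {φ : E3 → ℝ} (hφ : IsTest Ω φ) (i : Fin 3) :
    IsTest Ω (fun y => φ y • EuclideanSpace.single i (1 : ℝ)) :=
  ⟨hφ.1.smul contDiff_const, hφ.2.1.smul_right, (tsupport_smul_subset_left _ _).trans hφ.2.2⟩

theorem frob_symGrad (S : Mat) (D : Fin 3 → E3) :
    frob S (symGrad D) = ∑ i, inner ℝ (WithLp.toLp 2 fun j => (S i j + S j i) / 2) (D i) := by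
  simp [frob, symGrad, Fin.sum_univ_three, PiLp.inner_apply]
  ring

theorem memLp_toLp {α : Type*} [MeasurableSpace α] {μ : Measure α} {f : α → Fin 3 → ℝ}
    (hf : ∀ i, MemLp (fun x => f x i) 2 μ) : MemLp (fun x => (WithLp.toLp 2 (f x) : E3)) 2 μ := by
  have h : (fun x => (WithLp.toLp 2 (f x) : E3))
      = fun x => ∑ i, f x i • EuclideanSpace.single i (1 : ℝ) := by
    ext x j
    simp [Finset.sum_apply, Pi.single_apply]
  rw [h]
  refine memLp_finsetSum _ fun i _ => ?_
  have := (ContinuousLinearMap.toSpanSingleton ℝ (EuclideanSpace.single i (1 : ℝ) : E3)).comp_memLp'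
    (hf i)
  exact this

/-- An equation in the sense of distributions may be tested with functions in `H¹₀`. -/
theorem integral_frob_symGrad_of_memH10 {Ω : Set E3} {S : E3 → Mat} {F : E3 → E3}
    (hS : ∀ i j, MemLp (fun x => S x i j) 2 (volume.restrict Ω))
    (hF : MemLp F 2 (volume.restrict Ω))
    (h : ∀ w : E3 → E3, IsTest Ω w →
      ∫ x in Ω, frob (S x) (symGrad fun i => gradient (fun y => w y i) x)
        = ∫ x in Ω, inner ℝ (F x) (w x))
    {v : E3 → E3} {D : E3 → Fin 3 → E3}
    (hv : ∀ i, MemH10 Ω (fun x => v x i) (fun x => D x i)) :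
    ∫ x in Ω, frob (S x) (symGrad (D x)) = ∫ x in Ω, inner ℝ (F x) (v x) := by
  set μ := (volume : Measure E3).restrict Ω with hμ
  set r : Fin 3 → E3 → E3 := fun i x => WithLp.toLp 2 fun j => (S x i j + S x j i) / 2 with hr
  have hrL : ∀ i, MemLp (r i) 2 μ := fun i => memLp_toLp fun j => by
    have := ((hS i j).add (hS j i)).const_mul (1 / 2)
    refine (memLp_congr_ae (Eventually.of_forall fun x => ?_)).1 this
    simp only [Pi.add_apply]
    ring
  -- Fields with a single nonzero component split the vector equation into one scalar identity for
  -- each row of the symmetrized stress; each passes to the limit separately.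
  have htest : ∀ i φ, IsTest Ω φ → ∫ x, inner ℝ (r i x) (gradient φ x) ∂μ
      = ∫ x, inner ℝ (F x i) (φ x) ∂μ := by
    intro i φ hφ
    have h1 := h _ (isTest_smul_single hφ i)
    have e1 : ∀ x, frob (S x) (symGrad fun j => gradient (fun y =>
        (φ y • EuclideanSpace.single i (1 : ℝ) : E3) j) x) = inner ℝ (r i x) (gradient φ x) := by
      intro x
      rw [frob_symGrad, Finset.sum_eq_single i]
      · simp [hr]
      · intro j _ hj
        have : (fun y => (φ y • EuclideanSpace.single i (1 : ℝ) : E3) j) = fun _ => 0 := by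
          ext y; simp [hj]
        rw [this]
        simp [gradient_fun_const]
      · simp
    have e2 : ∀ x, inner ℝ (F x) (φ x • EuclideanSpace.single i (1 : ℝ) : E3)
        = inner ℝ (F x i) (φ x) := by
      intro x
      rw [inner_smul_right, EuclideanSpace.inner_single_right]
      simp
    simp_rw [e1, e2] at h1
    exact h1
  have hlim : ∀ i, ∫ x, inner ℝ (r i x) (D x i) ∂μ = ∫ x, inner ℝ (F x i) (v x i) ∂μ := by
    intro i
    obtain ⟨hv1, hv2, φ, hφ, h1, h2⟩ := hv i
    have t1 := tendsto_integral_inner (hrL i) hv2 (fun n => (hφ n).memLp_gradient μ) h2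
    have t2 := tendsto_integral_inner (memLp_apply hF i) hv1 (fun n => (hφ n).memLp μ) h1
    simp_rw [fun n => htest i _ (hφ n)] at t1
    exact tendsto_nhds_unique t1 t2
  simp_rw [frob_symGrad]
  have e3 : ∀ x, inner ℝ (F x) (v x) = ∑ i, inner ℝ (F x i) (v x i) := fun x =>
    PiLp.inner_apply _ _
  simp_rw [e3]
  rw [integral_finsetSum _ fun i _ => MemLp.integrable_real_inner (hrL i) (hv i).2.1,
    integral_finsetSum _ fun i _ => MemLp.integrable_real_inner (memLp_apply hF i) (hv i).1]
  exact Finset.sum_congr rfl fun i _ => hlim i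

theorem integrable_frob {α : Type*} [MeasurableSpace α] {μ : Measure α} {A B : α → Mat}
    (hA : ∀ i j, MemLp (fun x => A x i j) 2 μ) (hB : ∀ i j, MemLp (fun x => B x i j) 2 μ) :
    Integrable (fun x => frob (A x) (B x)) μ :=
  integrable_finsetSum _ fun i _ => integrable_finsetSum _ fun j _ =>
    (hA i j).integrable_mul (hB i j)

theorem ae_memLp_of_memL2L2 {X : Type*} [NormedAddCommGroup X] {T : ℝ} {μ : Measure E3}
    [IsFiniteMeasure μ] {v : ℝ → E3 → X} (h : MemL2L2 T μ v) :
    ∀ᵐ t ∂(volume.restrict (Ioo 0 T)), MemLp (v t) 2 μ := by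
  have h1 := h.1.prodMk_left
  have h2 : Integrable (fun p : ℝ × E3 => ‖v p.1 p.2‖ ^ 2) (cyl T μ) := MemLp.integrable_norm_pow h
    (by norm_num)
  filter_upwards [h1, h2.prod_right_ae] with t ht1 ht2
  exact (memLp_two_iff_integrable_sq_norm ht1).2 ht2

/-! ### Integrability, symmetry and signs for the approximate solutions -/

namespace Model

variable {P : Model}

theorem Admissible.isFiniteMeasure_vol (hP : P.Admissible) : IsFiniteMeasure P.vol :=
  ⟨by rw [vol, Measure.restrict_apply_univ]; exact hP.isBounded.measure_lt_top⟩

/-- The thermal stress. -/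
noncomputable def thermalStress (P : Model) (θb : ℝ → E3 → ℝ) (lam : ℝ) (θ : ℝ → E3 → ℝ) (t : ℝ)
    (x : E3) : ℝ := P.f (trunc (1 / lam) (θ t x + θb t x))

/-- This bound depends on `lam`. It serves only the integrability of the products and enters no
final constant. -/
theorem Admissible.exists_thermalStress_bound (hP : P.Admissible) {lam : ℝ} (hlam : 0 < lam) :
    ∃ B : ℝ, ∀ r : ℝ, |P.f (trunc (1 / lam) r)| ≤ B := by
  obtain ⟨B, hB⟩ := (isCompact_Icc (a := -(1 / lam)) (b := 1 / lam)).exists_bound_of_continuousOn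
    hP.f_continuous.continuousOn
  exact ⟨B, fun r => hB _ (abs_le.1 (abs_trunc_le (by positivity) r))⟩

theorem Admissible.aestronglyMeasurable_thermalStress (hP : P.Admissible) {θb θ : ℝ → E3 → ℝ}
    (lam : ℝ)
    (hθ : AEStronglyMeasurable (fun p : ℝ × E3 => θ p.1 p.2) (cyl P.T P.vol))
    (hθb : AEStronglyMeasurable (fun p : ℝ × E3 => θb p.1 p.2) (cyl P.T P.vol)) :
    AEStronglyMeasurable (fun p : ℝ × E3 => P.thermalStress θb lam θ p.1 p.2) (cyl P.T P.vol) :=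
  (hP.f_continuous.comp (continuous_trunc _)).comp_aestronglyMeasurable (hθ.add hθb)

theorem Admissible.memL2L2_thermalStress (hP : P.Admissible) {θb θ : ℝ → E3 → ℝ}
    {lam : ℝ} (hlam : 0 < lam)
    (hθ : AEStronglyMeasurable (fun p : ℝ × E3 => θ p.1 p.2) (cyl P.T P.vol))
    (hθb : AEStronglyMeasurable (fun p : ℝ × E3 => θb p.1 p.2) (cyl P.T P.vol)) :
    MemL2L2 P.T P.vol (P.thermalStress θb lam θ) := by
  have := hP.isFiniteMeasure_vol
  obtain ⟨B, hB⟩ := hP.exists_thermalStress_bound hlam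
  exact MemLp.of_bound (hP.aestronglyMeasurable_thermalStress lam hθ hθb) B
    (Eventually.of_forall fun p => hB _)

/-- The truncated dissipation. -/
noncomputable def dissipation (lam : ℝ) (τ εp' : ℝ → E3 → Mat) (t : ℝ) (x : E3) : ℝ :=
  trunc (1 / lam) (frob (εp' t x) (τ t x))

/-- The squared norm of the strain rate. -/
noncomputable def strainRateSq (Du' : ℝ → E3 → Fin 3 → E3) (t : ℝ) (x : E3) : ℝ :=
  frob (symGrad (Du' t x)) (symGrad (Du' t x))

section

variable {θb : ℝ → E3 → ℝ} {lam : ℝ} {u : ℝ → E3 → E3} {τ εp : ℝ → E3 → Mat} {θ : ℝ → E3 → ℝ}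
  {u' : ℝ → E3 → E3} {Du Du' : ℝ → E3 → Fin 3 → E3} {εp' : ℝ → E3 → Mat}
  {θ' : ℝ → E3 → ℝ} {Gθ : ℝ → E3 → E3}

/-- Weak gradients are unique, so the initial gradient of every solution agrees with the prescribed
`G₀`. The initial elastic energy then depends on the data alone. -/
theorem SolvesApprox.gradTimeDeriv (hP : P.Admissible)
    (h : P.SolvesApprox θb lam u τ εp θ u' Du Du' εp' θ' Gθ) {G₀ : Fin 3 → E3 → E3}
    (hG₀ : ∀ i, MemH1 P.Ω (fun x => P.u₀ x i) (G₀ i)) (i j : Fin 3) :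
    HasTimeDeriv P.T P.vol (fun x => G₀ i x j) (fun t x => Du t x i j) (fun t x => Du' t x i j) := by
  have := hP.isFiniteMeasure_vol
  have : IsFiniteMeasure (volume.restrict P.Ω) := hP.isFiniteMeasure_vol
  obtain ⟨-, ⟨G, hG, hD⟩, -⟩ := h.u_mem i
  exact (hD.congr_init (hG.2.2.ae_eq hP.isOpen (hG₀ i).2.2)).clm_comp (EuclideanSpace.proj j)

theorem SolvesApprox.elasticTimeDeriv (hP : P.Admissible)
    (h : P.SolvesApprox θb lam u τ εp θ u' Du Du' εp' θ' Gθ) {G₀ : Fin 3 → E3 → E3}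
    (hG₀ : ∀ i, MemH1 P.Ω (fun x => P.u₀ x i) (G₀ i)) (i j : Fin 3) :
    HasTimeDeriv P.T P.vol (fun x => (symGrad (fun k => G₀ k x) - P.εp₀ x) i j)
      (fun t x => (symGrad (Du t x) - εp t x) i j)
      (fun t x => (symGrad (Du' t x) - εp' t x) i j) := by
  have := hP.isFiniteMeasure_vol
  have h1 := (((h.gradTimeDeriv hP hG₀ i j).add (h.gradTimeDeriv hP hG₀ j i)).const_mul (1 / 2)).add
    ((h.εp_mem i j).const_mul (-1))
  convert h1 using 3 <;> simp [symGrad] <;> ring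

theorem SolvesApprox.elastic_isSymm (h : P.SolvesApprox θb lam u τ εp θ u' Du Du' εp' θ' Gθ) :
    ∀ᵐ p ∂(cyl P.T P.vol), (symGrad (Du p.1 p.2) - εp p.1 p.2).IsSymm := by
  filter_upwards [h.εp_symm] with p hp using (symGrad_isSymm _).sub hp

/-- The flow rule makes `εp'` a multiple of the deviator of a symmetric stress. Symmetry matters
because the elasticity tensor is self-adjoint only on symmetric matrices. -/
theorem SolvesApprox.elasticRate_isSymm (hP : P.Admissible)
    (h : P.SolvesApprox θb lam u τ εp θ u' Du Du' εp' θ' Gθ) :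
    ∀ᵐ p ∂(cyl P.T P.vol), (symGrad (Du' p.1 p.2) - εp' p.1 p.2).IsSymm := by
  filter_upwards [h.elastic_isSymm, h.stress, h.flow] with p hp1 hp2 hp3
  refine (symGrad_isSymm _).sub ?_
  rw [hp3, hp2]
  exact yosida_isSymm _ _ (hP.D_symm_mem _ hp1)

/-- Truncation of a nonnegative quantity can only lower it. This lets the mechanical dissipation
dominate the heat it produces. -/
theorem SolvesApprox.dissipation_le (hlam : 0 < lam)
    (h : P.SolvesApprox θb lam u τ εp θ u' Du Du' εp' θ' Gθ) :
    ∀ᵐ p ∂(cyl P.T P.vol), 0 ≤ dissipation lam τ εp' p.1 p.2 ∧ dissipation lam τ εp' p.1 p.2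
      ≤ frob (P.D (symGrad (Du p.1 p.2) - εp p.1 p.2)) (εp' p.1 p.2) := by
  filter_upwards [h.stress, h.flow] with p hp2 hp3
  rw [dissipation, ← hp2, frob_comm (τ p.1 p.2)]
  refine trunc_of_nonneg (by positivity) ?_
  rw [hp3]
  exact frob_yosida_nonneg hlam _

end

end Model

theorem integrable_slices {T : ℝ} {μ : Measure E3} [IsFiniteMeasure μ] {F : ℝ → E3 → ℝ}
    (hF : Integrable (fun p : ℝ × E3 => F p.1 p.2) (cyl T μ)) :
    ∀ᵐ t ∂(volume.restrict (Ioo 0 T)), Integrable (F t) μ := hF.prod_right_ae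

theorem integrableOn_integral {T : ℝ} {μ : Measure E3} [IsFiniteMeasure μ] {F : ℝ → E3 → ℝ}
    (hF : Integrable (fun p : ℝ × E3 => F p.1 p.2) (cyl T μ)) :
    IntegrableOn (fun t => ∫ x, F t x ∂μ) (Ioo 0 T) := hF.integral_prod_left

theorem intervalIntegral_mono_ae_Ioo {T s : ℝ} {g h : ℝ → ℝ} (hs : s ∈ Ioo 0 T)
    (hg : IntegrableOn g (Ioo 0 T)) (hh : IntegrableOn h (Ioo 0 T))
    (H : ∀ᵐ t ∂(volume.restrict (Ioo 0 T)), g t ≤ h t) :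
    ∫ t in (0 : ℝ)..s, g t ≤ ∫ t in (0 : ℝ)..s, h t := by
  refine intervalIntegral.integral_mono_ae_restrict hs.1.le
    (intervalIntegrable_of_integrableOn_Ioo hg hs.1.le hs.2.le)
    (intervalIntegrable_of_integrableOn_Ioo hh hs.1.le hs.2.le) ?_
  rw [← restrict_Ioo_eq_restrict_Icc]
  exact ae_restrict_of_ae_restrict_of_subset (Ioo_subset_Ioo_right hs.2.le) H

theorem intervalIntegral_le_of_nonneg {T s : ℝ} {g : ℝ → ℝ} (hs : s ∈ Ioo 0 T)
    (hg : IntegrableOn g (Ioo 0 T)) (H : ∀ᵐ t ∂(volume.restrict (Ioo 0 T)), 0 ≤ g t) :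
    ∫ t in (0 : ℝ)..s, g t ≤ ∫ t in Ioo 0 T, g t := by
  rw [intervalIntegral.integral_of_le hs.1.le, ← restrict_Ioo_eq_restrict_Ioc]
  exact setIntegral_mono_set hg H (Ioo_subset_Ioo_right hs.2.le).eventuallyLE

namespace Model

variable {P : Model} {θb : ℝ → E3 → ℝ} {lam : ℝ} {u : ℝ → E3 → E3} {τ εp : ℝ → E3 → Mat}
  {θ : ℝ → E3 → ℝ} {u' : ℝ → E3 → E3} {Du Du' : ℝ → E3 → Fin 3 → E3} {εp' : ℝ → E3 → Mat}
  {θ' : ℝ → E3 → ℝ} {Gθ : ℝ → E3 → E3}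

theorem SolvesApprox.memL2L2_strainRate (hP : P.Admissible)
    (h : P.SolvesApprox θb lam u τ εp θ u' Du Du' εp' θ' Gθ) (i j : Fin 3) :
    MemL2L2 P.T P.vol (fun t x => symGrad (Du' t x) i j) := by
  choose G₀ hG₀ using hP.u₀_mem
  have h1 : MemL2L2 P.T P.vol (fun t x => (1 / 2) * (Du' t x i j + Du' t x j i)) :=
    (MemLp.add (h.gradTimeDeriv hP hG₀ i j).2.1 (h.gradTimeDeriv hP hG₀ j i).2.1).const_mul _
  convert h1 using 3
  simp [symGrad]
  ring

theorem SolvesApprox.integrable_strainRateSq (hP : P.Admissible)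
    (h : P.SolvesApprox θb lam u τ εp θ u' Du Du' εp' θ' Gθ) :
    Integrable (fun p : ℝ × E3 => strainRateSq Du' p.1 p.2) (cyl P.T P.vol) :=
  integrable_frob (h.memL2L2_strainRate hP) (h.memL2L2_strainRate hP)

theorem SolvesApprox.memL2L2_divergence (hP : P.Admissible)
    (h : P.SolvesApprox θb lam u τ εp θ u' Du Du' εp' θ' Gθ) :
    MemL2L2 P.T P.vol (fun t x => divergence (Du' t x)) := by
  have h1 : MemL2L2 P.T P.vol (fun t x => ∑ i, symGrad (Du' t x) i i) :=
    memLp_finsetSum _ fun i _ => h.memL2L2_strainRate hP i i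
  simp only [symGrad_diag] at h1
  exact h1

theorem SolvesApprox.memL2L2_temperature
    (h : P.SolvesApprox θb lam u τ εp θ u' Du Du' εp' θ' Gθ) : MemL2L2 P.T P.vol θ := h.θ_space.1

theorem SolvesApprox.memL2L2_thermalStress (hP : P.Admissible) (hlam : 0 < lam)
    (hθb : MemL2L2 P.T P.vol θb)
    (h : P.SolvesApprox θb lam u τ εp θ u' Du Du' εp' θ' Gθ) :
    MemL2L2 P.T P.vol (P.thermalStress θb lam θ) :=
  hP.memL2L2_thermalStress hlam h.memL2L2_temperature.1 hθb.1

theorem SolvesApprox.memL2L2_stress (hP : P.Admissible)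
    (h : P.SolvesApprox θb lam u τ εp θ u' Du Du' εp' θ' Gθ) (i j : Fin 3) :
    MemL2L2 P.T P.vol (fun t x => P.D (symGrad (Du t x) - εp t x) i j) := by
  have := hP.isFiniteMeasure_vol
  choose G₀ hG₀ using hP.u₀_mem
  exact (HasTimeDeriv.linearMap_apply P.D (e₀ := fun x => symGrad (fun k => G₀ k x) - P.εp₀ x)
    (e := fun t x => symGrad (Du t x) - εp t x) (e' := fun t x => symGrad (Du' t x) - εp' t x)
    (h.elasticTimeDeriv hP hG₀) i j).memL2L2

theorem SolvesApprox.memL2L2_viscousStress (hP : P.Admissible)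
    (h : P.SolvesApprox θb lam u τ εp θ u' Du Du' εp' θ' Gθ) (i j : Fin 3) :
    MemL2L2 P.T P.vol (fun t x => P.D (symGrad (Du' t x)) i j) := by
  simp only [fun t x => linearMap_apply_eq_sum P.D (symGrad (Du' t x)) i j]
  exact memLp_finsetSum _ fun k _ => memLp_finsetSum _ fun l _ =>
    (h.memL2L2_strainRate hP k l).const_mul _

theorem SolvesApprox.integrable_dissipation (hP : P.Admissible) (hlam : 0 < lam)
    (h : P.SolvesApprox θb lam u τ εp θ u' Du Du' εp' θ' Gθ) :
    Integrable (fun p : ℝ × E3 => dissipation lam τ εp' p.1 p.2) (cyl P.T P.vol) := by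
  have := hP.isFiniteMeasure_vol
  have hi : Integrable (fun p : ℝ × E3 => frob (εp' p.1 p.2) (P.D (symGrad (Du p.1 p.2) - εp p.1 p.2)))
      (cyl P.T P.vol) :=
    integrable_frob (fun i j => (h.εp_mem i j).2.1) (h.memL2L2_stress hP)
  have hm : AEStronglyMeasurable (fun p : ℝ × E3 => dissipation lam τ εp' p.1 p.2)
      (cyl P.T P.vol) := by
    refine ((continuous_trunc (1 / lam)).comp_aestronglyMeasurable hi.1).congr ?_
    filter_upwards [h.stress] with p hp
    rw [dissipation, hp]
  exact (MemLp.of_bound (p := 1) hm (1 / lam) (Eventually.of_forall fun p =>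
    abs_trunc_le (by positivity) _)).integrable le_rfl

/-! ### The mechanical energy estimate -/

/-- The momentum balance tested with the velocity. -/
theorem SolvesApprox.integral_power_balance (hP : P.Admissible) (hlam : 0 < lam)
    (hθb : MemL2L2 P.T P.vol θb)
    (h : P.SolvesApprox θb lam u τ εp θ u' Du Du' εp' θ' Gθ) :
    ∀ᵐ t ∂(volume.restrict (Ioo 0 P.T)),
      ∫ x, frob (P.D (symGrad (Du t x) - εp t x)) (symGrad (Du' t x) - εp' t x) ∂P.vol
        + ∫ x, frob (P.D (symGrad (Du t x) - εp t x)) (εp' t x) ∂P.vol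
        + ∫ x, frob (P.D (symGrad (Du' t x))) (symGrad (Du' t x)) ∂P.vol
      = ∫ x, P.thermalStress θb lam θ t x * divergence (Du' t x) ∂P.vol
        + ∫ x, inner ℝ (P.F t x) (u' t x) ∂P.vol := by
  have := hP.isFiniteMeasure_vol
  have hv : ∀ᵐ t ∂(volume.restrict (Ioo 0 P.T)), ∀ i,
      MemH10 P.Ω (fun x => u' t x i) (fun x => Du' t x i) :=
    ae_all_iff.2 fun i => (h.u_mem i).2.2.2
  filter_upwards [ae_all_iff.2 fun i => ae_all_iff.2 fun j => ae_memLp_of_memL2L2 (h.memL2L2_stress hP i j),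
    ae_all_iff.2 fun i => ae_all_iff.2 fun j => ae_memLp_of_memL2L2 (h.memL2L2_viscousStress hP i j),
    ae_all_iff.2 fun i => ae_all_iff.2 fun j => ae_memLp_of_memL2L2 (h.memL2L2_strainRate hP i j),
    ae_all_iff.2 fun i => ae_all_iff.2 fun j => ae_memLp_of_memL2L2 (h.εp_mem i j).2.1, hv,
    ae_memLp_of_memL2L2 (h.memL2L2_thermalStress hP hlam hθb),
    ae_memLp_of_memL2L2 (h.memL2L2_divergence hP), ae_memLp_of_memL2L2 hP.F_mem,
    ae_ae_of_ae_cyl' h.stress, h.momentum] with t hS hV hW hp hv hb hd hF hτ hm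
  have hSt : ∀ i j, MemLp (fun x => ((τ t x - P.f (trunc (1 / lam) (θ t x + θb t x)) • (1 : Mat))
        + P.D (symGrad (Du' t x))) i j) 2 P.vol := by
    intro i j
    have h1 : MemLp (fun x => P.D (symGrad (Du t x) - εp t x) i j
        - P.thermalStress θb lam θ t x * (1 : Mat) i j + P.D (symGrad (Du' t x)) i j) 2 P.vol :=
      ((hS i j).sub (hb.mul_const _)).add (hV i j)
    refine (memLp_congr_ae ?_).1 h1
    filter_upwards [hτ] with x hx
    rw [hx]
    rfl
  have hm' := integral_frob_symGrad_of_memH10 hSt hF hm hv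
  rw [← vol] at hm'
  have hE : ∀ i j, MemLp (fun x => (symGrad (Du' t x) - εp' t x) i j) 2 P.vol := fun i j =>
    (hW i j).sub (hp i j)
  have i1 := integrable_frob hS hE
  have i2 := integrable_frob hS hp
  have i3 := integrable_frob hV hW
  have i4 : Integrable (fun x => P.thermalStress θb lam θ t x * divergence (Du' t x)) P.vol :=
    hb.integrable_mul hd
  rw [← sub_eq_iff_eq_add', ← hm', ← integral_add i1 i2]
  have i12 : Integrable (fun x => frob (P.D (symGrad (Du t x) - εp t x)) (symGrad (Du' t x) - εp' t x)
    + frob (P.D (symGrad (Du t x) - εp t x)) (εp' t x)) P.vol := i1.add i2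
  rw [← integral_add i12 i3]
  have i123 : Integrable (fun x => frob (P.D (symGrad (Du t x) - εp t x))
      (symGrad (Du' t x) - εp' t x) + frob (P.D (symGrad (Du t x) - εp t x)) (εp' t x)
      + frob (P.D (symGrad (Du' t x))) (symGrad (Du' t x))) P.vol := i12.add i3
  rw [← integral_sub i123 i4]
  refine integral_congr_ae ?_
  filter_upwards [hτ] with x hx
  rw [hx, frob_add_left, frob_sub_left, frob_smul_left, frob_one_symGrad, thermalStress,
    ← frob_add_right, sub_add_cancel]
  ring

/-- The elastic energy. -/
theorem SolvesApprox.energy (hP : P.Admissible)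
    (h : P.SolvesApprox θb lam u τ εp θ u' Du Du' εp' θ' Gθ) {G₀ : Fin 3 → E3 → E3}
    (hG₀ : ∀ i, MemH1 P.Ω (fun x => P.u₀ x i) (G₀ i)) :
    ∀ᵐ s ∂(volume.restrict (Ioo 0 P.T)),
      -(1 / 2 * ∫ x, frob (P.D (symGrad (fun k => G₀ k x) - P.εp₀ x))
        (symGrad (fun k => G₀ k x) - P.εp₀ x) ∂P.vol)
      ≤ ∫ t in (0 : ℝ)..s, ∫ x, frob (P.D (symGrad (Du t x) - εp t x))
          (symGrad (Du' t x) - εp' t x) ∂P.vol := by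
  have := hP.isFiniteMeasure_vol
  have h1 := (hasL1TimeDeriv_frob P.D (e₀ := fun x => symGrad (fun k => G₀ k x) - P.εp₀ x)
    (e := fun t x => symGrad (Du t x) - εp t x) (e' := fun t x => symGrad (Du' t x) - εp' t x)
    (h.elasticTimeDeriv hP hG₀)).integral_eq
  -- The two halves of the derivative of the quadratic form agree, because the elasticity tensor is
  -- symmetric on symmetric matrices.
  have h2 : ∀ᵐ t ∂(volume.restrict (Ioo 0 P.T)),
      ∫ x, (frob (P.D (symGrad (Du' t x) - εp' t x)) (symGrad (Du t x) - εp t x)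
        + frob (P.D (symGrad (Du t x) - εp t x)) (symGrad (Du' t x) - εp' t x)) ∂P.vol
      = 2 * ∫ x, frob (P.D (symGrad (Du t x) - εp t x)) (symGrad (Du' t x) - εp' t x) ∂P.vol := by
    filter_upwards [ae_ae_of_ae_cyl' h.elastic_isSymm,
      ae_ae_of_ae_cyl' (h.elasticRate_isSymm hP)] with t ht ht'
    rw [← integral_const_mul]
    refine integral_congr_ae ?_
    filter_upwards [ht, ht'] with x hx hx'
    rw [hP.D_symmetric _ _ hx' hx, frob_comm (symGrad (Du' t x) - εp' t x)]
    ring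
  filter_upwards [h1, ae_ae_of_ae_cyl' h.elastic_isSymm, ae_restrict_mem measurableSet_Ioo]
    with s ⟨_, hs⟩ hsym hsm
  have h3 : ∫ t in (0 : ℝ)..s, ∫ x, (frob (P.D (symGrad (Du' t x) - εp' t x))
        (symGrad (Du t x) - εp t x)
        + frob (P.D (symGrad (Du t x) - εp t x)) (symGrad (Du' t x) - εp' t x)) ∂P.vol
      = 2 * ∫ t in (0 : ℝ)..s,
        ∫ x, frob (P.D (symGrad (Du t x) - εp t x)) (symGrad (Du' t x) - εp' t x) ∂P.vol := by
    rw [← intervalIntegral.integral_const_mul, intervalIntegral.integral_of_le hsm.1.le,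
      intervalIntegral.integral_of_le hsm.1.le, ← restrict_Ioo_eq_restrict_Ioc]
    exact integral_congr_ae
      (ae_restrict_of_ae_restrict_of_subset (Ioo_subset_Ioo_right hsm.2.le) h2)
  -- The final elastic energy is discarded; only the initial one enters the bound.
  have h4 : 0 ≤ ∫ x, frob (P.D (symGrad (Du s x) - εp s x)) (symGrad (Du s x) - εp s x) ∂P.vol := by
    refine integral_nonneg_of_ae ?_
    filter_upwards [hsym] with x hx
    by_cases h0 : symGrad (Du s x) - εp s x = 0
    · simp [h0, frob]
    · exact (hP.D_posDef _ hx h0).le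
  rw [h3] at hs
  linarith

/-- The mechanical energy estimate, with the power of the thermal stress on the right. -/
theorem Admissible.exists_mechanical_estimate (hP : P.Admissible) :
    ∃ c C : ℝ, 0 < c ∧ ∀ θb, MemL2L2 P.T P.vol θb → ∀ lam, 0 < lam →
      ∀ u τ εp θ u' Du Du' εp' θ' Gθ, P.SolvesApprox θb lam u τ εp θ u' Du Du' εp' θ' Gθ →
      ∀ᵐ s ∂(volume.restrict (Ioo 0 P.T)),
        c * (∫ t in (0 : ℝ)..s, ∫ x, strainRateSq Du' t x ∂P.vol)
          + ∫ t in (0 : ℝ)..s, ∫ x, dissipation lam τ εp' t x ∂P.vol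
        ≤ C + ∫ t in (0 : ℝ)..s,
            ∫ x, P.thermalStress θb lam θ t x * divergence (Du' t x) ∂P.vol := by
  have := hP.isFiniteMeasure_vol
  obtain ⟨c, hc, hcD⟩ := exists_coercive P.D hP.D_posDef
  choose G₀ hG₀ using hP.u₀_mem
  obtain ⟨R, hR0, hR⟩ : ∃ R : ℝ, 0 < R ∧ P.Ω ⊆ Metric.closedBall 0 R := by
    obtain ⟨R, hR⟩ := hP.isBounded.subset_closedBall 0
    exact ⟨max R 1, by positivity,
      hR.trans (Metric.closedBall_subset_closedBall (le_max_left _ _))⟩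
  set E0 := 1 / 2 * ∫ x, frob (P.D (symGrad (fun k => G₀ k x) - P.εp₀ x))
        (symGrad (fun k => G₀ k x) - P.εp₀ x) ∂P.vol with hE0
  -- κ = 1/(2η) with η = c/(4R²). In Young's inequality for the force the velocity carries the
  -- weight η/2, and with the Poincaré constant 4R² this costs exactly half of the viscous term.
  set κ := 2 * R ^ 2 / c with hκ
  have hFi : Integrable (fun p : ℝ × E3 => ‖P.F p.1 p.2‖ ^ 2) (cyl P.T P.vol) :=
    MemLp.integrable_norm_pow hP.F_mem (by norm_num)
  set CF := ∫ t in Ioo 0 P.T, ∫ x, ‖P.F t x‖ ^ 2 ∂P.vol with hCF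
  refine ⟨c / 2, E0 + κ * CF, by positivity, ?_⟩
  intro θb hθb lam hlam u τ εp θ u' Du Du' εp' θ' Gθ h
  have iw := h.integrable_strainRateSq hP
  have im := h.integrable_dissipation hP hlam
  have hEL : ∀ i j, MemL2L2 P.T P.vol (fun t x => (symGrad (Du' t x) - εp' t x) i j) := fun i j =>
    (h.elasticTimeDeriv hP hG₀ i j).2.1
  have i1 : Integrable (fun p : ℝ × E3 => frob (P.D (symGrad (Du p.1 p.2) - εp p.1 p.2))
    (symGrad (Du' p.1 p.2) - εp' p.1 p.2)) (cyl P.T P.vol) :=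
    integrable_frob (h.memL2L2_stress hP) hEL
  have i2 : Integrable (fun p : ℝ × E3 => frob (P.D (symGrad (Du p.1 p.2) - εp p.1 p.2))
    (εp' p.1 p.2)) (cyl P.T P.vol) :=
    integrable_frob (h.memL2L2_stress hP) fun i j => (h.εp_mem i j).2.1
  have i4 : Integrable (fun p : ℝ × E3 => frob (P.D (symGrad (Du' p.1 p.2)))
    (symGrad (Du' p.1 p.2))) (cyl P.T P.vol) :=
    integrable_frob (h.memL2L2_viscousStress hP) (h.memL2L2_strainRate hP)
  have i3 : Integrable (fun p : ℝ × E3 => P.thermalStress θb lam θ p.1 p.2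
    * divergence (Du' p.1 p.2)) (cyl P.T P.vol) :=
    MemLp.integrable_mul (h.memL2L2_thermalStress hP hlam hθb) (h.memL2L2_divergence hP)
  have hpt : ∀ᵐ t ∂(volume.restrict (Ioo 0 P.T)),
      c / 2 * (∫ x, strainRateSq Du' t x ∂P.vol) + (∫ x, dissipation lam τ εp' t x ∂P.vol)
        + ∫ x, frob (P.D (symGrad (Du t x) - εp t x)) (symGrad (Du' t x) - εp' t x) ∂P.vol
      ≤ (∫ x, P.thermalStress θb lam θ t x * divergence (Du' t x) ∂P.vol)
        + κ * ∫ x, ‖P.F t x‖ ^ 2 ∂P.vol := by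
    have hv : ∀ᵐ t ∂(volume.restrict (Ioo 0 P.T)), ∀ i,
        MemH10 P.Ω (fun x => u' t x i) (fun x => Du' t x i) :=
      ae_all_iff.2 fun i => (h.u_mem i).2.2.2
    filter_upwards [h.integral_power_balance hP hlam hθb, hv, ae_memLp_of_memL2L2 hP.F_mem,
      integrable_slices iw, integrable_slices im,
      integrable_slices (F := fun t x => frob (P.D (symGrad (Du t x) - εp t x)) (εp' t x)) i2,
      integrable_slices (F := fun t x => frob (P.D (symGrad (Du' t x))) (symGrad (Du' t x))) i4,
      ae_ae_of_ae_cyl' (h.dissipation_le hlam)] with t hbal hv hF jw jm j2 j4 hdis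
    have e1 : ∫ x, dissipation lam τ εp' t x ∂P.vol
        ≤ ∫ x, frob (P.D (symGrad (Du t x) - εp t x)) (εp' t x) ∂P.vol :=
      integral_mono_ae jm j2 (by filter_upwards [hdis] with x hx using hx.2)
    have e2 : c * (∫ x, strainRateSq Du' t x ∂P.vol)
        ≤ ∫ x, frob (P.D (symGrad (Du' t x))) (symGrad (Du' t x)) ∂P.vol := by
      rw [← integral_const_mul]
      exact integral_mono (jw.const_mul c) j4 fun x => hcD _ (symGrad_isSymm _)
    have hvi : ∀ i, Integrable (fun x => u' t x i ^ 2) P.vol := fun i =>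
      MemLp.integrable_sq (hv i).1
    have hgi : ∀ i, Integrable (fun x => Du' t x i i ^ 2) P.vol := fun i =>
      MemLp.integrable_sq (memLp_apply (hv i).2.1 i)
    have jF : Integrable (fun x => ‖P.F t x‖ ^ 2) P.vol := hF.integrable_norm_pow (by norm_num)
    set η := c / (4 * R ^ 2) with hη
    have hη0 : 0 < η := by positivity
    have hu : MemLp (u' t) 2 P.vol := memLp_toLp (f := fun x i => u' t x i) fun i => (hv i).1
    have e3 : ∫ x, inner ℝ (P.F t x) (u' t x) ∂P.vol
        ≤ κ * (∫ x, ‖P.F t x‖ ^ 2 ∂P.vol) + η / 2 * ∑ i, ∫ x, u' t x i ^ 2 ∂P.vol := by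
      have j5 : Integrable (fun x => ∑ i, u' t x i ^ 2) P.vol :=
        integrable_finsetSum _ fun i _ => hvi i
      rw [← integral_finsetSum _ fun i _ => hvi i, ← integral_const_mul, ← integral_const_mul,
        ← integral_add (jF.const_mul _) (j5.const_mul _)]
      refine integral_mono (MemLp.integrable_real_inner hF hu)
        ((jF.const_mul _).add (j5.const_mul _)) fun x => ?_
      have k1 : ‖u' t x‖ ^ 2 = ∑ i, u' t x i ^ 2 := EuclideanSpace.real_norm_sq_eq _
      have k2 := real_inner_le_norm (P.F t x) (u' t x)
      have k3 : κ * (2 * η) = 1 := by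
        rw [hκ, hη]; field_simp; ring
      have k4 : κ = 1 / (2 * η) := by rw [eq_div_iff (by positivity)]; exact k3
      show _ ≤ κ * ‖P.F t x‖ ^ 2 + η / 2 * ∑ i, u' t x i ^ 2
      rw [← k1, k4]
      have k5 : 0 ≤ 1 / (2 * η) * (‖P.F t x‖ - η * ‖u' t x‖) ^ 2 := by positivity
      have k6 : 1 / (2 * η) * (‖P.F t x‖ - η * ‖u' t x‖) ^ 2
        = 1 / (2 * η) * ‖P.F t x‖ ^ 2 + η / 2 * ‖u' t x‖ ^ 2 - ‖P.F t x‖ * ‖u' t x‖ := by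
        field_simp
        ring
      linarith
    -- Poincaré in direction i for component i produces only the diagonal derivatives, which are
    -- entries of the symmetric gradient. Korn's inequality is not needed.
    have e4 : ∑ i, ∫ x, u' t x i ^ 2 ∂P.vol ≤ 4 * R ^ 2 * ∫ x, strainRateSq Du' t x ∂P.vol := by
      calc ∑ i, ∫ x, u' t x i ^ 2 ∂P.vol
          ≤ ∑ i, 4 * R ^ 2 * ∫ x, Du' t x i i ^ 2 ∂P.vol :=
            Finset.sum_le_sum fun i _ => (hv i).integral_sq_le hR0.le hR i
        _ = 4 * R ^ 2 * ∫ x, ∑ i, Du' t x i i ^ 2 ∂P.vol := by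
            rw [integral_finsetSum _ fun i _ => hgi i, Finset.mul_sum]
        _ ≤ _ := by
            refine mul_le_mul_of_nonneg_left (integral_mono
              (integrable_finsetSum _ fun i _ => hgi i) jw fun x => ?_) (by positivity)
            have := diag_sq_le_frob (symGrad (Du' t x))
            simp only [symGrad_diag] at this
            exact this
    have e5 : η / 2 * ∑ i, ∫ x, u' t x i ^ 2 ∂P.vol
        ≤ c / 2 * ∫ x, strainRateSq Du' t x ∂P.vol := by
      refine (mul_le_mul_of_nonneg_left e4 (by positivity)).trans_eq ?_
      rw [hη]
      field_simp
    linarith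
  have l0 := integrableOn_integral iw
  have l1 := integrableOn_integral (F := fun t x => frob (P.D (symGrad (Du t x) - εp t x))
    (symGrad (Du' t x) - εp' t x)) i1
  have l2 := integrableOn_integral im
  have l3 := integrableOn_integral (F := fun t x => P.thermalStress θb lam θ t x
    * divergence (Du' t x)) i3
  have lF := integrableOn_integral (F := fun t x => ‖P.F t x‖ ^ 2) hFi
  filter_upwards [h.energy hP hG₀, ae_restrict_mem measurableSet_Ioo] with s hs hsm
  have ii : ∀ {g : ℝ → ℝ}, IntegrableOn g (Ioo 0 P.T) → IntervalIntegrable g volume 0 s :=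
    fun hg => intervalIntegrable_of_integrableOn_Ioo hg hsm.1.le hsm.2.le
  have l012 := ((l0.const_mul (c / 2)).add l2).add l1
  have l3F := l3.add (lF.const_mul κ)
  have key := intervalIntegral_mono_ae_Ioo hsm l012 l3F hpt
  have r1 := intervalIntegral.integral_add ((ii (l0.const_mul (c / 2))).add (ii l2)) (ii l1)
  have r2 := intervalIntegral.integral_add (ii (l0.const_mul (c / 2))) (ii l2)
  have r3 := intervalIntegral.integral_add (ii l3) (ii (lF.const_mul κ))
  have r4 := intervalIntegral_le_of_nonneg hsm lF
    (Eventually.of_forall fun t => integral_nonneg fun x => by positivity)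
  have hκ0 : 0 ≤ κ := by positivity
  have r5 := mul_le_mul_of_nonneg_left r4 hκ0
  simp only [Pi.add_apply, intervalIntegral.integral_const_mul] at key r1 r2 r3 r5
  linarith

end Model

/-! ### A smooth substitute for the absolute value -/

/-- The bracket `√(1 + s²)`. -/
noncomputable def bracket (s : ℝ) : ℝ := √(1 + s ^ 2)

theorem bracket_sq (s : ℝ) : bracket s ^ 2 = 1 + s ^ 2 := Real.sq_sqrt (by positivity)

theorem one_le_bracket (s : ℝ) : 1 ≤ bracket s := by
  rw [bracket, Real.one_le_sqrt]
  nlinarith [sq_nonneg s]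

theorem bracket_pos (s : ℝ) : 0 < bracket s := one_pos.trans_le (one_le_bracket s)

theorem abs_le_bracket (s : ℝ) : |s| ≤ bracket s :=
  Real.abs_le_sqrt (by linarith)

theorem contDiff_bracket {n : ℕ∞} : ContDiff ℝ n bracket :=
  ContDiff.sqrt (by fun_prop) fun s => by positivity

theorem continuous_bracket : Continuous bracket := by
  unfold bracket; fun_prop

theorem hasDerivAt_bracket (s : ℝ) : HasDerivAt bracket (s / bracket s) s := by
  have h : HasDerivAt (fun s : ℝ => 1 + s ^ 2) (2 * s) s := by
    simpa using (hasDerivAt_pow 2 s).const_add 1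
  have h2 := h.sqrt (by positivity)
  rw [mul_div_mul_left _ _ two_ne_zero] at h2
  exact h2

theorem contDiff_div_bracket {n : ℕ∞} : ContDiff ℝ n fun s => s / bracket s :=
  contDiff_id.div contDiff_bracket fun s => (bracket_pos s).ne'

theorem abs_div_bracket_le (s : ℝ) : |s / bracket s| ≤ 1 := by
  rw [abs_div, abs_of_pos (bracket_pos s), div_le_one (bracket_pos s)]
  exact abs_le_bracket s

theorem deriv_div_bracket (s : ℝ) : deriv (fun s => s / bracket s) s = 1 / bracket s ^ 3 := by
  have h := (hasDerivAt_id s).div (hasDerivAt_bracket s) (bracket_pos s).ne'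
  have h2 := h.deriv
  have h3 : (id / bracket : ℝ → ℝ) = fun s => s / bracket s := rfl
  rw [h3] at h2
  rw [h2]
  have := bracket_pos s
  have h4 := bracket_sq s
  simp only [id]
  field_simp
  linarith

/-- With J the bracket, J² - s² = 1 makes the left side 1 / (J (J + s)), which is at most 1 / J².
This decay makes the coupling harmless at high temperature. -/
theorem one_sub_div_bracket_le {s : ℝ} (hs : 0 ≤ s) : 1 - s / bracket s ≤ 1 / (1 + s ^ 2) := by
  have h := bracket_pos s
  have h1 := bracket_sq s
  rw [← h1, one_sub_div h.ne', div_le_div_iff₀ h (by positivity)]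
  nlinarith [mul_nonneg h.le hs]

theorem abs_sub_le_of_abs_deriv_le {ψ : ℝ → ℝ} (hψ : ContDiff ℝ 1 ψ) {B : ℝ}
    (hB : ∀ s, |deriv ψ s| ≤ B) (r s : ℝ) : |ψ s - ψ r| ≤ B * |s - r| :=
  Convex.norm_image_sub_le_of_norm_deriv_le (fun x _ => hψ.differentiable one_ne_zero x)
    (fun x _ => hB x) convex_univ (mem_univ r) (mem_univ s)

theorem integrable_comp_of_abs_deriv_le {α : Type*} [MeasurableSpace α] {μ : Measure α}
    [IsFiniteMeasure μ] {ψ : ℝ → ℝ} (hψ : ContDiff ℝ 1 ψ) {B : ℝ}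
    (hB : ∀ s, |deriv ψ s| ≤ B) {v : α → ℝ} (hv : Integrable v μ) :
    Integrable (fun x => ψ (v x)) μ := by
  refine ((hv.norm.const_mul B).add (integrable_const |ψ 0|)).mono'
    (hψ.continuous.comp_aestronglyMeasurable hv.1) (Eventually.of_forall fun x => ?_)
  have h := abs_sub_le_of_abs_deriv_le hψ hB 0 (v x)
  rw [sub_zero] at h
  have h2 := abs_sub_abs_le_abs_sub (ψ (v x)) (ψ 0)
  simp only [Real.norm_eq_abs, Pi.add_apply]
  linarith

theorem integrable_mul_comp {α : Type*} [MeasurableSpace α] {μ : Measure α} {g v : α → ℝ}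
    (hg : Integrable g μ) (hv : AEStronglyMeasurable v μ) {ψ : ℝ → ℝ} (hψ : Continuous ψ) {B : ℝ}
    (hB : ∀ s, |ψ s| ≤ B) : Integrable (fun x => g x * ψ (v x)) μ :=
  hg.mul_bdd (c := B) (hψ.comp_aestronglyMeasurable hv) (Eventually.of_forall fun _ => hB _)

/-! ### The heat equation tested with functions of the temperature -/

namespace Model

variable {P : Model} {θb : ℝ → E3 → ℝ} {lam : ℝ} {u : ℝ → E3 → E3} {τ εp : ℝ → E3 → Mat}
  {θ : ℝ → E3 → ℝ} {u' : ℝ → E3 → E3} {Du Du' : ℝ → E3 → Fin 3 → E3} {εp' : ℝ → E3 → Mat}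
  {θ' : ℝ → E3 → ℝ} {Gθ : ℝ → E3 → E3}

/-- The source term of the heat equation. -/
noncomputable def heatSource (P : Model) (θb : ℝ → E3 → ℝ) (lam : ℝ) (τ : ℝ → E3 → Mat)
    (θ : ℝ → E3 → ℝ) (Du' : ℝ → E3 → Fin 3 → E3) (εp' : ℝ → E3 → Mat) (t : ℝ) (x : E3) : ℝ :=
  -P.thermalStress θb lam θ t x * divergence (Du' t x) + dissipation lam τ εp' t x

theorem SolvesApprox.integrable_thermalPower (hP : P.Admissible) (hlam : 0 < lam)
    (hθb : MemL2L2 P.T P.vol θb) (h : P.SolvesApprox θb lam u τ εp θ u' Du Du' εp' θ' Gθ) :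
    Integrable (fun p : ℝ × E3 => P.thermalStress θb lam θ p.1 p.2 * divergence (Du' p.1 p.2))
      (cyl P.T P.vol) :=
  MemLp.integrable_mul (h.memL2L2_thermalStress hP hlam hθb) (h.memL2L2_divergence hP)

theorem SolvesApprox.integrable_heatSource (hP : P.Admissible) (hlam : 0 < lam)
    (hθb : MemL2L2 P.T P.vol θb) (h : P.SolvesApprox θb lam u τ εp θ u' Du Du' εp' θ' Gθ) :
    Integrable (fun p : ℝ × E3 => P.heatSource θb lam τ θ Du' εp' p.1 p.2) (cyl P.T P.vol) := by
  have h1 := (h.integrable_thermalPower hP hlam hθb).neg.add (h.integrable_dissipation hP hlam)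
  refine h1.congr (Eventually.of_forall fun p => ?_)
  simp only [Pi.add_apply, Pi.neg_apply, heatSource, neg_mul]

/-- The heat equation tested with a bounded function of the temperature. -/
theorem SolvesApprox.integral_comp_temperature (hP : P.Admissible) (hlam : 0 < lam)
    (hθb : MemL2L2 P.T P.vol θb) (h : P.SolvesApprox θb lam u τ εp θ u' Du Du' εp' θ' Gθ)
    {Ψ ψ : ℝ → ℝ} (hΨ : ContDiff ℝ 1 Ψ) (hψ : ContDiff ℝ 1 ψ) (hd : ∀ s, deriv Ψ s = ψ s) {B : ℝ}
    (hB : ∀ s, |ψ s| ≤ B) (hB' : ∀ s, |deriv ψ s| ≤ B) :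
    ∀ᵐ s ∂(volume.restrict (Ioo 0 P.T)),
      ∫ x, Ψ (θ s x) ∂P.vol + ∫ t in (0 : ℝ)..s, ∫ x, deriv ψ (θ t x) * ‖Gθ t x‖ ^ 2 ∂P.vol
        = ∫ x, Ψ (P.θ₀ x) ∂P.vol
          + ∫ t in (0 : ℝ)..s, ∫ x, P.heatSource θb lam τ θ Du' εp' t x * ψ (θ t x) ∂P.vol := by
  have := hP.isFiniteMeasure_vol
  have : IsFiniteMeasure (volume.restrict P.Ω) := hP.isFiniteMeasure_vol
  have hθm := h.memL2L2_temperature.1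
  have i1 : Integrable (fun p : ℝ × E3 => deriv Ψ (θ p.1 p.2) * θ' p.1 p.2) (cyl P.T P.vol) := by
    simp only [hd]
    exact (integrable_mul_comp (MemL2L2.integrable h.θ_time.2.1) hθm hψ.continuous hB).congr
      (Eventually.of_forall fun p => mul_comm _ _)
  have hG : Integrable (fun p : ℝ × E3 => ‖Gθ p.1 p.2‖ ^ 2) (cyl P.T P.vol) :=
    MemLp.integrable_norm_pow h.θ_space.2.1 (by norm_num)
  have i2 : Integrable (fun p : ℝ × E3 => deriv ψ (θ p.1 p.2) * ‖Gθ p.1 p.2‖ ^ 2)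
      (cyl P.T P.vol) :=
    (integrable_mul_comp hG hθm (hψ.continuous_deriv le_rfl) hB').congr
      (Eventually.of_forall fun p => mul_comm _ _)
  have i3 : Integrable (fun p : ℝ × E3 => P.heatSource θb lam τ θ Du' εp' p.1 p.2 * ψ (θ p.1 p.2))
      (cyl P.T P.vol) :=
    integrable_mul_comp (h.integrable_heatSource hP hlam hθb) hθm hψ.continuous hB
  have hpt : ∀ᵐ t ∂(volume.restrict (Ioo 0 P.T)),
      ∫ x, deriv Ψ (θ t x) * θ' t x ∂P.vol + ∫ x, deriv ψ (θ t x) * ‖Gθ t x‖ ^ 2 ∂P.vol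
        = ∫ x, P.heatSource θb lam τ θ Du' εp' t x * ψ (θ t x) ∂P.vol := by
    filter_upwards [h.heat, h.θ_space.2.2] with t ht ht'
    -- The test function is ψ(θ), whose weak gradient is ψ'(θ)∇θ by the chain rule.
    have := ht _ _ (MemH1.comp hP.isOpen ht' hψ hB hB')
    simp only [real_inner_smul_right, real_inner_self_eq_norm_sq] at this
    simp only [hd, mul_comm (ψ _) (θ' t _)]
    exact this
  have l1 := integrableOn_integral (F := fun t x => deriv Ψ (θ t x) * θ' t x) i1
  have l2 := integrableOn_integral (F := fun t x => deriv ψ (θ t x) * ‖Gθ t x‖ ^ 2) i2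
  have h₀ : Integrable (fun x => Ψ (P.θ₀ x)) P.vol :=
    integrable_comp_of_abs_deriv_le hΨ (fun s => (hd s).symm ▸ hB s)
      (h.θ_time.1.integrable (by norm_num))
  filter_upwards [h.θ_time.integral_comp hΨ h₀ i1, ae_restrict_mem measurableSet_Ioo]
    with s ⟨_, hs⟩ hsm
  rw [hs, add_assoc, ← intervalIntegral.integral_add
    (intervalIntegrable_of_integrableOn_Ioo l1 hsm.1.le hsm.2.le)
    (intervalIntegrable_of_integrableOn_Ioo l2 hsm.1.le hsm.2.le)]
  congr 1
  rw [intervalIntegral.integral_of_le hsm.1.le, intervalIntegral.integral_of_le hsm.1.le,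
    ← restrict_Ioo_eq_restrict_Ioc]
  exact integral_congr_ae (ae_restrict_of_ae_restrict_of_subset (Ioo_subset_Ioo_right hsm.2.le) hpt)

end Model

/-! ### The bounds for the temperature in `L^∞(0,T;L¹)` and for the strain rate -/

/-- The primitive is continuous up to `T`, so exceeding `C` there would mean exceeding it on a whole
interval before `T`, which is not a null set. It is needed because the energy inequalities hold only
for almost every time. -/
theorem setIntegral_Ioo_le_of_ae_le {T C : ℝ} {g : ℝ → ℝ} (hT : 0 < T)
    (hg : IntegrableOn g (Ioo 0 T))
    (h : ∀ᵐ s ∂(volume.restrict (Ioo 0 T)), ∫ t in (0 : ℝ)..s, g t ≤ C) :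
    ∫ t in Ioo 0 T, g t ≤ C := by
  have hcont : ContinuousOn (fun s => ∫ t in (0 : ℝ)..s, g t) (Icc 0 T) := by
    have := intervalIntegral.continuousOn_primitive_interval (μ := volume) (f := g) (a := 0) (b := T)
    rw [uIcc_of_le hT.le] at this
    exact this ((integrableOn_Icc_iff_integrableOn_Ioo).2 hg)
  have ht : Tendsto (fun s => ∫ t in (0 : ℝ)..s, g t) (𝓝[Ioo 0 T] T)
      (𝓝 (∫ t in (0 : ℝ)..T, g t)) :=
    ((hcont T (right_mem_Icc.2 hT.le)).mono Ioo_subset_Icc_self)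
  rw [← integral_Ioc_eq_integral_Ioo, ← intervalIntegral.integral_of_le hT.le]
  by_contra! hlt
  have h1 := ht.eventually (lt_mem_nhds hlt)
  rw [nhdsWithin_Ioo_eq_nhdsLT hT] at h1
  obtain ⟨l, hl, hl'⟩ := (mem_nhdsLT_iff_exists_Ioo_subset' hT).1 h1
  have h3 : volume (Ioo (max l 0) T) = 0 := by
    have h4 : ∀ᵐ s ∂(volume.restrict (Ioo (max l 0) T)), False := by
      filter_upwards [ae_restrict_of_ae_restrict_of_subset
        (Ioo_subset_Ioo_left (le_max_right l 0)) h, ae_restrict_mem measurableSet_Ioo] with s hs hsm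
      exact absurd hs (not_le.2 (hl' ⟨(le_max_left _ _).trans_lt hsm.1, hsm.2⟩))
    rw [eventually_false_iff_eq_bot, ae_eq_bot, Measure.restrict_eq_zero] at h4
    exact h4
  rw [Real.volume_Ioo, ENNReal.ofReal_eq_zero] at h3
  have : max l 0 < T := max_lt hl hT
  linarith

theorem rpow_le_one_add {x p : ℝ} (hx : 0 ≤ x) (hp0 : 0 ≤ p) (hp : p ≤ 1) : x ^ p ≤ 1 + x := by
  rcases le_total x 1 with h | h
  · exact (Real.rpow_le_one hx h hp0).trans (by linarith)
  · exact (Real.rpow_le_rpow_of_exponent_le h hp).trans (by rw [Real.rpow_one]; linarith)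

namespace Model

variable {P : Model}

/-- There are three regimes. If `r` and `r + b` are negative, the growth of order 1/2 makes f²
linear and the factor is at most 4. If `r < 0 ≤ r + b`, the truncated argument lies between 0 and
`b`, so f² is controlled by 1 + b². If `r ≥ 0`, the decay of the factor beats the at most linear
growth of f, leaving a bound in `b` alone. -/
theorem Admissible.exists_thermalStress_mul_le (hP : P.Admissible) :
    ∃ K : ℝ, 0 ≤ K ∧ ∀ lam : ℝ, 0 < lam → ∀ r b : ℝ,
      P.f (trunc (1 / lam) (r + b)) ^ 2 * (1 - r / bracket r) ^ 2 ≤ K * (bracket r + b ^ 2) := by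
  obtain ⟨a, M, α, ha, hM, hα1, hα2, hf⟩ := hP.f_growth
  obtain ⟨C₀, hC₀, hfn⟩ := hP.f_growth_neg
  refine ⟨12 * C₀ ^ 2 + 10 * (a + M) ^ 2, by positivity, fun lam hlam r b => ?_⟩
  have hK : 0 < 1 / lam := by positivity
  set s := trunc (1 / lam) (r + b) with hs
  have hs1 : |s| ≤ |r| + |b| := (abs_trunc_le_abs hK _).trans (abs_add_le _ _)
  have hJ := one_le_bracket r
  have hrJ := abs_le_bracket r
  have hb : |b| ≤ (1 + b ^ 2) / 2 := by nlinarith [sq_nonneg (|b| - 1), sq_abs b]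
  obtain ⟨hχ1, hχ2⟩ := abs_le.1 (abs_div_bracket_le r)
  have hcrude : |P.f s| ≤ (a + M) * (1 + |s|) := by
    have h1 := rpow_le_one_add (abs_nonneg s) (by linarith : 0 ≤ α) (by linarith)
    have h2 := mul_le_mul_of_nonneg_left h1 hM
    nlinarith [hf s, abs_nonneg s, mul_nonneg ha (abs_nonneg s)]
  have hC₀2 : 0 ≤ C₀ ^ 2 := by positivity
  have haM2 : 0 ≤ (a + M) ^ 2 := by positivity
  have hb2 : 0 ≤ b ^ 2 := by positivity
  have hX : 0 ≤ bracket r + b ^ 2 := by positivity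
  rcases lt_or_ge r 0 with hr | hr
  · have h4 : (1 - r / bracket r) ^ 2 ≤ 4 := by nlinarith
    rcases lt_or_ge (r + b) 0 with hrb | hrb
    · have h1 := hfn s (trunc_of_neg hK hrb).1
      have h2 : P.f s ^ 2 ≤ C₀ ^ 2 * (1 + |s|) := by
        rw [← sq_abs (P.f s)]
        refine (pow_le_pow_left₀ (abs_nonneg _) h1 2).trans_eq ?_
        rw [mul_pow, ← Real.sqrt_eq_rpow, Real.sq_sqrt (by positivity)]
      calc P.f s ^ 2 * (1 - r / bracket r) ^ 2 ≤ (C₀ ^ 2 * (1 + |s|)) * 4 := by gcongr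
        _ ≤ (C₀ ^ 2 * (3 * (bracket r + b ^ 2))) * 4 := by
            gcongr
            linarith
        _ ≤ _ := by nlinarith [mul_nonneg haM2 hX]
    · have hsb : |s| ≤ |b| := by
        rw [abs_of_nonneg (trunc_of_nonneg hK hrb).1]
        exact (trunc_of_nonneg hK hrb).2.trans (by linarith [le_abs_self b])
      have h2 : P.f s ^ 2 ≤ (a + M) ^ 2 * (2 * (bracket r + b ^ 2)) := by
        rw [← sq_abs (P.f s)]
        refine (pow_le_pow_left₀ (abs_nonneg _) hcrude 2).trans ?_
        rw [mul_pow]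
        gcongr
        have : (1 + |s|) ^ 2 ≤ (1 + |b|) ^ 2 := by gcongr
        nlinarith [sq_abs b]
      calc P.f s ^ 2 * (1 - r / bracket r) ^ 2
          ≤ ((a + M) ^ 2 * (2 * (bracket r + b ^ 2))) * 4 := by gcongr
        _ ≤ _ := by nlinarith [mul_nonneg haM2 hX, mul_nonneg hC₀2 hX]
  · have h1 : |P.f s| * (1 - r / bracket r) ≤ (a + M) * (2 + |b|) := by
      have h2 := one_sub_div_bracket_le hr
      rw [abs_of_nonneg hr] at hs1
      calc |P.f s| * (1 - r / bracket r) ≤ ((a + M) * (1 + |s|)) * (1 / (1 + r ^ 2)) := by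
            gcongr
        _ = (a + M) * ((1 + |s|) / (1 + r ^ 2)) := by ring
        _ ≤ (a + M) * (2 + |b|) := by
            gcongr
            rw [div_le_iff₀ (by positivity)]
            nlinarith [abs_nonneg b, sq_nonneg r, mul_nonneg (abs_nonneg b) (sq_nonneg r),
              sq_nonneg (r - 1)]
    rw [← mul_pow, ← sq_abs (P.f s * _), abs_mul, abs_of_nonneg (by linarith : 0 ≤ 1 - r / bracket r)]
    calc (|P.f s| * (1 - r / bracket r)) ^ 2 ≤ ((a + M) * (2 + |b|)) ^ 2 :=
          pow_le_pow_left₀ (mul_nonneg (abs_nonneg _) (by linarith)) h1 2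
      _ = (a + M) ^ 2 * (2 + |b|) ^ 2 := by ring
      _ ≤ (a + M) ^ 2 * (10 * (bracket r + b ^ 2)) := by
          gcongr
          nlinarith [sq_abs b]
      _ ≤ _ := by nlinarith [mul_nonneg hC₀2 hX]

/-- The energy estimate: the temperature is bounded in `L^∞(0,T;L¹)` and the strain rate in
`L²(0,T;L²)`. -/
theorem Admissible.exists_energy_estimate (hP : P.Admissible) {θb : ℝ → E3 → ℝ}
    (hθb : MemL2L2 P.T P.vol θb) :
    ∃ C : ℝ, 0 ≤ C ∧ ∀ lam, 0 < lam →
      ∀ u τ εp θ u' Du Du' εp' θ' Gθ, P.SolvesApprox θb lam u τ εp θ u' Du Du' εp' θ' Gθ →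
      (∀ᵐ t ∂(volume.restrict (Ioo 0 P.T)), ∫ x, bracket (θ t x) ∂P.vol ≤ C) ∧
      ∫ t in Ioo 0 P.T, ∫ x, strainRateSq Du' t x ∂P.vol ≤ C := by
  have := hP.isFiniteMeasure_vol
  obtain ⟨c, C, hc, hmech⟩ := hP.exists_mechanical_estimate
  obtain ⟨K, hK0, hK⟩ := hP.exists_thermalStress_mul_le
  -- Young gives (c/6) (div u')² to the strain rate, which is at most c/2 of its square, half of
  -- what the mechanical estimate offers. The dual weight 3/(2c) times `K` is this constant.
  set κ := 3 * K / (2 * c) with hκ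
  have hκ0 : 0 ≤ κ := by positivity
  have hbi : Integrable (fun p : ℝ × E3 => θb p.1 p.2 ^ 2) (cyl P.T P.vol) :=
    MemLp.integrable_sq hθb
  set Cb := ∫ t in Ioo 0 P.T, ∫ x, θb t x ^ 2 ∂P.vol with hCb
  have hCb0 : 0 ≤ Cb := integral_nonneg fun t => integral_nonneg fun x => sq_nonneg _
  set J₀ := ∫ x, bracket (P.θ₀ x) ∂P.vol with hJ₀
  have hJ₀0 : 0 ≤ J₀ := integral_nonneg fun x => (bracket_pos _).le
  set C₁ := |C| + J₀ + κ * Cb with hC₁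
  have hC₁0 : 0 ≤ C₁ := by positivity
  set C₂ := C₁ * Real.exp (κ * P.T) with hC₂
  have hC₂0 : 0 ≤ C₂ := by positivity
  set C₃ := (C₁ + κ * (P.T * C₂)) / (c / 2) with hC₃
  have hT := hP.T_pos
  have hC₃0 : 0 ≤ C₃ := by positivity
  refine ⟨C₂ + C₃, by positivity, ?_⟩
  intro lam hlam u τ εp θ u' Du Du' εp' θ' Gθ h
  have iw := h.integrable_strainRateSq hP
  have im := h.integrable_dissipation hP hlam
  have ib := h.integrable_thermalPower hP hlam hθb
  have hθm := h.memL2L2_temperature.1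
  have ij : Integrable (fun p : ℝ × E3 => bracket (θ p.1 p.2)) (cyl P.T P.vol) := by
    refine integrable_comp_of_abs_deriv_le (contDiff_bracket (n := 1)) (B := 1) (fun s => ?_)
      (MemL2L2.integrable h.memL2L2_temperature)
    rw [(hasDerivAt_bracket s).deriv]
    exact abs_div_bracket_le s
  have is : Integrable (fun p : ℝ × E3 => P.heatSource θb lam τ θ Du' εp' p.1 p.2
      * (θ p.1 p.2 / bracket (θ p.1 p.2))) (cyl P.T P.vol) :=
    integrable_mul_comp (ψ := fun s => s / bracket s) (h.integrable_heatSource hP hlam hθb) hθm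
      (contDiff_div_bracket (n := 0)).continuous abs_div_bracket_le
  have hpt : ∀ᵐ t ∂(volume.restrict (Ioo 0 P.T)),
      ∫ x, P.thermalStress θb lam θ t x * divergence (Du' t x) ∂P.vol
        + ∫ x, P.heatSource θb lam τ θ Du' εp' t x * (θ t x / bracket (θ t x)) ∂P.vol
      ≤ ∫ x, dissipation lam τ εp' t x ∂P.vol + c / 2 * ∫ x, strainRateSq Du' t x ∂P.vol
        + κ * (∫ x, bracket (θ t x) ∂P.vol) + κ * ∫ x, θb t x ^ 2 ∂P.vol := by
    filter_upwards [integrable_slices iw, integrable_slices im,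
      integrable_slices (F := fun t x => P.thermalStress θb lam θ t x * divergence (Du' t x)) ib,
      integrable_slices (F := fun t x => bracket (θ t x)) ij,
      integrable_slices (F := fun t x => P.heatSource θb lam τ θ Du' εp' t x
        * (θ t x / bracket (θ t x))) is,
      integrable_slices (F := fun t x => θb t x ^ 2) hbi,
      ae_ae_of_ae_cyl' (h.dissipation_le hlam)] with t jw jm jb jj js jθ hdis
    have k1 := jm.add (jw.const_mul (c / 2))
    have k2 := k1.add (jj.const_mul κ)
    have k3 := k2.add (jθ.const_mul κ)
    have e1 := integral_add k2 (jθ.const_mul κ)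
    have e2 := integral_add k1 (jj.const_mul κ)
    have e3 := integral_add jm (jw.const_mul (c / 2))
    have e4 := integral_add jb js
    simp only [Pi.add_apply, integral_const_mul] at e1 e2 e3 e4
    rw [← e4, ← e3, ← e2, ← e1]
    refine integral_mono_ae (jb.add js) k3 ?_
    filter_upwards [hdis] with x hx
    obtain ⟨hχ1, hχ2⟩ := abs_le.1 (abs_div_bracket_le (θ t x))
    have q1 := hK lam hlam (θ t x) (θb t x)
    have q2 := divergence_sq_le (Du' t x)
    simp only [heatSource]
    rw [show P.f (trunc (1 / lam) (θ t x + θb t x)) = P.thermalStress θb lam θ t x from rfl] at q1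
    rw [show frob (symGrad (Du' t x)) (symGrad (Du' t x)) = strainRateSq Du' t x from rfl] at q2
    set χ := θ t x / bracket (θ t x)
    set b := P.thermalStress θb lam θ t x
    set d := divergence (Du' t x)
    have q3 : dissipation lam τ εp' t x * χ ≤ dissipation lam τ εp' t x := by
      nlinarith [hx.1]
    have q4 : b * (1 - χ) * d ≤ 3 / (2 * c) * (b ^ 2 * (1 - χ) ^ 2) + c / 6 * d ^ 2 := by
      have : 3 / (2 * c) * (b ^ 2 * (1 - χ) ^ 2) + c / 6 * d ^ 2 - b * (1 - χ) * d
        = 3 / (2 * c) * (b * (1 - χ) - c / 3 * d) ^ 2 := by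
        field_simp
        ring
      have : 0 ≤ 3 / (2 * c) * (b * (1 - χ) - c / 3 * d) ^ 2 := by positivity
      linarith
    have q5 := mul_le_mul_of_nonneg_left q1 (by positivity : 0 ≤ 3 / (2 * c))
    have q6 := mul_le_mul_of_nonneg_left q2 (by positivity : 0 ≤ c / 6)
    have q7 : 3 / (2 * c) * (K * (bracket (θ t x) + θb t x ^ 2))
      = κ * bracket (θ t x) + κ * θb t x ^ 2 := by
      rw [hκ]; ring
    linarith
  have l0 := integrableOn_integral iw
  have l1 := integrableOn_integral im
  have l2 := integrableOn_integral (F := fun t x => P.thermalStress θb lam θ t x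
    * divergence (Du' t x)) ib
  have l3 := integrableOn_integral (F := fun t x => bracket (θ t x)) ij
  have l4 := integrableOn_integral (F := fun t x => P.heatSource θb lam τ θ Du' εp' t x
        * (θ t x / bracket (θ t x))) is
  have l5 := integrableOn_integral (F := fun t x => θb t x ^ 2) hbi
  -- The mechanical estimate is added to the heat equation tested with the derivative of `bracket`.
  -- The gradient term has a sign and is dropped, and the dissipation cancels through `hpt`.
  have main : ∀ᵐ s ∂(volume.restrict (Ioo 0 P.T)),
      ∫ x, bracket (θ s x) ∂P.vol + c / 2 * ∫ t in (0 : ℝ)..s, ∫ x, strainRateSq Du' t x ∂P.vol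
        ≤ C₁ + κ * ∫ t in (0 : ℝ)..s, ∫ x, bracket (θ t x) ∂P.vol := by
    have htest := h.integral_comp_temperature hP hlam hθb (contDiff_bracket (n := 1))
      (contDiff_div_bracket (n := 1)) (fun s => (hasDerivAt_bracket s).deriv) (B := 1)
      abs_div_bracket_le (fun s => by
        rw [deriv_div_bracket, abs_of_pos (by have := bracket_pos s; positivity)]
        exact div_le_one_of_le₀ (one_le_pow₀ (one_le_bracket s)) (by have := bracket_pos s; positivity))
    filter_upwards [htest, hmech θb hθb lam hlam u τ εp θ u' Du Du' εp' θ' Gθ h,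
      ae_restrict_mem measurableSet_Ioo] with s hs hm hsm
    have ii : ∀ {g : ℝ → ℝ}, IntegrableOn g (Ioo 0 P.T) → IntervalIntegrable g volume 0 s :=
      fun hg => intervalIntegrable_of_integrableOn_Ioo hg hsm.1.le hsm.2.le
    have k1 := l1.add (l0.const_mul (c / 2))
    have k2 := k1.add (l3.const_mul κ)
    have k3 := k2.add (l5.const_mul κ)
    have key := intervalIntegral_mono_ae_Ioo hsm (l2.add l4) k3 hpt
    have e1 := intervalIntegral.integral_add (ii k2) (ii (l5.const_mul κ))
    have e2 := intervalIntegral.integral_add (ii k1) (ii (l3.const_mul κ))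
    have e3 := intervalIntegral.integral_add (ii l1) (ii (l0.const_mul (c / 2)))
    have e4 := intervalIntegral.integral_add (ii l2) (ii l4)
    have e5 := mul_le_mul_of_nonneg_left (intervalIntegral_le_of_nonneg hsm l5
      (Eventually.of_forall fun t => integral_nonneg fun x => sq_nonneg _)) hκ0
    have e6 : 0 ≤ ∫ t in (0 : ℝ)..s, ∫ x, deriv (fun s => s / bracket s) (θ t x) * ‖Gθ t x‖ ^ 2
        ∂P.vol := by
      refine intervalIntegral.integral_nonneg hsm.1.le fun t _ => integral_nonneg fun x => ?_
      have := bracket_pos (θ t x)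
      simp only [deriv_div_bracket, Pi.zero_apply]
      positivity
    have e7 := le_abs_self C
    simp only [Pi.add_apply, intervalIntegral.integral_const_mul] at key e1 e2 e3 e4
    rw [hC₁]
    linarith
  have hY : ∀ᵐ t ∂(volume.restrict (Ioo 0 P.T)), ∫ x, bracket (θ t x) ∂P.vol ≤ C₂ := by
    refine ae_le_of_le_integral hC₁0 hκ0 l3 ?_
    filter_upwards [main, ae_restrict_mem measurableSet_Ioo] with s hs hsm
    have : 0 ≤ ∫ t in (0 : ℝ)..s, ∫ x, strainRateSq Du' t x ∂P.vol :=
      intervalIntegral.integral_nonneg hsm.1.le fun t _ => integral_nonneg fun x =>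
        frob_self_nonneg _
    nlinarith
  refine ⟨hY.mono fun t ht => ht.trans (by linarith), ?_⟩
  refine (setIntegral_Ioo_le_of_ae_le hT l0 (C := C₃) ?_).trans (by linarith)
  filter_upwards [main, ae_restrict_mem measurableSet_Ioo] with s hs hsm
  have e1 : ∫ t in (0 : ℝ)..s, ∫ x, bracket (θ t x) ∂P.vol ≤ P.T * C₂ := by
    have := intervalIntegral_mono_ae_Ioo hsm l3 
      (integrableOn_const (C := C₂) measure_Ioo_lt_top.ne) hY
    rw [intervalIntegral.integral_const, smul_eq_mul, sub_zero] at this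
    exact this.trans (mul_le_mul_of_nonneg_right hsm.2.le hC₂0)
  have e2 : 0 ≤ ∫ x, bracket (θ s x) ∂P.vol := integral_nonneg fun x => (bracket_pos _).le
  have e3 := mul_le_mul_of_nonneg_left e1 hκ0
  rw [hC₃, le_div_iff₀ (by positivity)]
  linarith

end Model

/-! ### Powers of the bracket and the renormalizing function -/

theorem hasDerivAt_bracket_rpow (p s : ℝ) :
    HasDerivAt (fun s => bracket s ^ p) (s / bracket s * p * bracket s ^ (p - 1)) s :=
  (hasDerivAt_bracket s).rpow_const (Or.inl (bracket_pos s).ne')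

theorem contDiff_bracket_rpow {n : ℕ∞} (p : ℝ) : ContDiff ℝ n fun s => bracket s ^ p :=
  contDiff_bracket.rpow_const_of_ne fun s => (bracket_pos s).ne'

theorem abs_deriv_bracket_rpow_le {p : ℝ} (hp : 0 ≤ p) (s : ℝ) :
    |deriv (fun s => bracket s ^ p) s| ≤ p * bracket s ^ (p - 1) := by
  have h0 := Real.rpow_nonneg (bracket_pos s).le (p - 1)
  rw [(hasDerivAt_bracket_rpow p s).deriv, mul_assoc, abs_mul, abs_of_nonneg (mul_nonneg hp h0)]
  exact mul_le_of_le_one_left (mul_nonneg hp h0) (abs_div_bracket_le s)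

theorem integrable_bracket_rpow_neg {ν : ℝ} (hν : 0 < ν) :
    Integrable fun s => bracket s ^ (-(1 + ν)) := by
  have h := integrable_rpow_neg_one_add_norm_sq (E := ℝ) (μ := volume) (r := 1 + ν)
    (by simp [hν])
  refine h.congr (Eventually.of_forall fun s => ?_)
  simp only [bracket, Real.sqrt_eq_rpow, Real.norm_eq_abs, sq_abs]
  rw [← Real.rpow_mul (by positivity)]
  congr 1
  ring

/-- A nonnegative `C²` function with bounded first derivative and second derivative
`(1 + s²)^{-(1 + ν) / 2}`. -/
theorem exists_renormalization {ν : ℝ} (hν : 0 < ν) :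
    ∃ (Ψ ψ : ℝ → ℝ) (B : ℝ), ContDiff ℝ 1 Ψ ∧ ContDiff ℝ 1 ψ ∧ (∀ s, deriv Ψ s = ψ s) ∧
      (∀ s, deriv ψ s = bracket s ^ (-(1 + ν))) ∧ (∀ s, |ψ s| ≤ B) ∧ (∀ s, |deriv ψ s| ≤ B) ∧
      ∀ s, 0 ≤ Ψ s := by
  set φ : ℝ → ℝ := fun s => bracket s ^ (-(1 + ν)) with hφ
  have hφc : Continuous φ := (contDiff_bracket_rpow (n := 0) _).continuous
  have hφi : Integrable φ := integrable_bracket_rpow_neg hν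
  have hφ0 : ∀ s, 0 ≤ φ s := fun s => Real.rpow_nonneg (bracket_pos s).le _
  have hφ1 : ∀ s, φ s ≤ 1 := fun s =>
    Real.rpow_le_one_of_one_le_of_nonpos (one_le_bracket s) (by linarith)
  set ψ : ℝ → ℝ := fun s => ∫ t in (0 : ℝ)..s, φ t with hψ
  have hψd : ∀ s, HasDerivAt ψ (φ s) s := fun s => (hφc.integral_hasStrictDerivAt 0 s).hasDerivAt
  have hψc : Continuous ψ := continuous_iff_continuousAt.2 fun s => (hψd s).continuousAt
  set Ψ : ℝ → ℝ := fun s => ∫ t in (0 : ℝ)..s, ψ t with hΨ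
  have hΨd : ∀ s, HasDerivAt Ψ (ψ s) s := fun s => (hψc.integral_hasStrictDerivAt 0 s).hasDerivAt
  have hi0 : 0 ≤ ∫ s, φ s := integral_nonneg hφ0
  -- The integral bounds ψ, the summand 1 bounds its derivative.
  refine ⟨Ψ, ψ, (∫ s, φ s) + 1, ?_, ?_, fun s => (hΨd s).deriv, fun s => (hψd s).deriv, ?_, ?_, ?_⟩
  · refine contDiff_one_iff_deriv.2 ⟨fun s => (hΨd s).differentiableAt, ?_⟩
    rw [show deriv Ψ = ψ from funext fun s => (hΨd s).deriv]
    exact hψc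
  · refine contDiff_one_iff_deriv.2 ⟨fun s => (hψd s).differentiableAt, ?_⟩
    rw [show deriv ψ = φ from funext fun s => (hψd s).deriv]
    exact hφc
  · intro s
    have h1 := intervalIntegral.norm_integral_le_integral_norm_uIoc (f := φ) (μ := volume)
      (a := 0) (b := s)
    simp only [Real.norm_eq_abs, abs_of_nonneg (hφ0 _)] at h1
    have h2 := setIntegral_le_integral (s := uIoc 0 s) hφi (Eventually.of_forall hφ0)
    exact (h1.trans h2).trans (by linarith)
  · intro s
    rw [(hψd s).deriv, abs_of_nonneg (hφ0 s)]
    linarith [hφ1 s]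
  · intro s
    rcases le_total 0 s with hs | hs
    · exact intervalIntegral.integral_nonneg hs fun t ht =>
        intervalIntegral.integral_nonneg ht.1 fun r _ => hφ0 r
    · rw [hΨ]
      simp only
      rw [intervalIntegral.integral_symm, ← intervalIntegral.integral_neg]
      refine intervalIntegral.integral_nonneg hs fun t ht => ?_
      rw [hψ]
      simp only
      rw [intervalIntegral.integral_symm, neg_neg]
      exact intervalIntegral.integral_nonneg ht.2 fun r _ => hφ0 r

/-! ### Interpolation in space between `L¹` and the weighted gradient -/

theorem ennreal_le_sq_of_le_rpow_half_mul {X K : ℝ≥0∞} (hX : X ≠ ⊤) (h : X ≤ X ^ (1 / 2 : ℝ) * K) :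
    X ≤ K ^ 2 := by
  rcases eq_or_ne X 0 with h0 | h0
  · simp [h0]
  have h1 : X ^ (1 / 2 : ℝ) ≠ 0 := by simp [h0]
  have h2 : X ^ (1 / 2 : ℝ) ≠ ⊤ := by simp [hX]
  have h3 : X = X ^ (1 / 2 : ℝ) * X ^ (1 / 2 : ℝ) := by
    rw [← ENNReal.rpow_add _ _ h0 hX]
    norm_num
  have h4 : X ^ (1 / 2 : ℝ) ≤ K := by
    exact (ENNReal.mul_le_mul_iff_right h1 h2).1 (h3.symm.le.trans h)
  calc X = X ^ (1 / 2 : ℝ) * X ^ (1 / 2 : ℝ) := h3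
    _ ≤ K * K := mul_le_mul' h4 h4
    _ = K ^ 2 := (sq K).symm

theorem enorm_bracket_rpow (s p : ℝ) :
    ‖bracket s ^ p‖ₑ = ENNReal.ofReal (bracket s) ^ p := by
  rw [ENNReal.ofReal_rpow_of_pos (bracket_pos s), Real.enorm_eq_ofReal
    (Real.rpow_nonneg (bracket_pos s).le _)]

theorem memLp_bracket {α : Type*} [MeasurableSpace α] {μ : Measure α} [IsFiniteMeasure μ]
    {v : α → ℝ} (hv : MemLp v 2 μ) : MemLp (fun x => bracket (v x)) 2 μ := by
  refine ((memLp_const (1 : ℝ)).add hv.norm).mono'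
    (continuous_bracket.comp_aestronglyMeasurable hv.1) (Eventually.of_forall fun x => ?_)
  rw [Real.norm_of_nonneg (bracket_pos _).le]
  simp only [Pi.add_apply, Real.norm_eq_abs]
  refine abs_le_of_sq_le_sq' ?_ (by positivity) |>.2
  rw [bracket_sq]
  nlinarith [abs_nonneg (v x), sq_abs (v x)]

theorem integrable_bracket_rpow {α : Type*} [MeasurableSpace α] {μ : Measure α}
    [IsFiniteMeasure μ] {v : α → ℝ} (hv : MemLp v 2 μ) {p : ℝ} (hp : p ≤ 2) :
    Integrable (fun x => bracket (v x) ^ p) μ := by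
  refine (memLp_bracket hv).integrable_sq.mono' ((contDiff_bracket_rpow (n := 0)
    p).continuous.comp_aestronglyMeasurable hv.1) (Eventually.of_forall fun x => ?_)
  rw [Real.norm_of_nonneg (Real.rpow_nonneg (bracket_pos _).le _), ← Real.rpow_two]
  exact Real.rpow_le_rpow_of_exponent_le (one_le_bracket _) hp

/-- Let X be the left side, I the weighted gradient integral and J the bracket of v. By
Cauchy-Schwarz the W^{1,1} norm of z = J^β is at most X^{1/2} times a constant times 1 + I^{1/2}.
Sobolev in L^{3/2}, followed by Hölder against the L¹ bound, gives X ≤ C X^{1/2} (1 + I^{1/2}).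
Cancelling X^{1/2} leaves a bound linear in I, so it can be integrated in time without loss. -/
theorem lintegral_bracket_rpow_le {Ω : Set E3} (hΩ : IsOpen Ω) (hbd : Bornology.IsBounded Ω)
    (hb : HasC2Boundary Ω) {ν : ℝ} (hν : 0 < ν) (hν3 : ν ≤ 1 / 3) (N : ℝ≥0) :
    ∃ C : ℝ≥0, ∀ v G, MemH1 Ω v G → ∫⁻ x in Ω, ENNReal.ofReal (bracket (v x)) ≤ N →
      ∫⁻ x in Ω, ENNReal.ofReal (bracket (v x)) ^ (5 / 3 - ν)
        ≤ C * (1 + ∫⁻ x in Ω, ENNReal.ofReal (bracket (v x)) ^ (-(1 + ν)) * ‖G x‖ₑ ^ 2) := by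
  have hfin : IsFiniteMeasure (volume.restrict Ω) :=
    ⟨by rw [Measure.restrict_apply_univ]; exact hbd.measure_lt_top⟩
  obtain ⟨S, hS⟩ := sobolev hΩ hbd hb
  -- Two identities fix β: β + 1/3 = 5/3 - ν for Hölder with exponents 2/3 and 1/3, and β - 1 = (5/3
  -- - ν)/2 - (1 + ν)/2 for Cauchy-Schwarz on the gradient. The condition ν ≤ 1/3 means β ≥ 1.
  set β : ℝ := 4 / 3 - ν with hβ
  have hβ1 : 1 ≤ β := by linarith
  set L : ℝ≥0∞ := ((S : ℝ≥0∞) ^ (2 / 3 : ℝ) * (N : ℝ≥0∞) ^ (1 / 3 : ℝ)) ^ 2 * 2 with hL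
  have hLtop : L ≠ ⊤ := by
    refine ENNReal.mul_ne_top (ENNReal.pow_ne_top (ENNReal.mul_ne_top ?_ ?_)) (by norm_num)
    · exact ENNReal.rpow_ne_top_of_nonneg (by norm_num) ENNReal.coe_ne_top
    · exact ENNReal.rpow_ne_top_of_nonneg (by norm_num) ENNReal.coe_ne_top
  set M : ℝ≥0∞ := L * (N + ENNReal.ofReal β ^ 2) with hM
  have hMtop : M ≠ ⊤ := by
    refine ENNReal.mul_ne_top hLtop (ENNReal.add_ne_top.2 ⟨ENNReal.coe_ne_top, ?_⟩)
    exact ENNReal.pow_ne_top ENNReal.ofReal_ne_top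
  refine ⟨M.toNNReal, fun v G hv hN => ?_⟩
  rw [ENNReal.coe_toNNReal hMtop]
  set μ := volume.restrict Ω with hμ
  set j : E3 → ℝ≥0∞ := fun x => ENNReal.ofReal (bracket (v x)) with hj
  have hj1 : ∀ x, 1 ≤ j x := fun x => by
    rw [hj]
    simpa using one_le_bracket (v x)
  have hj0 : ∀ x, j x ≠ 0 := fun x => (one_pos.trans_le (hj1 x)).ne'
  have hjt : ∀ x, j x ≠ ⊤ := fun x => ENNReal.ofReal_ne_top
  have hjm : AEMeasurable j μ :=
    (continuous_bracket.measurable.comp_aemeasurable hv.1.1.aemeasurable).ennreal_ofReal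
  set g : E3 → ℝ≥0∞ := fun x => j x ^ (-(1 + ν)) * ‖G x‖ₑ ^ 2 with hg
  have hgm : AEMeasurable g μ := (hjm.pow_const _).mul (hv.2.1.1.enorm.pow_const _)
  set X := ∫⁻ x, j x ^ (5 / 3 - ν) ∂μ with hX
  set I := ∫⁻ x, g x ∂μ with hI
  have hbv : MemLp (fun x => bracket (v x)) 2 μ := memLp_bracket hv.1
  have hrpi : ∀ p ≤ (2 : ℝ), Integrable (fun x => bracket (v x) ^ p) μ :=
    fun p => integrable_bracket_rpow hv.1
  -- Finiteness comes from `v` in L², as 5/3 - ν ≤ 2. It is used only to cancel a power of X.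
  have hXtop : X ≠ ⊤ := by
    have := (hrpi (5 / 3 - ν) (by linarith)).2.ne
    simp only [enorm_bracket_rpow] at this
    exact this
  have hz : HasL1Grad Ω (fun x => bracket (v x) ^ β)
      (fun x => deriv (fun s => bracket s ^ β) (v x) • G x) := by
    refine HasL1Grad.comp hΩ hv.hasL1Grad (contDiff_bracket_rpow (n := 1) β)
      (hrpi β (by linarith)) ?_
    refine (hbv.integrable_mul (hv.2.1.norm.const_mul β)).mono' ?_ (Eventually.of_forall fun x => ?_)
    · exact (((contDiff_bracket_rpow (n := 1) β).continuous_deriv le_rfl).comp_aestronglyMeasurable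
        hv.1.1).smul hv.2.1.1
    · rw [norm_smul, Real.norm_eq_abs]
      have h1 := abs_deriv_bracket_rpow_le (by linarith : 0 ≤ β) (v x)
      have h2 : bracket (v x) ^ (β - 1) ≤ bracket (v x) := by
        conv_rhs => rw [← Real.rpow_one (bracket (v x))]
        exact Real.rpow_le_rpow_of_exponent_le (one_le_bracket _) (by linarith)
      calc |deriv (fun s => bracket s ^ β) (v x)| * ‖G x‖
          ≤ (β * bracket (v x) ^ (β - 1)) * ‖G x‖ := by gcongr
        _ ≤ (β * bracket (v x)) * ‖G x‖ := by gcongr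
        _ = _ := by simp only [Pi.mul_apply]; ring
  have hsob := hS _ _ hz
  simp only [enorm_bracket_rpow] at hsob
  have hz1 : ∫⁻ x, j x ^ β ∂μ ≤ X ^ (1 / 2 : ℝ) * (N : ℝ≥0∞) ^ (1 / 2 : ℝ) := by
    calc ∫⁻ x, j x ^ β ∂μ ≤ ∫⁻ x, (j x ^ (5 / 3 - ν)) ^ (1 / 2 : ℝ) * j x ^ (1 / 2 : ℝ) ∂μ := by
          refine lintegral_mono fun x => ?_
          rw [← ENNReal.rpow_mul, ← ENNReal.rpow_add _ _ (hj0 x) (hjt x)]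
          exact ENNReal.rpow_le_rpow_of_exponent_le (hj1 x) (by linarith)
      _ ≤ X ^ (1 / 2 : ℝ) * (∫⁻ x, j x ∂μ) ^ (1 / 2 : ℝ) :=
          ENNReal.lintegral_mul_norm_pow_le (hjm.pow_const _) hjm (by norm_num) (by norm_num)
            (by norm_num)
      _ ≤ _ := by gcongr
  have hz2 : ∫⁻ x, ‖deriv (fun s => bracket s ^ β) (v x) • G x‖ₑ ∂μ
      ≤ ENNReal.ofReal β * (X ^ (1 / 2 : ℝ) * I ^ (1 / 2 : ℝ)) := by
    calc ∫⁻ x, ‖deriv (fun s => bracket s ^ β) (v x) • G x‖ₑ ∂μ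
        ≤ ∫⁻ x, ENNReal.ofReal β * ((j x ^ (5 / 3 - ν)) ^ (1 / 2 : ℝ) * g x ^ (1 / 2 : ℝ)) ∂μ := by
          refine lintegral_mono fun x => ?_
          have h1 : ‖deriv (fun s => bracket s ^ β) (v x)‖ₑ ≤ ENNReal.ofReal β * j x ^ (β - 1) := by
            rw [Real.enorm_eq_ofReal_abs]
            refine (ENNReal.ofReal_le_ofReal
              (abs_deriv_bracket_rpow_le (by linarith : 0 ≤ β) (v x))).trans_eq ?_
            rw [ENNReal.ofReal_mul (by linarith), ENNReal.ofReal_rpow_of_pos (bracket_pos _)]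
          have h2 : (j x ^ (5 / 3 - ν)) ^ (1 / 2 : ℝ) * g x ^ (1 / 2 : ℝ)
              = j x ^ (β - 1) * ‖G x‖ₑ := by
            rw [hg]
            simp only
            rw [ENNReal.mul_rpow_of_nonneg _ _ (by norm_num), ← mul_assoc, ← ENNReal.rpow_mul,
              ← ENNReal.rpow_mul, ← ENNReal.rpow_add _ _ (hj0 x) (hjt x), ← ENNReal.rpow_natCast,
              ← ENNReal.rpow_mul]
            congr 1
            · congr 1
              rw [hβ]; ring
            · norm_num
          rw [enorm_smul, h2, ← mul_assoc]
          gcongr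
      _ = ENNReal.ofReal β * ∫⁻ x, (j x ^ (5 / 3 - ν)) ^ (1 / 2 : ℝ) * g x ^ (1 / 2 : ℝ) ∂μ :=
          lintegral_const_mul' _ _ ENNReal.ofReal_ne_top
      _ ≤ _ := by
          gcongr
          exact ENNReal.lintegral_mul_norm_pow_le (hjm.pow_const _) hgm (by norm_num) (by norm_num)
            (by norm_num)
  set R := (N : ℝ≥0∞) ^ (1 / 2 : ℝ) + ENNReal.ofReal β * I ^ (1 / 2 : ℝ) with hR
  have hzR : ∫⁻ x, (j x ^ β + ‖deriv (fun s => bracket s ^ β) (v x) • G x‖ₑ) ∂μ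
      ≤ X ^ (1 / 2 : ℝ) * R := by
    rw [lintegral_add_left' (hjm.pow_const _)]
    refine (add_le_add hz1 hz2).trans_eq ?_
    rw [hR]
    ring
  have hXle : X ≤ X ^ (1 / 2 : ℝ) * ((S : ℝ≥0∞) ^ (2 / 3 : ℝ) * (N : ℝ≥0∞) ^ (1 / 3 : ℝ) * R) := by
    calc X = ∫⁻ x, ((j x ^ β) ^ (3 / 2 : ℝ)) ^ (2 / 3 : ℝ) * j x ^ (1 / 3 : ℝ) ∂μ := by
          refine lintegral_congr fun x => ?_
          rw [← ENNReal.rpow_mul, ← ENNReal.rpow_mul, ← ENNReal.rpow_add _ _ (hj0 x) (hjt x)]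
          congr 1
          rw [hβ]; ring
      _ ≤ (∫⁻ x, (j x ^ β) ^ (3 / 2 : ℝ) ∂μ) ^ (2 / 3 : ℝ) * (∫⁻ x, j x ∂μ) ^ (1 / 3 : ℝ) :=
          ENNReal.lintegral_mul_norm_pow_le ((hjm.pow_const _).pow_const _) hjm (by norm_num)
            (by norm_num) (by norm_num)
      _ ≤ ((S : ℝ≥0∞) * (X ^ (1 / 2 : ℝ) * R) ^ (3 / 2 : ℝ)) ^ (2 / 3 : ℝ)
            * (N : ℝ≥0∞) ^ (1 / 3 : ℝ) := by
          gcongr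
          refine hsob.trans ?_
          gcongr
      _ = _ := by
          rw [ENNReal.mul_rpow_of_nonneg _ _ (by norm_num), ← ENNReal.rpow_mul]
          norm_num
          ring
  refine (ennreal_le_sq_of_le_rpow_half_mul hXtop hXle).trans ?_
  have hR2 : R ^ 2 ≤ 2 * (N + ENNReal.ofReal β ^ 2 * I) := by
    have h1 : ∀ a b : ℝ≥0∞, (a + b) ^ 2 ≤ 2 * (a ^ 2 + b ^ 2) := fun a b => by
      have := ENNReal.rpow_add_le_mul_rpow_add_rpow a b (p := 2) (by norm_num)
      norm_num at this
      exact this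
    refine (h1 _ _).trans_eq ?_
    rw [mul_pow, ← ENNReal.rpow_natCast, ← ENNReal.rpow_mul, ← ENNReal.rpow_natCast (I ^ _),
      ← ENNReal.rpow_mul]
    norm_num
  calc ((S : ℝ≥0∞) ^ (2 / 3 : ℝ) * (N : ℝ≥0∞) ^ (1 / 3 : ℝ) * R) ^ 2
      = ((S : ℝ≥0∞) ^ (2 / 3 : ℝ) * (N : ℝ≥0∞) ^ (1 / 3 : ℝ)) ^ 2 * R ^ 2 := by rw [mul_pow]
    _ ≤ ((S : ℝ≥0∞) ^ (2 / 3 : ℝ) * (N : ℝ≥0∞) ^ (1 / 3 : ℝ)) ^ 2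
          * (2 * (N + ENNReal.ofReal β ^ 2 * I)) := by gcongr
    _ = L * (N + ENNReal.ofReal β ^ 2 * I) := by rw [hL]; ring
    _ ≤ L * ((N + ENNReal.ofReal β ^ 2) * (1 + I)) := by
        gcongr
        rw [add_mul, mul_add, mul_add, mul_one, mul_one]
        exact add_le_add le_self_add le_add_self
    _ = M * (1 + I) := by rw [hM, hL]; ring

theorem integrable_bracket_rpow_neg_mul {α X : Type*} [MeasurableSpace α] {μ : Measure α}
    [NormedAddCommGroup X] {v : α → ℝ} {G : α → X} (hv : AEStronglyMeasurable v μ)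
    (hG : MemLp G 2 μ) {p : ℝ} (hp : p ≤ 0) :
    Integrable (fun x => bracket (v x) ^ p * ‖G x‖ ^ 2) μ := by
  have hGi : Integrable (fun x => ‖G x‖ ^ 2) μ := hG.integrable_norm_pow (by norm_num)
  refine (integrable_mul_comp hGi hv (contDiff_bracket_rpow (n := 0) p).continuous (B := 1)
    fun s => ?_).congr (Eventually.of_forall fun x => mul_comm _ _)
  rw [abs_of_nonneg (Real.rpow_nonneg (bracket_pos s).le _)]
  exact Real.rpow_le_one_of_one_le_of_nonpos (one_le_bracket s) hp

theorem integral_bracket_rpow_le {Ω : Set E3} (hΩ : IsOpen Ω) (hbd : Bornology.IsBounded Ω)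
    (hb : HasC2Boundary Ω) {ν : ℝ} (hν : 0 < ν) (hν3 : ν ≤ 1 / 3) (N : ℝ) :
    ∃ C : ℝ, 0 ≤ C ∧ ∀ v G, MemH1 Ω v G → ∫ x in Ω, bracket (v x) ≤ N →
      ∫ x in Ω, bracket (v x) ^ (5 / 3 - ν)
        ≤ C * (1 + ∫ x in Ω, bracket (v x) ^ (-(1 + ν)) * ‖G x‖ ^ 2) := by
  have hfin : IsFiniteMeasure (volume.restrict Ω) :=
    ⟨by rw [Measure.restrict_apply_univ]; exact hbd.measure_lt_top⟩
  obtain ⟨C, hC⟩ := lintegral_bracket_rpow_le hΩ hbd hb hν hν3 N.toNNReal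
  refine ⟨C, C.2, fun v G hv hN => ?_⟩
  have i1 : Integrable (fun x => bracket (v x)) (volume.restrict Ω) :=
    (memLp_bracket hv.1).integrable (by norm_num)
  have i2 := integrable_bracket_rpow hv.1 (by linarith : 5 / 3 - ν ≤ 2)
  have i3 := integrable_bracket_rpow_neg_mul hv.1.1 hv.2.1 (by linarith : -(1 + ν) ≤ 0)
  have n2 : ∀ x, 0 ≤ bracket (v x) ^ (5 / 3 - ν) := fun x => Real.rpow_nonneg (bracket_pos _).le _
  have n3 : ∀ x, 0 ≤ bracket (v x) ^ (-(1 + ν)) * ‖G x‖ ^ 2 := fun x =>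
    mul_nonneg (Real.rpow_nonneg (bracket_pos _).le _) (sq_nonneg _)
  have n3' : 0 ≤ ∫ x in Ω, bracket (v x) ^ (-(1 + ν)) * ‖G x‖ ^ 2 := integral_nonneg n3
  have h := hC v G hv (by
    rw [← ofReal_integral_eq_lintegral_ofReal i1 (Eventually.of_forall fun x => (bracket_pos _).le)]
    exact ENNReal.ofReal_le_ofReal hN)
  have e2 : ∫⁻ x in Ω, ENNReal.ofReal (bracket (v x)) ^ (5 / 3 - ν)
      = ENNReal.ofReal (∫ x in Ω, bracket (v x) ^ (5 / 3 - ν)) := by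
    rw [ofReal_integral_eq_lintegral_ofReal i2 (Eventually.of_forall n2)]
    exact lintegral_congr fun x => ENNReal.ofReal_rpow_of_pos (bracket_pos _)
  have e3 : ∫⁻ x in Ω, ENNReal.ofReal (bracket (v x)) ^ (-(1 + ν)) * ‖G x‖ₑ ^ 2
      = ENNReal.ofReal (∫ x in Ω, bracket (v x) ^ (-(1 + ν)) * ‖G x‖ ^ 2) := by
    rw [ofReal_integral_eq_lintegral_ofReal i3 (Eventually.of_forall n3)]
    refine lintegral_congr fun x => ?_
    rw [ENNReal.ofReal_mul (Real.rpow_nonneg (bracket_pos _).le _),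
      ENNReal.ofReal_rpow_of_pos (bracket_pos _), ENNReal.ofReal_pow (norm_nonneg _), ofReal_norm]
  rw [e2, e3, ← ENNReal.ofReal_one, ← ENNReal.ofReal_add zero_le_one n3',
    ← ENNReal.ofReal_coe_nnreal, ← ENNReal.ofReal_mul C.coe_nonneg, ENNReal.ofReal_le_ofReal_iff] at h
  · exact h
  · exact mul_nonneg C.2 (by linarith)

/-! ### The Boccardo-Gallouët estimate -/

namespace Model

variable {P : Model}

/-- The exponent is p = 2α, below 5/3 by the growth condition. This is where the bound 5/6 on α
matters: f² must be controlled by the power of the temperature that the gradient estimate provides.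
-/
theorem Admissible.exists_thermalStress_sq_le (hP : P.Admissible) :
    ∃ p K : ℝ, p < 5 / 3 ∧ 0 ≤ K ∧ ∀ lam : ℝ, 0 < lam → ∀ r b : ℝ,
      P.f (trunc (1 / lam) (r + b)) ^ 2 ≤ K * (bracket r ^ p + b ^ 2) := by
  obtain ⟨a, M, α, ha, hM, hα1, hα2, hf⟩ := hP.f_growth
  refine ⟨2 * α, 3 * a ^ 2 + 9 * M ^ 2, by linarith, by positivity, fun lam hlam r b => ?_⟩
  set s := trunc (1 / lam) (r + b) with hs
  have hs1 : |s| ≤ |r| + |b| := (abs_trunc_le_abs (by positivity) _).trans (abs_add_le _ _)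
  have h1 : |s| ^ α ≤ |r| ^ α + |b| ^ α :=
    (Real.rpow_le_rpow (abs_nonneg _) hs1 (by linarith)).trans
      (Real.rpow_add_le_add_rpow (abs_nonneg _) (abs_nonneg _) (by linarith) (by linarith))
  have h2 : |P.f s| ≤ a + M * |r| ^ α + M * |b| ^ α := by
    nlinarith [hf s, mul_le_mul_of_nonneg_left h1 hM]
  have h3 : (|r| ^ α) ^ 2 ≤ bracket r ^ (2 * α) := by
    rw [← Real.rpow_natCast, ← Real.rpow_mul (abs_nonneg _), mul_comm 2 α]
    exact Real.rpow_le_rpow (abs_nonneg _) (abs_le_bracket r) (by push_cast; linarith)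
  have h4 : (|b| ^ α) ^ 2 ≤ 2 + 2 * b ^ 2 := by
    have h5 := rpow_le_one_add (abs_nonneg b) (by linarith : 0 ≤ α) (by linarith)
    have h6 := pow_le_pow_left₀ (Real.rpow_nonneg (abs_nonneg b) α) h5 2
    nlinarith [sq_abs b, sq_nonneg (|b| - 1)]
  have h5 : 1 ≤ bracket r ^ (2 * α) := Real.one_le_rpow (one_le_bracket r) (by linarith)
  set x := |r| ^ α
  set y := |b| ^ α
  have h6 : P.f s ^ 2 ≤ (a + M * x + M * y) ^ 2 := by
    rw [← sq_abs (P.f s)]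
    exact pow_le_pow_left₀ (abs_nonneg _) h2 2
  have h7 : (a + M * x + M * y) ^ 2 ≤ 3 * (a ^ 2 + M ^ 2 * x ^ 2 + M ^ 2 * y ^ 2) := by
    nlinarith [sq_nonneg (a - M * x), sq_nonneg (a - M * y), sq_nonneg (M * x - M * y)]
  have h8 := mul_le_mul_of_nonneg_left h3 (sq_nonneg M)
  have h9 := mul_le_mul_of_nonneg_left h4 (sq_nonneg M)
  have h10 := mul_le_mul_of_nonneg_left h5 (sq_nonneg M)
  have h11 := mul_le_mul_of_nonneg_left h5 (sq_nonneg a)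
  have h12 := mul_nonneg (sq_nonneg a) (sq_nonneg b)
  have h13 := mul_nonneg (sq_nonneg M) (sq_nonneg b)
  linarith

/-- The test function ψ(θ) is bounded, so an L¹ bound for the heat source is enough. The thermal
power is kept on the right, and the dissipation is bounded by it through the mechanical estimate. -/
theorem Admissible.exists_gradient_estimate (hP : P.Admissible) {θb : ℝ → E3 → ℝ}
    (hθb : MemL2L2 P.T P.vol θb) {ν : ℝ} (hν : 0 < ν) :
    ∃ C : ℝ, 0 ≤ C ∧ ∀ lam, 0 < lam →
      ∀ u τ εp θ u' Du Du' εp' θ' Gθ, P.SolvesApprox θb lam u τ εp θ u' Du Du' εp' θ' Gθ →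
      ∫ t in Ioo 0 P.T, ∫ x, bracket (θ t x) ^ (-(1 + ν)) * ‖Gθ t x‖ ^ 2 ∂P.vol
        ≤ C * (1 + ∫ t in Ioo 0 P.T,
          ∫ x, |P.thermalStress θb lam θ t x * divergence (Du' t x)| ∂P.vol) := by
  have := hP.isFiniteMeasure_vol
  obtain ⟨c, C, hc, hmech⟩ := hP.exists_mechanical_estimate
  obtain ⟨Ψ, ψ, B, hΨ, hψ, hd, hd', hB, hB', hΨ0⟩ := exists_renormalization hν
  have hB0 : 0 ≤ B := (abs_nonneg _).trans (hB 0)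
  set A := ∫ x, Ψ (P.θ₀ x) ∂P.vol with hA
  have hA0 : 0 ≤ A := integral_nonneg fun x => hΨ0 _
  refine ⟨A + B * (2 + |C|), by positivity, ?_⟩
  intro lam hlam u τ εp θ u' Du Du' εp' θ' Gθ h
  have iw := h.integrable_strainRateSq hP
  have im := h.integrable_dissipation hP hlam
  have ib := h.integrable_thermalPower hP hlam hθb
  have hθm := h.memL2L2_temperature.1
  have is : Integrable (fun p : ℝ × E3 => P.heatSource θb lam τ θ Du' εp' p.1 p.2
      * ψ (θ p.1 p.2)) (cyl P.T P.vol) :=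
    integrable_mul_comp (h.integrable_heatSource hP hlam hθb) hθm hψ.continuous hB
  have l0 := integrableOn_integral iw
  have l1 := integrableOn_integral im
  have l2 := integrableOn_integral (F := fun t x => P.thermalStress θb lam θ t x
    * divergence (Du' t x)) ib
  have l3 := integrableOn_integral (F := fun t x => |P.thermalStress θb lam θ t x
    * divergence (Du' t x)|) ib.abs
  have l4 := integrableOn_integral (F := fun t x => P.heatSource θb lam τ θ Du' εp' t x
    * ψ (θ t x)) is
  have l5 := integrableOn_integral (F := fun t x => bracket (θ t x) ^ (-(1 + ν)) * ‖Gθ t x‖ ^ 2)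
    (integrable_bracket_rpow_neg_mul hθm h.θ_space.2.1 (by linarith))
  set Q := ∫ t in Ioo 0 P.T,
    ∫ x, |P.thermalStress θb lam θ t x * divergence (Du' t x)| ∂P.vol with hQ
  have n3 : ∀ t, 0 ≤ ∫ x, |P.thermalStress θb lam θ t x * divergence (Du' t x)| ∂P.vol :=
    fun t => integral_nonneg fun x => abs_nonneg _
  have hQ0 : 0 ≤ Q := integral_nonneg n3
  have hQs : ∀ s ∈ Ioo 0 P.T, ∫ t in (0 : ℝ)..s,
      ∫ x, |P.thermalStress θb lam θ t x * divergence (Du' t x)| ∂P.vol ≤ Q := fun s hs =>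
    intervalIntegral_le_of_nonneg hs l3 (Eventually.of_forall n3)
  have hm : ∀ᵐ s ∂(volume.restrict (Ioo 0 P.T)),
      ∫ t in (0 : ℝ)..s, ∫ x, dissipation lam τ εp' t x ∂P.vol ≤ |C| + Q := by
    filter_upwards [hmech θb hθb lam hlam u τ εp θ u' Du Du' εp' θ' Gθ h,
      ae_restrict_mem measurableSet_Ioo] with s hs hsm
    have e1 : 0 ≤ ∫ t in (0 : ℝ)..s, ∫ x, strainRateSq Du' t x ∂P.vol :=
      intervalIntegral.integral_nonneg hsm.1.le fun t _ => integral_nonneg fun x =>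
        frob_self_nonneg _
    have e2 := intervalIntegral_mono_ae_Ioo hsm l2 l3 (Eventually.of_forall fun t =>
      (le_abs_self _).trans abs_integral_le_integral_abs)
    have e3 := le_abs_self C
    have e4 := hQs s hsm
    have e5 := mul_nonneg hc.le e1
    linarith
  have hpt : ∀ᵐ t ∂(volume.restrict (Ioo 0 P.T)),
      ∫ x, P.heatSource θb lam τ θ Du' εp' t x * ψ (θ t x) ∂P.vol
        ≤ B * (∫ x, |P.thermalStress θb lam θ t x * divergence (Du' t x)| ∂P.vol)
          + B * ∫ x, dissipation lam τ εp' t x ∂P.vol := by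
    filter_upwards [integrable_slices im,
      integrable_slices (F := fun t x => |P.thermalStress θb lam θ t x * divergence (Du' t x)|)
        ib.abs,
      integrable_slices (F := fun t x => P.heatSource θb lam τ θ Du' εp' t x * ψ (θ t x)) is,
      ae_ae_of_ae_cyl' (h.dissipation_le hlam)] with t jm jb js hdis
    rw [← integral_const_mul, ← integral_const_mul,
      ← integral_add (jb.const_mul B) (jm.const_mul B)]
    refine integral_mono_ae js ((jb.const_mul B).add (jm.const_mul B)) ?_
    filter_upwards [hdis] with x hx
    calc P.heatSource θb lam τ θ Du' εp' t x * ψ (θ t x)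
        ≤ |P.heatSource θb lam τ θ Du' εp' t x| * |ψ (θ t x)| := by
          rw [← abs_mul]; exact le_abs_self _
      _ ≤ (|P.thermalStress θb lam θ t x * divergence (Du' t x)| + dissipation lam τ εp' t x)
            * B := by
          refine mul_le_mul ?_ (hB _) (abs_nonneg _) (add_nonneg (abs_nonneg _) hx.1)
          refine (abs_add_le _ _).trans ?_
          rw [neg_mul, abs_neg, abs_of_nonneg hx.1]
      _ = _ := by ring
  refine setIntegral_Ioo_le_of_ae_le hP.T_pos l5 ?_
  filter_upwards [h.integral_comp_temperature hP hlam hθb hΨ hψ hd hB hB', hm,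
    ae_restrict_mem measurableSet_Ioo] with s hs hms hsm
  have ii : ∀ {g : ℝ → ℝ}, IntegrableOn g (Ioo 0 P.T) → IntervalIntegrable g volume 0 s :=
    fun hg => intervalIntegrable_of_integrableOn_Ioo hg hsm.1.le hsm.2.le
  have key := intervalIntegral_mono_ae_Ioo hsm l4 ((l3.const_mul B).add (l1.const_mul B)) hpt
  have e1 := intervalIntegral.integral_add (ii (l3.const_mul B)) (ii (l1.const_mul B))
  have e2 : 0 ≤ ∫ x, Ψ (θ s x) ∂P.vol := integral_nonneg fun x => hΨ0 _
  have e3 := mul_le_mul_of_nonneg_left (hQs s hsm) hB0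
  have e4 := mul_le_mul_of_nonneg_left hms hB0
  simp only [Pi.add_apply, intervalIntegral.integral_const_mul, hd'] at key e1 hs
  have e5 : 0 ≤ A * Q := by positivity
  have e6 : 0 ≤ B * (|C| * Q) := by positivity
  linarith

/-- The Boccardo-Gallouët estimate. -/
theorem Admissible.exists_temperature_estimate (hP : P.Admissible) {θb : ℝ → E3 → ℝ}
    (hθb : MemL2L2 P.T P.vol θb) :
    ∃ ν₀ : ℝ, 0 < ν₀ ∧ ∀ ν : ℝ, 0 < ν → ν ≤ ν₀ → ∃ C : ℝ, ∀ lam, 0 < lam →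
      ∀ u τ εp θ u' Du Du' εp' θ' Gθ, P.SolvesApprox θb lam u τ εp θ u' Du Du' εp' θ' Gθ →
      (∫ t in Ioo 0 P.T, ∫ x, bracket (θ t x) ^ (5 / 3 - ν) ∂P.vol)
        + ∫ t in Ioo 0 P.T, ∫ x, bracket (θ t x) ^ (-(1 + ν)) * ‖Gθ t x‖ ^ 2 ∂P.vol ≤ C := by
  have := hP.isFiniteMeasure_vol
  have : IsFiniteMeasure (volume.restrict P.Ω) := hP.isFiniteMeasure_vol
  obtain ⟨p, K, hp, hK0, hK⟩ := hP.exists_thermalStress_sq_le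
  obtain ⟨CA, hCA0, hCA⟩ := hP.exists_energy_estimate hθb
  -- The first bound is required by the spatial interpolation, the second ensures p ≤ 5/3 - ν, so
  -- that f² is dominated by the power to be absorbed.
  refine ⟨min (1 / 3) (5 / 3 - p), lt_min (by norm_num) (by linarith), fun ν hν hν₀ => ?_⟩
  have hν3 : ν ≤ 1 / 3 := hν₀.trans (min_le_left _ _)
  have hνp : p ≤ 5 / 3 - ν := by linarith [hν₀.trans (min_le_right (1 / 3) (5 / 3 - p))]
  obtain ⟨CG, hCG0, hCG⟩ := hP.exists_gradient_estimate hθb hν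
  obtain ⟨CS, hCS0, hCS⟩ := integral_bracket_rpow_le hP.isOpen hP.isBounded hP.c2Boundary hν hν3 CA
  have hT := hP.T_pos
  have hbi : Integrable (fun p : ℝ × E3 => θb p.1 p.2 ^ 2) (cyl P.T P.vol) :=
    MemLp.integrable_sq hθb
  set Cb := ∫ t in Ioo 0 P.T, ∫ x, θb t x ^ 2 ∂P.vol with hCb
  have hCb0 : 0 ≤ Cb := integral_nonneg fun t => integral_nonneg fun x => sq_nonneg _
  -- Chosen so that X returns with a factor of at most 1/2 after one pass through the thermal power,
  -- the gradient estimate and the interpolation; the summand 1 only keeps the denominator positive.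
  set δ : ℝ := 1 / (2 * (CS * CG * K + 1)) with hδ
  have hδ0 : 0 < δ := by positivity
  have hδK : CS * CG * (δ * K) ≤ 1 / 2 := by
    rw [hδ, show CS * CG * (1 / (2 * (CS * CG * K + 1)) * K)
      = (CS * CG * K) / (2 * (CS * CG * K + 1)) by ring, div_le_div_iff₀ (by positivity) two_pos]
    linarith
  -- The loop reads X ≤ X/2 + X₀/2.
  set X₀ : ℝ := 2 * (CS * (P.T + CG * (1 + δ * K * Cb + 3 / (4 * δ) * CA))) with hX₀
  have hX₀0 : 0 ≤ X₀ := by positivity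
  refine ⟨X₀ + CG * (1 + δ * K * (X₀ + Cb) + 3 / (4 * δ) * CA), ?_⟩
  intro lam hlam u τ εp θ u' Du Du' εp' θ' Gθ h
  obtain ⟨hCA1, hCA2⟩ := hCA lam hlam u τ εp θ u' Du Du' εp' θ' Gθ h
  have hgrad := hCG lam hlam u τ εp θ u' Du Du' εp' θ' Gθ h
  have iw := h.integrable_strainRateSq hP
  have ib := h.integrable_thermalPower hP hlam hθb
  have hθm := h.memL2L2_temperature.1
  have ix : Integrable (fun q : ℝ × E3 => bracket (θ q.1 q.2) ^ (5 / 3 - ν)) (cyl P.T P.vol) :=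
    integrable_bracket_rpow h.memL2L2_temperature (by linarith)
  have ig : Integrable (fun q : ℝ × E3 => bracket (θ q.1 q.2) ^ (-(1 + ν)) * ‖Gθ q.1 q.2‖ ^ 2)
    (cyl P.T P.vol) := integrable_bracket_rpow_neg_mul hθm h.θ_space.2.1 (by linarith)
  have l0 := integrableOn_integral iw
  have l1 := integrableOn_integral (F := fun t x => bracket (θ t x) ^ (5 / 3 - ν)) ix
  have l2 := integrableOn_integral (F := fun t x => bracket (θ t x) ^ (-(1 + ν)) * ‖Gθ t x‖ ^ 2) ig
  have l3 := integrableOn_integral (F := fun t x => |P.thermalStress θb lam θ t x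
    * divergence (Du' t x)|) ib.abs
  have l4 := integrableOn_integral (F := fun t x => θb t x ^ 2) hbi
  set X := ∫ t in Ioo 0 P.T, ∫ x, bracket (θ t x) ^ (5 / 3 - ν) ∂P.vol with hX
  set I := ∫ t in Ioo 0 P.T, ∫ x, bracket (θ t x) ^ (-(1 + ν)) * ‖Gθ t x‖ ^ 2 ∂P.vol with hI
  set Q := ∫ t in Ioo 0 P.T,
    ∫ x, |P.thermalStress θb lam θ t x * divergence (Du' t x)| ∂P.vol with hQ
  have hXI : X ≤ CS * (P.T + I) := by
    have e1 : ∫ t in Ioo 0 P.T, CS * (1 + ∫ x, bracket (θ t x) ^ (-(1 + ν)) * ‖Gθ t x‖ ^ 2 ∂P.vol)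
        = CS * (P.T + I) := by
      rw [integral_const_mul, integral_add (integrable_const _) l2, ← hI]
      simp [hT.le]
    rw [← e1]
    refine integral_mono_ae l1 (((integrable_const _).add l2).const_mul _) ?_
    filter_upwards [h.θ_space.2.2, hCA1] with t ht ht'
    exact hCS _ _ ht ht'
  have l14 : IntegrableOn (fun t => ∫ x, bracket (θ t x) ^ (5 / 3 - ν) ∂P.vol
    + ∫ x, θb t x ^ 2 ∂P.vol) (Ioo 0 P.T) := l1.add l4
  have hQX : Q ≤ δ * K * (X + Cb) + 3 / (4 * δ) * CA := by
    have e1 : ∫ t in Ioo 0 P.T, (δ * K * (∫ x, bracket (θ t x) ^ (5 / 3 - ν) ∂P.vol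
        + ∫ x, θb t x ^ 2 ∂P.vol) + 3 / (4 * δ) * ∫ x, strainRateSq Du' t x ∂P.vol)
        = δ * K * (X + Cb) + 3 / (4 * δ) * ∫ t in Ioo 0 P.T, ∫ x, strainRateSq Du' t x ∂P.vol := by
      rw [integral_add (l14.const_mul _) (l0.const_mul _), integral_const_mul,
        integral_const_mul, integral_add l1 l4]
    have e2 : Q ≤ δ * K * (X + Cb)
        + 3 / (4 * δ) * ∫ t in Ioo 0 P.T, ∫ x, strainRateSq Du' t x ∂P.vol := by
      rw [← e1]
      refine integral_mono_ae l3 ((l14.const_mul _).add (l0.const_mul _)) ?_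
      filter_upwards [integrable_slices iw,
        integrable_slices (F := fun t x => |P.thermalStress θb lam θ t x * divergence (Du' t x)|)
          ib.abs,
        integrable_slices (F := fun t x => bracket (θ t x) ^ (5 / 3 - ν)) ix,
        integrable_slices (F := fun t x => θb t x ^ 2) hbi] with t jw jb jx jθ
      have jxθ : Integrable (fun x => bracket (θ t x) ^ (5 / 3 - ν) + θb t x ^ 2) P.vol :=
        jx.add jθ
      rw [← integral_add jx jθ, ← integral_const_mul, ← integral_const_mul,
        ← integral_add (jxθ.const_mul _) (jw.const_mul _)]
      refine integral_mono jb ((jxθ.const_mul _).add (jw.const_mul _)) fun x => ?_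
      have q1 := hK lam hlam (θ t x) (θb t x)
      have q2 := divergence_sq_le (Du' t x)
      rw [show P.f (trunc (1 / lam) (θ t x + θb t x)) = P.thermalStress θb lam θ t x from rfl] at q1
      rw [show frob (symGrad (Du' t x)) (symGrad (Du' t x)) = strainRateSq Du' t x from rfl] at q2
      set b := P.thermalStress θb lam θ t x
      set d := divergence (Du' t x)
      have q3 : bracket (θ t x) ^ p ≤ bracket (θ t x) ^ (5 / 3 - ν) :=
        Real.rpow_le_rpow_of_exponent_le (one_le_bracket _) hνp
      have q4 : |b * d| ≤ δ * b ^ 2 + 1 / (4 * δ) * d ^ 2 := by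
        rw [abs_mul, ← sq_abs b, ← sq_abs d]
        have : δ * |b| ^ 2 + 1 / (4 * δ) * |d| ^ 2 - |b| * |d|
          = δ * (|b| - 1 / (2 * δ) * |d|) ^ 2 := by
          field_simp
          ring
        have : 0 ≤ δ * (|b| - 1 / (2 * δ) * |d|) ^ 2 := by positivity
        linarith
      have q5 : b ^ 2 ≤ K * (bracket (θ t x) ^ (5 / 3 - ν) + θb t x ^ 2) :=
        q1.trans (mul_le_mul_of_nonneg_left (by linarith) hK0)
      have q6 := mul_le_mul_of_nonneg_left q5 hδ0.le
      have q7 := mul_le_mul_of_nonneg_left q2 (by positivity : 0 ≤ 1 / (4 * δ))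
      calc |b * d| ≤ δ * (K * (bracket (θ t x) ^ (5 / 3 - ν) + θb t x ^ 2))
            + 1 / (4 * δ) * (3 * strainRateSq Du' t x) := by linarith
        _ = _ := by ring
    refine e2.trans ?_
    gcongr
  have hIX : I ≤ CG * (1 + δ * K * (X + Cb) + 3 / (4 * δ) * CA) :=
    hgrad.trans (mul_le_mul_of_nonneg_left (by linarith) hCG0)
  have hX0 : 0 ≤ X := integral_nonneg fun t => integral_nonneg fun x =>
    Real.rpow_nonneg (bracket_pos _).le _
  have hXX₀ : X ≤ X₀ := by
    have e1 := mul_le_mul_of_nonneg_left (add_le_add_right hIX P.T) hCS0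
    have e2 : CS * (P.T + CG * (1 + δ * K * (X + Cb) + 3 / (4 * δ) * CA))
        = CS * CG * (δ * K) * X + X₀ / 2 := by
      rw [hX₀]; ring
    have e3 := mul_le_mul_of_nonneg_right hδK hX0
    linarith
  refine add_le_add hXX₀ (hIX.trans ?_)
  gcongr

end Model

/-! ### From the weighted gradient to `W^{1,q}` -/

/-- Young's inequality with weights 1 - q/2 and q/2: a^q is a product of a power of J^{-(1+ν)} a²
and a compensating power of the bracket J, which becomes J^{(1+ν)q/(2-q)}. That exponent is at most
5/3 - ν precisely when ν ≤ 5/3 - 4q/3. -/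
theorem rpow_le_bracket_rpow_add {q ν a s : ℝ} (hq1 : 1 ≤ q) (ha : 0 ≤ a)
    (hν0 : 0 < ν) (hν : ν ≤ 5 / 3 - 4 * q / 3) :
    a ^ q ≤ bracket s ^ (5 / 3 - ν) + bracket s ^ (-(1 + ν)) * a ^ 2 := by
  have hJ := bracket_pos s
  have hJ1 := one_le_bracket s
  have hJn : ∀ p : ℝ, 0 ≤ bracket s ^ p := fun p => Real.rpow_nonneg hJ.le p
  have h1 : 1 - q / 2 ≠ 0 := by linarith
  have h2 : (1 + ν) * q / (2 - q) ≤ 5 / 3 - ν := by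
    rw [div_le_iff₀ (by linarith)]
    nlinarith
  have h3 := Real.geom_mean_le_arith_mean2_weighted (w₁ := 1 - q / 2) (w₂ := q / 2)
    (p₁ := bracket s ^ ((1 + ν) * q / (2 - q))) (p₂ := bracket s ^ (-(1 + ν)) * a ^ 2)
    (by linarith) (by linarith) (hJn _) (mul_nonneg (hJn _) (sq_nonneg a)) (by ring)
  have h4 : (bracket s ^ ((1 + ν) * q / (2 - q))) ^ (1 - q / 2)
      * (bracket s ^ (-(1 + ν)) * a ^ 2) ^ (q / 2) = a ^ q := by
    rw [Real.mul_rpow (hJn _) (sq_nonneg a), ← Real.rpow_mul hJ.le, ← Real.rpow_mul hJ.le,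
      ← mul_assoc, ← Real.rpow_add hJ, ← Real.rpow_natCast, ← Real.rpow_mul ha]
    have e1 : (1 + ν) * q / (2 - q) * (1 - q / 2) + -(1 + ν) * (q / 2) = 0 := by
      have : 2 - q ≠ 0 := by linarith
      field_simp
      ring
    rw [e1, Real.rpow_zero, one_mul]
    congr 1
    push_cast
    ring
  have h5 := Real.rpow_le_rpow_of_exponent_le hJ1 h2
  have h6 : (1 - q / 2) * bracket s ^ ((1 + ν) * q / (2 - q)) ≤ bracket s ^ (5 / 3 - ν) := by
    have := mul_le_of_le_one_left (hJn ((1 + ν) * q / (2 - q))) (by linarith : 1 - q / 2 ≤ 1)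
    linarith
  have h7 : q / 2 * (bracket s ^ (-(1 + ν)) * a ^ 2) ≤ bracket s ^ (-(1 + ν)) * a ^ 2 :=
    mul_le_of_le_one_left (mul_nonneg (hJn _) (sq_nonneg a)) (by linarith)
  linarith

theorem enorm_rpow_eq_ofReal {X : Type*} [NormedAddCommGroup X] (a : X) {q : ℝ} (hq : 0 ≤ q) :
    ‖a‖ₑ ^ q = ENNReal.ofReal (‖a‖ ^ q) := by
  rw [← ofReal_norm, ENNReal.ofReal_rpow_of_nonneg (norm_nonneg _) hq]

theorem Model.SolvesApprox.normLqW1q_le {P : Model} (hP : P.Admissible) {θb : ℝ → E3 → ℝ}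
    {lam : ℝ} {u : ℝ → E3 → E3} {τ εp : ℝ → E3 → Mat} {θ : ℝ → E3 → ℝ} {u' : ℝ → E3 → E3}
    {Du Du' : ℝ → E3 → Fin 3 → E3} {εp' : ℝ → E3 → Mat} {θ' : ℝ → E3 → ℝ} {Gθ : ℝ → E3 → E3}
    (h : P.SolvesApprox θb lam u τ εp θ u' Du Du' εp' θ' Gθ) {q ν : ℝ} (hq1 : 1 ≤ q)
    (hν0 : 0 < ν) (hν : ν ≤ 5 / 3 - 4 * q / 3) :
    normLqW1q P.T P.Ω q θ Gθ
      ≤ ENNReal.ofReal (2 * (∫ t in Ioo 0 P.T, ∫ x, bracket (θ t x) ^ (5 / 3 - ν) ∂P.vol)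
        + ∫ t in Ioo 0 P.T, ∫ x, bracket (θ t x) ^ (-(1 + ν)) * ‖Gθ t x‖ ^ 2 ∂P.vol) ^ (1 / q) := by
  have := hP.isFiniteMeasure_vol
  have ix : Integrable (fun p : ℝ × E3 => bracket (θ p.1 p.2) ^ (5 / 3 - ν)) (cyl P.T P.vol) :=
    integrable_bracket_rpow h.memL2L2_temperature (by linarith)
  have ig : Integrable (fun p : ℝ × E3 => bracket (θ p.1 p.2) ^ (-(1 + ν)) * ‖Gθ p.1 p.2‖ ^ 2)
    (cyl P.T P.vol) :=
    integrable_bracket_rpow_neg_mul h.memL2L2_temperature.1 h.θ_space.2.1 (by linarith)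
  have l1 := integrableOn_integral (F := fun t x => bracket (θ t x) ^ (5 / 3 - ν)) ix
  have l2 := integrableOn_integral (F := fun t x => bracket (θ t x) ^ (-(1 + ν)) * ‖Gθ t x‖ ^ 2) ig
  have n1 : ∀ t x, 0 ≤ bracket (θ t x) ^ (5 / 3 - ν) := fun t x =>
    Real.rpow_nonneg (bracket_pos _).le _
  have n2 : ∀ t x, 0 ≤ bracket (θ t x) ^ (-(1 + ν)) * ‖Gθ t x‖ ^ 2 := fun t x =>
    mul_nonneg (Real.rpow_nonneg (bracket_pos _).le _) (sq_nonneg _)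
  have m1 : ∀ t, 0 ≤ ∫ x, bracket (θ t x) ^ (5 / 3 - ν) ∂P.vol := fun t => integral_nonneg (n1 t)
  have m2 : ∀ t, 0 ≤ ∫ x, bracket (θ t x) ^ (-(1 + ν)) * ‖Gθ t x‖ ^ 2 ∂P.vol := fun t =>
    integral_nonneg (n2 t)
  have l12 : IntegrableOn (fun t => 2 * ∫ x, bracket (θ t x) ^ (5 / 3 - ν) ∂P.vol
      + ∫ x, bracket (θ t x) ^ (-(1 + ν)) * ‖Gθ t x‖ ^ 2 ∂P.vol) (Ioo 0 P.T) :=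
    (l1.const_mul 2).add l2
  refine ENNReal.rpow_le_rpow ?_ (by positivity)
  rw [← integral_const_mul, ← integral_add (l1.const_mul 2) l2,
    ofReal_integral_eq_lintegral_ofReal l12 (Eventually.of_forall fun t =>
      add_nonneg (mul_nonneg zero_le_two (m1 t)) (m2 t))]
  refine lintegral_mono_ae ?_
  filter_upwards [integrable_slices (F := fun t x => bracket (θ t x) ^ (5 / 3 - ν)) ix,
    integrable_slices (F := fun t x => bracket (θ t x) ^ (-(1 + ν)) * ‖Gθ t x‖ ^ 2) ig] with t j1 j2
  have e1 : ∫⁻ x in P.Ω, ‖θ t x‖ₑ ^ q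
      ≤ ENNReal.ofReal (∫ x, bracket (θ t x) ^ (5 / 3 - ν) ∂P.vol) := by
    rw [ofReal_integral_eq_lintegral_ofReal j1 (Eventually.of_forall (n1 t))]
    refine lintegral_mono fun x => ?_
    rw [enorm_rpow_eq_ofReal _ (by linarith)]
    refine ENNReal.ofReal_le_ofReal ?_
    rw [Real.norm_eq_abs]
    exact (Real.rpow_le_rpow (abs_nonneg _) (abs_le_bracket _) (by linarith)).trans
      (Real.rpow_le_rpow_of_exponent_le (one_le_bracket _) (by linarith))
  have e2 : ∫⁻ x in P.Ω, ‖Gθ t x‖ₑ ^ q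
      ≤ ENNReal.ofReal (∫ x, bracket (θ t x) ^ (5 / 3 - ν) ∂P.vol
        + ∫ x, bracket (θ t x) ^ (-(1 + ν)) * ‖Gθ t x‖ ^ 2 ∂P.vol) := by
    have j12 : Integrable (fun x => bracket (θ t x) ^ (5 / 3 - ν)
        + bracket (θ t x) ^ (-(1 + ν)) * ‖Gθ t x‖ ^ 2) P.vol := j1.add j2
    rw [← integral_add j1 j2, ofReal_integral_eq_lintegral_ofReal j12
      (Eventually.of_forall fun x => add_nonneg (n1 t x) (n2 t x))]
    refine lintegral_mono fun x => ?_
    rw [enorm_rpow_eq_ofReal _ (by linarith)]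
    exact ENNReal.ofReal_le_ofReal
      (rpow_le_bracket_rpow_add hq1 (norm_nonneg _) hν0 hν)
  refine (add_le_add e1 e2).trans_eq ?_
  rw [← ENNReal.ofReal_add (m1 t) (add_nonneg (m1 t) (m2 t))]
  congr 1
  ring

end ThermoPlasticity

theorem lemma4p4 (P : ThermoPlasticity.Model) (hP : P.Admissible)
    (θb : ℝ → ThermoPlasticity.E3 → ℝ) (hθb : P.IsBoundaryLift θb)
    (q : ℝ) (hq1 : 1 ≤ q) (hq2 : q < 5 / 4) :
    ∃ C : ℝ≥0, ∀ lam : ℝ, 0 < lam →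
      ∀ (u : ℝ → ThermoPlasticity.E3 → ThermoPlasticity.E3)
        (τ εp : ℝ → ThermoPlasticity.E3 → ThermoPlasticity.Mat)
        (θ : ℝ → ThermoPlasticity.E3 → ℝ),
        P.IsApproxSolution θb lam u τ εp θ →
          ∃ G : ℝ → ThermoPlasticity.E3 → ThermoPlasticity.E3,
            ThermoPlasticity.MemLqW1q P.T P.Ω q θ G ∧
              ThermoPlasticity.normLqW1q P.T P.Ω q θ G ≤ C := by
  obtain ⟨_, _, _, hθbH, -⟩ := hθb
  obtain ⟨ν₀, hν₀, hest⟩ := hP.exists_temperature_estimate hθbH.1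
  -- The only place where q < 5/4 is used directly: it leaves room for a positive ν.
  have hν : 0 < min ν₀ (5 / 3 - 4 * q / 3) := lt_min hν₀ (by linarith)
  obtain ⟨C, hC⟩ := hest _ hν (min_le_left _ _)
  -- The norm is controlled by 2X + I, where X bounds both the function and part of the gradient,
  -- and 2X + I ≤ 2(X + I).
  set K : ℝ≥0∞ := ENNReal.ofReal (2 * C) ^ (1 / q) with hK
  have hKtop : K ≠ ⊤ := ENNReal.rpow_ne_top_of_nonneg (by positivity) ENNReal.ofReal_ne_top
  refine ⟨K.toNNReal, ?_⟩
  rintro lam hlam u τ εp θ ⟨u', Du, Du', εp', θ', Gθ, h⟩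
  have hle : ThermoPlasticity.normLqW1q P.T P.Ω q θ Gθ ≤ K := by
    refine (h.normLqW1q_le hP hq1 hν (min_le_right _ _)).trans ?_
    refine ENNReal.rpow_le_rpow (ENNReal.ofReal_le_ofReal ?_) (by positivity)
    have h1 := hC lam hlam u τ εp θ u' Du Du' εp' θ' Gθ h
    have h2 : 0 ≤ ∫ t in Ioo 0 P.T, ∫ x, ThermoPlasticity.bracket (θ t x)
        ^ (-(1 + min ν₀ (5 / 3 - 4 * q / 3))) * ‖Gθ t x‖ ^ 2 ∂P.vol :=
      integral_nonneg fun t => integral_nonneg fun x =>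
        mul_nonneg (Real.rpow_nonneg (ThermoPlasticity.bracket_pos _).le _) (sq_nonneg _)
    linarith
  refine ⟨Gθ, ⟨h.θ_space.1.1, h.θ_space.2.1.1, ?_, hle.trans_lt hKtop.lt_top⟩, ?_⟩
  · exact h.θ_space.2.2.mono fun t ht => ht.2.2
  · rwa [ENNReal.coe_toNNReal hKtop]
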